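/- **Conventions.** "Lax" means "from many to one". For a bicategory $\mathscr B$, $\mathscr{NB}$ is its Duskin nerve: an $n$-simplex is a normalised (strictly unital) lax functor $[n]\to\mathscr B$, i.e. objects $x_i$, 1-cells $f_{ij}$ and 2-cells $f_{jk}\circ f_{ij}\Rightarrow f_{ik}$, normalised for $i=j$ or $j=k$ and satisfying the cocycle condition for $i\le j\le k\le l$. For a monoidal category $\mathscr V$ put $\mathscr V^\triangle=\mathscr N\mathscr B\mathscr V$, where $\mathscr{BV}$ is the one-object bicategory with $g\circ f=g\otimes f$; thus a 1-simplex is an object and a 2-simplex is a map $x_{12}\otimes x_{01}\to x_{02}$. A normal lax monoidal functor (lax monoidal, unit constraint an identity) induces a map $\mathscr V^\triangle\to\mathscr W^\triangle$. The upper décalage of a simplicial set $X$ is $(\mathrm{dec}\,X)_n=X_{n+1}$ with top faces and degeneracies forgotten. A *unary operadic 2-category* $\mathbb O=(X,\mathscr C)$ is a simplicial set $X$ with a strict 2-category $\mathscr C$ and an isomorphism $\mathrm{dec}\,X\cong\mathscr{NC}$. Operadic functors are the maps of the underlying simplicial sets; they form the category $\mathrm{uOpCat}$. The terminal object is $\odot$.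 A *categorical $\mathbb O$-operad* $P$ consists of categories $P_A$ ($A\in X_1$), functors $P_{d_0f}\times P_{d_2f}\to P_{d_1f}$, $(b,p)\mapsto b\cdot_f p$ ($f\in X_2$), and objects $e_c\in P_{s_0c}$ ($c\in X_0$), such that, as equalities of functors, $$(a\cdot_{d_0s}b)\cdot_{d_2s}c=a\cdot_{d_1s}(b\cdot_{d_3s}c)\quad(s\in X_3),\qquad a\cdot_{s_0A}e_{d_1A}=a=e_{d_0A}\cdot_{s_1A}a\quad(A\in X_1).$$ A *morphism* $F:P\to Q$ is a normalised lax one: functors $F_A:P_A\to Q_A$ with $F(e_c)=e_c$ and natural maps $Fb\cdot_f Fp\to F(b\cdot_f p)$ which satisfy the associativity coherence over every $s\in X_3$ and are identities when $f=s_0A$, $p=e$ and when $f=s_1A$, $b=e$. These form the category $\mathrm{Oper}_{\mathbb O}(\mathrm{Cat})$. Let $\int_{\mathbb O}P$ be the following simplicial set over $X$. An $n$-simplex consists of $x\in X_n$, objects $a_{ij}\in P_{x_{ij}}$ for $i\le j$, where $x_{ij}$ is the edge of $x$ from $i$ to $j$, with $a_{ii}=e$, and maps $a_{jk}\cdot a_{ij}\to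 a_{ik}$ for $i\le j\le k$, the product being taken over the face $x_{ijk}$; these maps are identities for $i=j$ or $j=k$, and for all $i\le j\le k\le l$ the two composites $a_{kl}\cdot a_{jk}\cdot a_{ij}\to a_{il}$ agree. A morphism $F$ sends $(x,a_{ij},\alpha_{ijk})$ to $x$ with the objects $Fa_{ij}$ and the maps $Fa_{jk}\cdot Fa_{ij}\to F(a_{jk}\cdot a_{ij})\to Fa_{ik}$. **Theorem.** 1. For every unary operadic 2-category $\mathbb O=(X,\mathscr C)$, the construction $P\mapsto(\int_{\mathbb O}P\to X)$ lifts to a functor $$\textstyle\int_{\mathbb O}:\mathrm{Oper}_{\mathbb O}(\mathrm{Cat})\to\mathrm{uOpCat}/\mathbb O$$ (in particular $\mathrm{dec}\int_{\mathbb O}P\cong\mathscr N\mathscr C_P$ for some strict 2-category $\mathscr C_P$), and this functor is fully faithful. 2. In particular, let $\mathrm{StrMonCat}$ be the category of strict monoidal categories and normal lax monoidal functors, and regard a strict monoidal category $\mathscr V$ as the categorical $\odot$-operad with the single category $\mathscr V$, product $\otimes$ and unit the monoidal unit. Then $\int_\odot:\mathrm{StrMonCat}\to\mathrm{uOpCat}$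 is fully faithful, and $\int_\odot\mathscr V\cong\mathscr V^\triangle$ naturally in $\mathscr V$. 3. Let $1/\mathrm{Cat}$ be the lax coslice category: objects are pairs $(D,d)$ with $D$ a (small) category and $d\in D$, morphisms $(D,d)\to(E,e)$ are pairs of a functor $H:D\to E$ and a map $Hd\to e$, and the monoidal structure is the cartesian product. Let $P:X\to\mathrm{Cat}^\triangle$ be a simplicial map, i.e. a 1-connected categorical $\mathbb O$-operad ($P_{s_0c}=1$ for all $c\in X_0$). Then there is a pullback square $$\begin{array}{ccc}\int_{\mathbb O}P&\longrightarrow&(1/\mathrm{Cat})^\triangle\\ \downarrow&&\downarrow\\ \mathbb O&\xrightarrow{\;P\;}&\mathrm{Cat}^\triangle\end{array}$$ of simplicial sets, in which the left map is the projection and the right map is induced by the projection $1/\mathrm{Cat}\to\mathrm{Cat}$. -/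

import Mathlib

open CategoryTheory Simplicial Opposite

universe w v u

namespace OperadicGrothendieck

/-! ### The Duskin nerve and the upper décalage -/

/-- A normalised lax functor from the ordinal `[n] = {0 < ⋯ < n}`, viewed as a 2-category with only
identity 2-cells, to a bicategory `B`: an `n`-simplex of the Duskin nerve of `B`.
The 1-cell `hom` for `i = j` is the identity, and the 2-cell `comp` for `i = j` or `j = k` is the
unitor, so that the data are determined by the indices `i < j < k`. -/
structure NerveSimplex (B : Type u) [Bicategory.{w, v} B] (n : ℕ) where
  obj : Fin (n + 1) → B
  hom : ∀ {i j : Fin (n + 1)}, i ≤ j → (obj i ⟶ obj j)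
  /-- the lax triangle `f_jk ∘ f_ij ⇒ f_ik` -/
  comp : ∀ {i j k : Fin (n + 1)} (hij : i ≤ j) (hjk : j ≤ k),
    hom hij ≫ hom hjk ⟶ hom (hij.trans hjk)
  hom_refl : ∀ i, hom (le_refl i) = 𝟙 (obj i)
  comp_refl_left : ∀ {i k : Fin (n + 1)} (h : i ≤ k),
    comp (le_refl i) h =
      Bicategory.whiskerRight (eqToHom (hom_refl i)) (hom h) ≫
        (Bicategory.leftUnitor (hom h)).hom
  comp_refl_right : ∀ {i k : Fin (n + 1)} (h : i ≤ k),
    comp h (le_refl k) =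
      Bicategory.whiskerLeft (hom h) (eqToHom (hom_refl k)) ≫
        (Bicategory.rightUnitor (hom h)).hom
  comp_assoc : ∀ {i j k l : Fin (n + 1)} (hij : i ≤ j) (hjk : j ≤ k) (hkl : k ≤ l),
    Bicategory.whiskerRight (comp hij hjk) (hom hkl) ≫ comp (hij.trans hjk) hkl =
      (Bicategory.associator (hom hij) (hom hjk) (hom hkl)).hom ≫
        Bicategory.whiskerLeft (hom hij) (comp hjk hkl) ≫ comp hij (hjk.trans hkl)

/-- Restriction of a simplex of the nerve along a monotone map. -/
def NerveSimplex.precomp {B : Type u} [Bicategory.{w, v} B] {n m : ℕ} (S : NerveSimplex B n)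
    (φ : Fin (m + 1) →o Fin (n + 1)) : NerveSimplex B m where
  obj i := S.obj (φ i)
  hom h := S.hom (φ.monotone h)
  comp h h' := S.comp (φ.monotone h) (φ.monotone h')
  hom_refl i := S.hom_refl (φ i)
  comp_refl_left h := S.comp_refl_left (φ.monotone h)
  comp_refl_right h := S.comp_refl_right (φ.monotone h)
  comp_assoc h h' h'' := S.comp_assoc (φ.monotone h) (φ.monotone h') (φ.monotone h'')

/-- The Duskin nerve of a bicategory (in particular, of a strict 2-category). -/
def duskinNerve (B : Type u) [Bicategory.{w, v} B] : SSet.{max w v u} where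
  obj n := NerveSimplex B n.unop.len
  map f := ↾fun S => S.precomp f.unop.toOrderHom
  map_id _ := rfl
  map_comp _ _ := rfl

/-- The extension of a monotone map `[n] → [m]` to `[n + 1] → [m + 1]` which preserves the top. -/
def addTopMap {n m : ℕ} (f : Fin (n + 1) →o Fin (m + 1)) : Fin (n + 2) →o Fin (m + 2) where
  toFun := Fin.lastCases (Fin.last (m + 1)) fun i => (f i).castSucc
  monotone' := by
    intro a b
    induction b using Fin.lastCases with
    | last => intro _; simpa using Fin.le_last _
    | cast b =>
      induction a using Fin.lastCases with
      | last => intro h; exact absurd (h.trans_lt b.castSucc_lt_last) (lt_irrefl _)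
      | cast a => intro h; simpa using f.monotone (by simpa using h)

@[simp]
lemma addTopMap_last {n m : ℕ} (f : Fin (n + 1) →o Fin (m + 1)) :
    addTopMap f (Fin.last (n + 1)) = Fin.last (m + 1) :=
  Fin.lastCases_last (motive := fun _ => Fin (m + 2))

@[simp]
lemma addTopMap_castSucc {n m : ℕ} (f : Fin (n + 1) →o Fin (m + 1)) (i : Fin (n + 1)) :
    addTopMap f i.castSucc = (f i).castSucc :=
  Fin.lastCases_castSucc (motive := fun _ => Fin (m + 2)) _

/-- The functor `[n] ↦ [n + 1]` on the simplex category which adds a new top element. -/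
def addTop : SimplexCategory ⥤ SimplexCategory where
  obj n := ⦋n.len + 1⦌
  map f := SimplexCategory.Hom.mk (addTopMap f.toOrderHom)
  map_id n := by
    ext i : 3
    induction i using Fin.lastCases with
    | last => exact addTopMap_last _
    | cast i => exact addTopMap_castSucc _ _
  map_comp {a b c} f g := by
    ext i : 3
    change addTopMap (g.toOrderHom.comp f.toOrderHom) i =
      addTopMap g.toOrderHom (addTopMap f.toOrderHom i)
    induction i using Fin.lastCases with
    | last => simp
    | cast i => simp

/-- The upper décalage: `(dec X)_n = X_{n+1}`, forgetting the top face and degeneracy maps. -/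
def dec (X : SSet.{w}) : SSet.{w} :=
  addTop.op ⋙ X

/-! ### Unary operadic 2-categories -/

/-- A unary operadic 2-category: a simplicial set `X` and a (strict) 2-category `C` together with
an isomorphism of the upper décalage of `X` with the nerve of `C`. -/
structure UOpCat where
  X : SSet.{w}
  C : Type w
  [bicategory : Bicategory.{w, w} C]
  [strict : Bicategory.Strict C]
  decIso : dec X ≅ duskinNerve C

/-- Operadic functors are morphisms of the underlying simplicial sets. -/
structure UOpCat.Hom (O O' : UOpCat.{w}) where
  toSSet : O.X ⟶ O'.X

instance : Category UOpCat.{w} where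
  Hom := UOpCat.Hom
  id O := ⟨𝟙 O.X⟩
  comp f g := ⟨f.toSSet ≫ g.toSSet⟩

/-- The underlying simplicial set of a unary operadic 2-category. -/
def UOpCat.forget : UOpCat.{w} ⥤ SSet.{w} where
  obj O := O.X
  map f := f.toSSet

instance {n : ℕ} : Subsingleton (NerveSimplex (LocallyDiscrete (Discrete PUnit.{w + 1})) n) where
  allEq := by
    rintro ⟨o, h, c, _, _, _, _⟩ ⟨o', h', c', _, _, _, _⟩
    obtain rfl : o = o' := by
      funext i
      rcases o i with ⟨⟨⟨⟩⟩⟩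
      rcases o' i with ⟨⟨⟨⟩⟩⟩
      rfl
    obtain rfl : @h = @h' := by
      funext i j hij
      exact Subsingleton.elim (α := Discrete (_ ⟶ _)) _ _
    obtain rfl : @c = @c' := by
      funext i j k hij hjk
      exact Subsingleton.elim _ _
    rfl

/-- The terminal unary operadic 2-category `⊙`: one simplex in each dimension, and the 2-category
with one object, one 1-cell and one 2-cell. -/
def UOpCat.terminal : UOpCat.{w} where
  X := (Functor.const _).obj PUnit
  C := LocallyDiscrete (Discrete PUnit.{w + 1})
  decIso := NatIso.ofComponents (fun n =>
    { hom := ↾fun _ =>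
        { obj := fun _ => ⟨⟨⟨⟩⟩⟩
          hom := fun _ => 𝟙 _
          comp := fun _ _ => 𝟙 _
          hom_refl := fun _ => rfl
          comp_refl_left := fun _ => Subsingleton.elim _ _
          comp_refl_right := fun _ => Subsingleton.elim _ _
          comp_assoc := fun _ _ _ => Subsingleton.elim _ _ }
      inv := ↾fun _ => ⟨⟩
      hom_inv_id := rfl
      inv_hom_id := by
        ext S
        exact Subsingleton.elim
          (α := NerveSimplex (LocallyDiscrete (Discrete PUnit.{w + 1})) n.unop.len) _ _ })
    (fun f => rfl)

/-! ### Categorical operads -/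

/-- `f` is a 2-simplex with edges `d₀ f = B`, `d₂ f = A` and `d₁ f = C`. -/
structure IsTri {X : SSet.{w}} (f : X _⦋2⦌) (B A C : X _⦋1⦌) : Prop where
  d0 : X.δ 0 f = B
  d2 : X.δ 2 f = A
  d1 : X.δ 1 f = C

lemma isTri_σ₀ {X : SSet.{w}} (A : X _⦋1⦌) : IsTri (X.σ 0 A) A (X.σ 0 (X.δ 1 A)) A where
  d0 := ConcreteCategory.congr_hom (X.δ_comp_σ_self (i := 0)) A
  d2 := ConcreteCategory.congr_hom (X.δ_comp_σ_of_gt (i := 1) (j := 0) (by decide)) A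
  d1 := ConcreteCategory.congr_hom (X.δ_comp_σ_succ (i := 0)) A

lemma isTri_σ₁ {X : SSet.{w}} (A : X _⦋1⦌) : IsTri (X.σ 1 A) (X.σ 0 (X.δ 0 A)) A A where
  d0 := ConcreteCategory.congr_hom (X.δ_comp_σ_of_le (i := 0) (j := 0) (by decide)) A
  d2 := ConcreteCategory.congr_hom (X.δ_comp_σ_succ (i := 1)) A
  d1 := ConcreteCategory.congr_hom (X.δ_comp_σ_self (i := 1)) A

/-- A categorical operad over a simplicial set `X` (the underlying simplicial set of a unary
operadic 2-category `(X, C)`). The objects, 1-cells and lax triangles of `C` are the elements of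
`X₁`, `X₂` and `X₃`; the fibre of a 1-cell `f : d₁ f ⟶ d₀ f` is `d₂ f`, the local lali-terminal
objects are the `s₀ c` for `c ∈ X₀`. The operad consists of categories `P_A` for `A ∈ X₁`, functors
`P_{d₀ f} × P_{d₂ f} ⥤ P_{d₁ f}` for `f ∈ X₂`, written `(b, p) ↦ b ·_f p`, and units
`e_c ∈ P_{s₀ c}` for `c ∈ X₀`. The edges of `f` are passed to `mul` up to propositional equality,
so that the laws can be stated without transport. -/
structure CatOperad (X : SSet.{w}) where
  cat : X _⦋1⦌ → Cat.{v, u}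
  mul : ∀ {B A C : X _⦋1⦌} (f : X _⦋2⦌), IsTri f B A C → (cat B × cat A ⥤ cat C)
  unit : ∀ c : X _⦋0⦌, cat (X.σ 0 c)
  /-- `(a₂₃ · a₁₂) · a₀₁ = a₂₃ · (a₁₂ · a₀₁)`, the products being taken over the four faces of a
  3-simplex -/
  assoc : ∀ (s : X _⦋3⦌) {A₀₁ A₁₂ A₂₃ A₀₂ A₁₃ A₀₃ : X _⦋1⦌}
    (h₀ : IsTri (X.δ 0 s) A₂₃ A₁₂ A₁₃) (h₁ : IsTri (X.δ 1 s) A₂₃ A₀₂ A₀₃)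
    (h₂ : IsTri (X.δ 2 s) A₁₃ A₀₁ A₀₃) (h₃ : IsTri (X.δ 3 s) A₁₂ A₀₁ A₀₂),
    ((mul _ h₀).prod (𝟭 (cat A₀₁))) ⋙ mul _ h₂ =
      prod.associator (cat A₂₃) (cat A₁₂) (cat A₀₁) ⋙
        ((𝟭 (cat A₂₃)).prod (mul _ h₃)) ⋙ mul _ h₁
  /-- `a · e = a` -/
  mul_unit : ∀ A : X _⦋1⦌,
    (𝟭 (cat A)).prod' ((Functor.const _).obj (unit (X.δ 1 A))) ⋙ mul (X.σ 0 A) (isTri_σ₀ A) =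
      𝟭 (cat A)
  /-- `e · a = a` -/
  unit_mul : ∀ A : X _⦋1⦌,
    ((Functor.const _).obj (unit (X.δ 0 A))).prod' (𝟭 (cat A)) ⋙ mul (X.σ 1 A) (isTri_σ₁ A) =
      𝟭 (cat A)

/-- A (normalised lax) morphism of categorical operads: functors `F_A : P_A ⥤ Q_A` which preserve
the units strictly, with natural maps `F b ·_f F p ⟶ F (b ·_f p)` subject to the associativity law
and normalised with respect to the units. -/
@[ext]
structure CatOperad.Hom {X : SSet.{w}} (P Q : CatOperad.{w, v, u} X) where
  app : ∀ A, P.cat A ⥤ Q.cat A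
  lax : ∀ {B A C : X _⦋1⦌} (f : X _⦋2⦌) (h : IsTri f B A C),
    ((app B).prod (app A)) ⋙ Q.mul f h ⟶ P.mul f h ⋙ app C
  app_unit : ∀ c, (app (X.σ 0 c)).obj (P.unit c) = Q.unit c
  lax_assoc : ∀ (s : X _⦋3⦌) {A₀₁ A₁₂ A₂₃ A₀₂ A₁₃ A₀₃ : X _⦋1⦌}
    (h₀ : IsTri (X.δ 0 s) A₂₃ A₁₂ A₁₃) (h₁ : IsTri (X.δ 1 s) A₂₃ A₀₂ A₀₃)
    (h₂ : IsTri (X.δ 2 s) A₁₃ A₀₁ A₀₃) (h₃ : IsTri (X.δ 3 s) A₁₂ A₀₁ A₀₂)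
    (a : P.cat A₂₃) (b : P.cat A₁₂) (c : P.cat A₀₁), ∃ e e',
    (Q.mul _ h₂).map (Prod.mkHom ((lax _ h₀).app (a, b)) (𝟙 ((app A₀₁).obj c))) ≫
        (lax _ h₂).app ((P.mul _ h₀).obj (a, b), c) ≫ eqToHom e =
      eqToHom e' ≫
        (Q.mul _ h₁).map (Prod.mkHom (𝟙 ((app A₂₃).obj a)) ((lax _ h₃).app (b, c))) ≫
          (lax _ h₁).app (a, (P.mul _ h₃).obj (b, c))
  lax_mul_unit : ∀ {A : X _⦋1⦌} (a : P.cat A), ∃ e,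
    (lax _ (isTri_σ₀ A)).app (a, P.unit (X.δ 1 A)) = eqToHom e
  lax_unit_mul : ∀ {A : X _⦋1⦌} (a : P.cat A), ∃ e,
    (lax _ (isTri_σ₁ A)).app (P.unit (X.δ 0 A), a) = eqToHom e

namespace CatOperad

variable {X : SSet.{w}}

lemma mul_unit_obj (P : CatOperad.{w, v, u} X) {A : X _⦋1⦌} (a : P.cat A) :
    (P.mul _ (isTri_σ₀ A)).obj (a, P.unit (X.δ 1 A)) = a :=
  CategoryTheory.Functor.congr_obj (P.mul_unit A) a

lemma unit_mul_obj (P : CatOperad.{w, v, u} X) {A : X _⦋1⦌} (a : P.cat A) :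
    (P.mul _ (isTri_σ₁ A)).obj (P.unit (X.δ 0 A), a) = a :=
  CategoryTheory.Functor.congr_obj (P.unit_mul A) a

/-- The identity morphism. -/
def Hom.id (P : CatOperad.{w, v, u} X) : Hom P P where
  app A := 𝟭 _
  lax f h := 𝟙 _
  app_unit c := rfl
  lax_assoc s A₀₁ _ A₂₃ A₀₂ A₁₃ _ h₀ h₁ h₂ h₃ a b c := by
    refine ⟨CategoryTheory.Functor.congr_obj (P.assoc s h₀ h₁ h₂ h₃) ((a, b), c),
      CategoryTheory.Functor.congr_obj (P.assoc s h₀ h₁ h₂ h₃) ((a, b), c), ?_⟩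
    have h (x : P.cat A₁₃ × P.cat A₀₁) := (P.mul _ h₂).map_id x
    have h' (x : P.cat A₂₃ × P.cat A₀₂) := (P.mul _ h₁).map_id x
    erw [h, h']
    simp
  lax_mul_unit a := ⟨rfl, rfl⟩
  lax_unit_mul a := ⟨rfl, rfl⟩

lemma Hom.lax_mul_unit' {P Q : CatOperad.{w, v, u} X} (F : Hom P Q) {A : X _⦋1⦌} (a : P.cat A)
    (x) (hx : x = P.unit (X.δ 1 A)) : ∃ e, (F.lax _ (isTri_σ₀ A)).app (a, x) = eqToHom e := by
  subst hx
  exact F.lax_mul_unit a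

lemma Hom.lax_unit_mul' {P Q : CatOperad.{w, v, u} X} (F : Hom P Q) {A : X _⦋1⦌} (a : P.cat A)
    (x) (hx : x = P.unit (X.δ 0 A)) : ∃ e, (F.lax _ (isTri_σ₁ A)).app (x, a) = eqToHom e := by
  subst hx
  exact F.lax_unit_mul a

lemma Hom.lax_natural_left {P Q : CatOperad.{w, v, u} X} (F : Hom P Q) {B A C : X _⦋1⦌}
    (f : X _⦋2⦌) (h : IsTri f B A C) {b b' : P.cat B} (g : b ⟶ b') (p : P.cat A) :
    (Q.mul f h).map (Prod.mkHom ((F.app B).map g) (𝟙 ((F.app A).obj p))) ≫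
        (F.lax f h).app (b', p) =
      (F.lax f h).app (b, p) ≫ (F.app C).map ((P.mul f h).map (Prod.mkHom g (𝟙 p))) := by
  rw [← (F.app A).map_id]
  exact (F.lax f h).naturality (Prod.mkHom g (𝟙 p))

lemma Hom.lax_natural_right {P Q : CatOperad.{w, v, u} X} (F : Hom P Q) {B A C : X _⦋1⦌}
    (f : X _⦋2⦌) (h : IsTri f B A C) (b : P.cat B) {p p' : P.cat A} (g : p ⟶ p') :
    (Q.mul f h).map (Prod.mkHom (𝟙 ((F.app B).obj b)) ((F.app A).map g)) ≫
        (F.lax f h).app (b, p') =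
      (F.lax f h).app (b, p) ≫ (F.app C).map ((P.mul f h).map (Prod.mkHom (𝟙 b) g)) := by
  rw [← (F.app B).map_id]
  exact (F.lax f h).naturality (Prod.mkHom (𝟙 b) g)

/-- The structure maps `GF b ·_f GF p ⟶ G (F b ·_f F p) ⟶ GF (b ·_f p)` of a composite. -/
def Hom.compLax {P Q R : CatOperad.{w, v, u} X} (F : Hom P Q) (G : Hom Q R) {B A C : X _⦋1⦌}
    (f : X _⦋2⦌) (h : IsTri f B A C) :
    ((F.app B ⋙ G.app B).prod (F.app A ⋙ G.app A)) ⋙ R.mul f h ⟶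
      P.mul f h ⋙ F.app C ⋙ G.app C where
  app x := (G.lax f h).app ((F.app B).obj x.1, (F.app A).obj x.2) ≫
    (G.app C).map ((F.lax f h).app x)
  naturality x y g := by
    have h₁ := (G.lax f h).naturality (Prod.mkHom ((F.app B).map g.1) ((F.app A).map g.2))
    have h₂ := congrArg (G.app C).map ((F.lax f h).naturality g)
    simp only [Functor.comp_obj, Functor.comp_map, Functor.map_comp, Functor.prod_obj,
      Functor.prod_map] at h₁ h₂ ⊢
    rw [reassoc_of% h₁, h₂, Category.assoc]

lemma Hom.compLax_app {P Q R : CatOperad.{w, v, u} X} (F : Hom P Q) (G : Hom Q R)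
    {B A C : X _⦋1⦌} (f : X _⦋2⦌) (h : IsTri f B A C) (b : P.cat B) (p : P.cat A) :
    (Hom.compLax F G f h).app (b, p) =
      (G.lax f h).app ((F.app B).obj b, (F.app A).obj p) ≫
        (G.app C).map ((F.lax f h).app (b, p)) :=
  rfl

lemma Hom.comp_assoc {P Q R : CatOperad.{w, v, u} X} (F : Hom P Q) (G : Hom Q R)
    (s : X _⦋3⦌) {A₀₁ A₁₂ A₂₃ A₀₂ A₁₃ A₀₃ : X _⦋1⦌}
    (h₀ : IsTri (X.δ 0 s) A₂₃ A₁₂ A₁₃) (h₁ : IsTri (X.δ 1 s) A₂₃ A₀₂ A₀₃)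
    (h₂ : IsTri (X.δ 2 s) A₁₃ A₀₁ A₀₃) (h₃ : IsTri (X.δ 3 s) A₁₂ A₀₁ A₀₂)
    (a : P.cat A₂₃) (b : P.cat A₁₂) (c : P.cat A₀₁) : ∃ e e',
    (R.mul _ h₂).map
          (Prod.mkHom ((Hom.compLax F G _ h₀).app (a, b)) (𝟙 ((F.app A₀₁ ⋙ G.app A₀₁).obj c))) ≫
        (Hom.compLax F G _ h₂).app ((P.mul _ h₀).obj (a, b), c) ≫ eqToHom e =
      eqToHom e' ≫
        (R.mul _ h₁).map
            (Prod.mkHom (𝟙 ((F.app A₂₃ ⋙ G.app A₂₃).obj a)) ((Hom.compLax F G _ h₃).app (b, c))) ≫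
          (Hom.compLax F G _ h₁).app (a, (P.mul _ h₃).obj (b, c)) := by
  obtain ⟨e, e', hF⟩ := F.lax_assoc s h₀ h₁ h₂ h₃ a b c
  obtain ⟨d, d', hG⟩ := G.lax_assoc s h₀ h₁ h₂ h₃ ((F.app _).obj a) ((F.app _).obj b)
    ((F.app _).obj c)
  refine ⟨(congrArg (G.app _).obj e), d', ?_⟩
  have n₂ := G.lax_natural_left _ h₂ ((F.lax _ h₀).app (a, b)) ((F.app A₀₁).obj c)
  have n₁ := G.lax_natural_right _ h₁ ((F.app A₂₃).obj a) ((F.lax _ h₃).app (b, c))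
  have hF' := congrArg (G.app A₀₃).map hF
  have m₂ := (R.mul _ h₂).map_comp
    (Prod.mkHom ((G.lax _ h₀).app ((F.app _).obj a, (F.app _).obj b))
      (𝟙 ((G.app A₀₁).obj ((F.app A₀₁).obj c))))
    (Prod.mkHom ((G.app A₁₃).map ((F.lax _ h₀).app (a, b)))
      (𝟙 ((G.app A₀₁).obj ((F.app A₀₁).obj c))))
  have m₁ := (R.mul _ h₁).map_comp
    (Prod.mkHom (𝟙 ((G.app A₂₃).obj ((F.app A₂₃).obj a)))
      ((G.lax _ h₃).app ((F.app _).obj b, (F.app _).obj c)))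
    (Prod.mkHom (𝟙 ((G.app A₂₃).obj ((F.app A₂₃).obj a)))
      ((G.app A₀₂).map ((F.lax _ h₃).app (b, c))))
  simp only [prod_comp, Category.id_comp, Functor.comp_obj, Functor.map_comp, Hom.compLax_app,
    Functor.prod_obj, eqToHom_map] at n₁ n₂ hF' m₁ m₂ hG ⊢
  rw [m₂, m₁]
  simp only [Category.assoc]
  rw [reassoc_of% n₂, hF', reassoc_of% hG, ← reassoc_of% n₁]

/-- Composition of morphisms. -/
def Hom.comp {P Q R : CatOperad.{w, v, u} X} (F : Hom P Q) (G : Hom Q R) : Hom P R where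
  app A := F.app A ⋙ G.app A
  lax f h := Hom.compLax F G f h
  app_unit c := by
    simp [F.app_unit, G.app_unit]
  lax_assoc s _ _ _ _ _ _ h₀ h₁ h₂ h₃ a b c := Hom.comp_assoc F G s h₀ h₁ h₂ h₃ a b c
  lax_mul_unit {A} a := by
    obtain ⟨e, h⟩ := F.lax_mul_unit a
    obtain ⟨e', h'⟩ := G.lax_mul_unit' ((F.app _).obj a) _ (F.app_unit _)
    refine ⟨e'.trans (congrArg (G.app _).obj e), ?_⟩
    rw [Hom.compLax_app, h, h', eqToHom_map, eqToHom_trans]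
  lax_unit_mul {A} a := by
    obtain ⟨e, h⟩ := F.lax_unit_mul a
    obtain ⟨e', h'⟩ := G.lax_unit_mul' ((F.app _).obj a) _ (F.app_unit _)
    refine ⟨e'.trans (congrArg (G.app _).obj e), ?_⟩
    rw [Hom.compLax_app, h, h', eqToHom_map, eqToHom_trans]

/-- The category of categorical operads over `X`. -/
instance : Category (CatOperad.{w, v, u} X) where
  Hom := Hom
  id := Hom.id
  comp F G := Hom.comp F G
  id_comp {P Q} F := by
    refine Hom.ext (x := Hom.comp (Hom.id P) F) rfl (heq_of_eq ?_)
    funext _ _ C f h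
    ext x
    exact (congrArg _ ((F.app C).map_id _)).trans (Category.comp_id _)
  comp_id {P Q} F := by
    refine Hom.ext (x := Hom.comp F (Hom.id Q)) rfl (heq_of_eq ?_)
    funext _ _ _ f h
    ext x
    exact Category.id_comp _
  assoc {P Q R S} F G H := by
    refine Hom.ext (x := Hom.comp (Hom.comp F G) H) (y := Hom.comp F (Hom.comp G H)) rfl
      (heq_of_eq ?_)
    funext _ _ C f h
    ext x
    exact (congrArg _ ((H.app C).map_comp _ _)).trans (Category.assoc _ _ _).symm

end CatOperad

/-! ### The operadic Grothendieck construction -/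

/-- The vertex `x_i` of a simplex. -/
def vertex {X : SSet.{w}} {n : ℕ} (x : X _⦋n⦌) (i : Fin (n + 1)) : X _⦋0⦌ :=
  X.map (SimplexCategory.const ⦋0⦌ ⦋n⦌ i).op x

/-- The edge `x_i → x_j` of a simplex. -/
def edge {X : SSet.{w}} {n : ℕ} (x : X _⦋n⦌) {i j : Fin (n + 1)} (h : i ≤ j) : X _⦋1⦌ :=
  X.map (SimplexCategory.mkOfLe i j h).op x

/-- The (possibly degenerate) 2-dimensional face of a simplex with vertices `x_i, x_j, x_k`. -/
def face {X : SSet.{w}} {n : ℕ} (x : X _⦋n⦌) {i j k : Fin (n + 1)} (hij : i ≤ j) (hjk : j ≤ k) :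
    X _⦋2⦌ :=
  X.map (SimplexCategory.mkOfLeComp i j k hij hjk).op x

lemma vertex_map {X : SSet.{w}} {n m : ℕ} (f : ⦋m⦌ ⟶ ⦋n⦌) (x : X _⦋n⦌) (i : Fin (m + 1)) :
    vertex (X.map f.op x) i = vertex x (f.toOrderHom i) := by
  have : SimplexCategory.const ⦋0⦌ ⦋m⦌ i ≫ f = SimplexCategory.const ⦋0⦌ ⦋n⦌ (f.toOrderHom i) := rfl
  simp only [vertex, ← this, op_comp, X.map_comp]
  rfl

lemma edge_map {X : SSet.{w}} {n m : ℕ} (f : ⦋m⦌ ⟶ ⦋n⦌) (x : X _⦋n⦌) {i j : Fin (m + 1)}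
    (h : i ≤ j) : edge (X.map f.op x) h = edge x (f.toOrderHom.monotone h) := by
  have : SimplexCategory.mkOfLe i j h ≫ f =
      SimplexCategory.mkOfLe _ _ (f.toOrderHom.monotone h) := by
    ext a : 3
    fin_cases a <;> rfl
  simp only [edge, ← this, op_comp, X.map_comp]
  rfl

lemma face_map {X : SSet.{w}} {n m : ℕ} (f : ⦋m⦌ ⟶ ⦋n⦌) (x : X _⦋n⦌) {i j k : Fin (m + 1)}
    (hij : i ≤ j) (hjk : j ≤ k) :
    face (X.map f.op x) hij hjk =
      face x (f.toOrderHom.monotone hij) (f.toOrderHom.monotone hjk) := by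
  have : SimplexCategory.mkOfLeComp i j k hij hjk ≫ f =
      SimplexCategory.mkOfLeComp _ _ _ (f.toOrderHom.monotone hij)
        (f.toOrderHom.monotone hjk) := by
    ext a : 3
    fin_cases a <;> rfl
  simp only [face, ← this, op_comp, X.map_comp]
  rfl

lemma isTri_face {X : SSet.{w}} {n : ℕ} (x : X _⦋n⦌) {i j k : Fin (n + 1)} (hij : i ≤ j)
    (hjk : j ≤ k) : IsTri (face x hij hjk) (edge x hjk) (edge x hij) (edge x (hij.trans hjk)) := by
  have h₀ : SimplexCategory.δ 0 ≫ SimplexCategory.mkOfLeComp i j k hij hjk =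
      SimplexCategory.mkOfLe j k hjk := by
    ext a : 3
    fin_cases a <;> rfl
  have h₁ : SimplexCategory.δ 1 ≫ SimplexCategory.mkOfLeComp i j k hij hjk =
      SimplexCategory.mkOfLe i k (hij.trans hjk) := by
    ext a : 3
    fin_cases a <;> rfl
  have h₂ : SimplexCategory.δ 2 ≫ SimplexCategory.mkOfLeComp i j k hij hjk =
      SimplexCategory.mkOfLe i j hij := by
    ext a : 3
    fin_cases a <;> rfl
  constructor
  · simp only [edge, ← h₀, op_comp, X.map_comp]
    rfl
  · simp only [edge, ← h₂, op_comp, X.map_comp]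
    rfl
  · simp only [edge, ← h₁, op_comp, X.map_comp]
    rfl

lemma σ₀_edge {X : SSet.{w}} {n : ℕ} (x : X _⦋n⦌) {i k : Fin (n + 1)} (h : i ≤ k) :
    face x (le_refl i) h = X.σ 0 (edge x h) := by
  have : SimplexCategory.σ 0 ≫ SimplexCategory.mkOfLe i k h =
      SimplexCategory.mkOfLeComp i i k le_rfl h := by
    ext a : 3
    fin_cases a <;> rfl
  simp only [face, ← this, op_comp, X.map_comp]
  rfl

lemma σ₁_edge {X : SSet.{w}} {n : ℕ} (x : X _⦋n⦌) {i k : Fin (n + 1)} (h : i ≤ k) :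
    face x h (le_refl k) = X.σ 1 (edge x h) := by
  have : SimplexCategory.σ 1 ≫ SimplexCategory.mkOfLe i k h =
      SimplexCategory.mkOfLeComp i k k h le_rfl := by
    ext a : 3
    fin_cases a <;> rfl
  simp only [face, ← this, op_comp, X.map_comp]
  rfl

lemma vertex_eq_δ₁ {X : SSet.{w}} {n : ℕ} (x : X _⦋n⦌) {i k : Fin (n + 1)} (h : i ≤ k) :
    vertex x i = X.δ 1 (edge x h) := by
  have : SimplexCategory.δ 1 ≫ SimplexCategory.mkOfLe i k h = SimplexCategory.const ⦋0⦌ ⦋n⦌ i := by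
    ext a : 3
    fin_cases a ; rfl
  simp only [vertex, ← this, op_comp, X.map_comp]
  rfl

lemma vertex_eq_δ₀ {X : SSet.{w}} {n : ℕ} (x : X _⦋n⦌) {i k : Fin (n + 1)} (h : i ≤ k) :
    vertex x k = X.δ 0 (edge x h) := by
  have : SimplexCategory.δ 0 ≫ SimplexCategory.mkOfLe i k h = SimplexCategory.const ⦋0⦌ ⦋n⦌ k := by
    ext a : 3
    fin_cases a ; rfl
  simp only [vertex, ← this, op_comp, X.map_comp]
  rfl

/-- Any three consecutive inequalities in `[n]` define a 3-dimensional face of a simplex. -/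
lemma exists_tetra {X : SSet.{w}} {n : ℕ} (x : X _⦋n⦌) {i j k l : Fin (n + 1)} (hij : i ≤ j)
    (hjk : j ≤ k) (hkl : k ≤ l) : ∃ s : X _⦋3⦌, face x hjk hkl = X.δ 0 s ∧
      face x (hij.trans hjk) hkl = X.δ 1 s ∧ face x hij (hjk.trans hkl) = X.δ 2 s ∧
      face x hij hjk = X.δ 3 s := by
  let t : ⦋3⦌ ⟶ ⦋n⦌ := SimplexCategory.mkHom
    { toFun := ![i, j, k, l]
      monotone' := by
        intro a b h
        fin_cases a <;> fin_cases b <;> first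
          | exact le_rfl
          | assumption
          | exact hij.trans hjk
          | exact hjk.trans hkl
          | exact (hij.trans hjk).trans hkl
          | exact absurd h (by decide) }
  have h₀ : SimplexCategory.δ 0 ≫ t = SimplexCategory.mkOfLeComp _ _ _ hjk hkl := by
    ext a : 3
    fin_cases a <;> rfl
  have h₁ : SimplexCategory.δ 1 ≫ t = SimplexCategory.mkOfLeComp _ _ _ (hij.trans hjk) hkl := by
    ext a : 3
    fin_cases a <;> rfl
  have h₂ : SimplexCategory.δ 2 ≫ t = SimplexCategory.mkOfLeComp _ _ _ hij (hjk.trans hkl) := by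
    ext a : 3
    fin_cases a <;> rfl
  have h₃ : SimplexCategory.δ 3 ≫ t = SimplexCategory.mkOfLeComp _ _ _ hij hjk := by
    ext a : 3
    fin_cases a <;> rfl
  refine ⟨X.map t.op x, ?_, ?_, ?_, ?_⟩
  · simp only [face, ← h₀, op_comp, X.map_comp]; rfl
  · simp only [face, ← h₁, op_comp, X.map_comp]; rfl
  · simp only [face, ← h₂, op_comp, X.map_comp]; rfl
  · simp only [face, ← h₃, op_comp, X.map_comp]; rfl

/-- An `n`-simplex of the operadic Grothendieck construction of `P`: an `n`-simplex `x` of `X`, for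
`i ≤ j` an object `a_ij` of the category of `P` over the edge `x_i → x_j`, and for `i ≤ j ≤ k` a
morphism `a_jk · a_ij ⟶ a_ik`, the product being taken over the face `x_i x_j x_k`, such that the
two composites `(a_kl · a_jk) · a_ij = a_kl · (a_jk · a_ij) ⟶ a_il` agree for `i ≤ j ≤ k ≤ l`.
The object `a_ii` is the unit and the morphisms for `i = j` or `j = k` are identities, so that the
data are determined by the indices `i < j < k`. Thus a 1-simplex is a pair `(A, a)` with `a ∈ P_A`,
and a 2-simplex consists of `f ∈ X₂`, objects `b`, `p`, `a` over its edges, and a morphism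
`b ·_f p ⟶ a`. -/
structure TotalSimplex {X : SSet.{w}} (P : CatOperad.{w, v, u} X) (n : ℕ) where
  base : X _⦋n⦌
  pt : ∀ {i j : Fin (n + 1)}, i ≤ j → Σ A : X _⦋1⦌, P.cat A
  pt_fst : ∀ {i j : Fin (n + 1)} (h : i ≤ j), (pt h).1 = edge base h
  comp : ∀ {i j k : Fin (n + 1)} (hij : i ≤ j) (hjk : j ≤ k) (f : X _⦋2⦌),
    f = face base hij hjk → ∀ h : IsTri f (pt hjk).1 (pt hij).1 (pt (hij.trans hjk)).1,
    ((P.mul f h).obj ((pt hjk).2, (pt hij).2) ⟶ (pt (hij.trans hjk)).2)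
  pt_refl : ∀ i, pt (le_refl i) = ⟨X.σ 0 (vertex base i), P.unit (vertex base i)⟩
  comp_refl_left : ∀ {i k : Fin (n + 1)} (hik : i ≤ k) f hf h, ∃ e,
    comp (le_refl i) hik f hf h = eqToHom e
  comp_refl_right : ∀ {i k : Fin (n + 1)} (hik : i ≤ k) f hf h, ∃ e,
    comp hik (le_refl k) f hf h = eqToHom e
  comp_assoc : ∀ {i j k l : Fin (n + 1)} (hij : i ≤ j) (hjk : j ≤ k) (hkl : k ≤ l)
    f₀ f₁ f₂ f₃ hf₀ hf₁ hf₂ hf₃ h₀ h₁ h₂ h₃, ∃ e,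
    (P.mul f₂ h₂).map (Prod.mkHom (comp hjk hkl f₀ hf₀ h₀) (𝟙 (pt hij).2)) ≫
        comp hij (hjk.trans hkl) f₂ hf₂ h₂ =
      eqToHom e ≫
        (P.mul f₁ h₁).map (Prod.mkHom (𝟙 (pt hkl).2) (comp hij hjk f₃ hf₃ h₃)) ≫
          comp (hij.trans hjk) hkl f₁ hf₁ h₁


/-- Restriction of a simplex along a morphism of the simplex category. -/
def TotalSimplex.precomp {X : SSet.{w}} {P : CatOperad.{w, v, u} X} {n m : ℕ}
    (S : TotalSimplex P n) (φ : ⦋m⦌ ⟶ ⦋n⦌) : TotalSimplex P m where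
  base := X.map φ.op S.base
  pt h := S.pt (φ.toOrderHom.monotone h)
  pt_fst h := (S.pt_fst _).trans (edge_map φ S.base h).symm
  comp hij hjk f hf h := S.comp _ _ f (hf.trans (face_map φ S.base hij hjk)) h
  pt_refl i := by
    rw [vertex_map]
    exact S.pt_refl _
  comp_refl_left h f hf := S.comp_refl_left _ f _
  comp_refl_right h f hf := S.comp_refl_right _ f _
  comp_assoc _ _ _ f₀ f₁ f₂ f₃ _ _ _ _ h₀ h₁ h₂ h₃ :=
    S.comp_assoc _ _ _ f₀ f₁ f₂ f₃ _ _ _ _ h₀ h₁ h₂ h₃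

lemma TotalSimplex.ext' {X : SSet.{w}} {P : CatOperad.{w, v, u} X} {n : ℕ}
    {S T : TotalSimplex P n} (hbase : S.base = T.base)
    (hpt : ∀ {i j : Fin (n + 1)} (h : i ≤ j), S.pt h = T.pt h)
    (hcomp : ∀ {i j k : Fin (n + 1)} (hij : i ≤ j) (hjk : j ≤ k) f hf hf' h h',
      HEq (S.comp hij hjk f hf h) (T.comp hij hjk f hf' h')) : S = T := by
  rcases S with ⟨b, p, h₁, c, _, _, _, _⟩
  rcases T with ⟨b', p', h₁', c', _, _, _, _⟩
  obtain rfl : b = b' := hbase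
  obtain rfl : @p = @p' := by
    funext i j h
    exact hpt h
  obtain rfl : @c = @c' := by
    funext i j k hij hjk f hf h
    exact eq_of_heq (hcomp hij hjk f hf hf h h)
  rfl

lemma TotalSimplex.precomp_id {X : SSet.{w}} {P : CatOperad.{w, v, u} X} {n : ℕ}
    (S : TotalSimplex P n) : S.precomp (𝟙 ⦋n⦌) = S := by
  refine TotalSimplex.ext' ?_ (fun _ => rfl) (fun _ _ _ _ _ _ _ => HEq.rfl)
  change X.map (𝟙 _) S.base = _
  rw [X.map_id]
  rfl

lemma TotalSimplex.precomp_comp {X : SSet.{w}} {P : CatOperad.{w, v, u} X} {n m l : ℕ}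
    (S : TotalSimplex P n) (f : ⦋m⦌ ⟶ ⦋n⦌) (g : ⦋l⦌ ⟶ ⦋m⦌) :
    S.precomp (g ≫ f) = (S.precomp f).precomp g := by
  refine TotalSimplex.ext' ?_ (fun _ => rfl) (fun _ _ _ _ _ _ _ => HEq.rfl)
  change X.map (f.op ≫ g.op) S.base = X.map g.op (X.map f.op S.base)
  rw [X.map_comp]
  rfl

/-- The simplicial set underlying the operadic Grothendieck construction `∫ P`. -/
def total {X : SSet.{w}} (P : CatOperad.{w, v, u} X) : SSet.{max w v u} where
  obj n := TotalSimplex P n.unop.len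
  map φ := ↾fun S => S.precomp φ.unop
  map_id n := by
    ext S
    exact TotalSimplex.precomp_id S
  map_comp f g := by
    ext S
    exact TotalSimplex.precomp_comp S f.unop g.unop

namespace CatOperad.Hom

variable {X : SSet.{w}} {P Q : CatOperad.{w, v, u} X} (F : Hom P Q)

lemma pt_unit (x : Σ A, P.cat A) (c : X _⦋0⦌) (hx : x = ⟨X.σ 0 c, P.unit c⟩) :
    (⟨x.1, (F.app _).obj x.2⟩ : Σ A, Q.cat A) = ⟨X.σ 0 c, Q.unit c⟩ := by
  subst hx
  rw [F.app_unit]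

lemma lax_right_unit {B A C : X _⦋1⦌} (f : X _⦋2⦌) (h : IsTri f B A C) (b : P.cat B) (p : P.cat A)
    (c : X _⦋0⦌) (hc : c = X.δ 1 B) (hf : f = X.σ 0 B)
    (hp : (⟨A, p⟩ : Σ A, P.cat A) = ⟨X.σ 0 c, P.unit c⟩) :
    ∃ e, (F.lax f h).app (b, p) = eqToHom e := by
  subst hf hc
  obtain rfl : B = C := (isTri_σ₀ B).d1.symm.trans h.d1
  cases hp
  exact F.lax_mul_unit b

lemma lax_left_unit {B A C : X _⦋1⦌} (f : X _⦋2⦌) (h : IsTri f B A C) (b : P.cat B) (p : P.cat A)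
    (c : X _⦋0⦌) (hc : c = X.δ 0 A) (hf : f = X.σ 1 A)
    (hb : (⟨B, b⟩ : Σ A, P.cat A) = ⟨X.σ 0 c, P.unit c⟩) :
    ∃ e, (F.lax f h).app (b, p) = eqToHom e := by
  subst hf hc
  obtain rfl : A = C := (isTri_σ₁ A).d1.symm.trans h.d1
  cases hb
  exact F.lax_unit_mul p

lemma comp_assoc_aux (s : X _⦋3⦌) {A₀₁ A₁₂ A₂₃ A₀₂ A₁₃ A₀₃ : X _⦋1⦌} (f₀ f₁ f₂ f₃ : X _⦋2⦌)
    (e₀ : f₀ = X.δ 0 s) (e₁ : f₁ = X.δ 1 s) (e₂ : f₂ = X.δ 2 s) (e₃ : f₃ = X.δ 3 s)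
    (h₀ : IsTri f₀ A₂₃ A₁₂ A₁₃) (h₁ : IsTri f₁ A₂₃ A₀₂ A₀₃)
    (h₂ : IsTri f₂ A₁₃ A₀₁ A₀₃) (h₃ : IsTri f₃ A₁₂ A₀₁ A₀₂)
    (a : P.cat A₂₃) (b : P.cat A₁₂) (c : P.cat A₀₁) (d₁₃ : P.cat A₁₃) (d₀₂ : P.cat A₀₂)
    (d₀₃ : P.cat A₀₃) (α₀ : (P.mul f₀ h₀).obj (a, b) ⟶ d₁₃) (α₁ : (P.mul f₁ h₁).obj (a, d₀₂) ⟶ d₀₃)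
    (α₂ : (P.mul f₂ h₂).obj (d₁₃, c) ⟶ d₀₃) (α₃ : (P.mul f₃ h₃).obj (b, c) ⟶ d₀₂)
    (H : ∃ e, (P.mul f₂ h₂).map (Prod.mkHom α₀ (𝟙 c)) ≫ α₂ =
      eqToHom e ≫ (P.mul f₁ h₁).map (Prod.mkHom (𝟙 a) α₃) ≫ α₁) : ∃ e,
    (Q.mul f₂ h₂).map (Prod.mkHom ((F.lax f₀ h₀).app (a, b) ≫ (F.app _).map α₀)
        (𝟙 ((F.app _).obj c))) ≫ ((F.lax f₂ h₂).app (d₁₃, c) ≫ (F.app _).map α₂) =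
      eqToHom e ≫ (Q.mul f₁ h₁).map (Prod.mkHom (𝟙 ((F.app _).obj a))
        ((F.lax f₃ h₃).app (b, c) ≫ (F.app _).map α₃)) ≫
          ((F.lax f₁ h₁).app (a, d₀₂) ≫ (F.app _).map α₁) := by
  subst e₀ e₁ e₂ e₃
  obtain ⟨e, H⟩ := H
  obtain ⟨d, d', hF⟩ := F.lax_assoc s h₀ h₁ h₂ h₃ a b c
  refine ⟨d', ?_⟩
  have n₂ := F.lax_natural_left _ h₂ α₀ c
  have n₁ := F.lax_natural_right _ h₁ a α₃
  have H' := congrArg (F.app A₀₃).map H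
  have m₂ := (Q.mul _ h₂).map_comp
    (Prod.mkHom ((F.lax _ h₀).app (a, b)) (𝟙 ((F.app A₀₁).obj c)))
    (Prod.mkHom ((F.app _).map α₀) (𝟙 ((F.app A₀₁).obj c)))
  have m₁ := (Q.mul _ h₁).map_comp
    (Prod.mkHom (𝟙 ((F.app A₂₃).obj a)) ((F.lax _ h₃).app (b, c)))
    (Prod.mkHom (𝟙 ((F.app A₂₃).obj a)) ((F.app _).map α₃))
  simp only [prod_comp, Category.id_comp, Functor.comp_obj, Functor.map_comp,
    Functor.prod_obj, eqToHom_map] at n₁ n₂ H' m₁ m₂ hF ⊢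
  rw [m₂, m₁]
  simp only [Category.assoc]
  rw [reassoc_of% n₂, H', reassoc_of% hF, ← reassoc_of% n₁]

end CatOperad.Hom

/-- The action of a morphism of operads on simplices of the Grothendieck construction:
`(A, a) ↦ (A, F a)`, and `α : b ·_f p ⟶ a` is sent to `F b ·_f F p ⟶ F (b ·_f p) ⟶ F a`. -/
def TotalSimplex.map {X : SSet.{w}} {P Q : CatOperad.{w, v, u} X} (F : CatOperad.Hom P Q) {n : ℕ}
    (S : TotalSimplex P n) : TotalSimplex Q n where
  base := S.base
  pt h := ⟨(S.pt h).1, (F.app _).obj (S.pt h).2⟩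
  pt_fst h := S.pt_fst h
  comp hij hjk f hf h := (F.lax f h).app ((S.pt hjk).2, (S.pt hij).2) ≫
    (F.app _).map (S.comp hij hjk f hf h)
  pt_refl i := F.pt_unit _ _ (S.pt_refl i)
  comp_refl_left {i k} hik f hf h := by
    obtain ⟨e, he⟩ := F.lax_right_unit f h (S.pt hik).2 (S.pt (le_refl i)).2 (vertex S.base i)
      (by rw [S.pt_fst]; exact vertex_eq_δ₁ _ _)
      (by rw [hf, S.pt_fst]; exact σ₀_edge _ _) (S.pt_refl i)
    obtain ⟨e', he'⟩ := S.comp_refl_left hik f hf h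
    exact ⟨e.trans (congrArg _ e'), by rw [he, he', eqToHom_map, eqToHom_trans]⟩
  comp_refl_right {i k} hik f hf h := by
    obtain ⟨e, he⟩ := F.lax_left_unit f h (S.pt (le_refl k)).2 (S.pt hik).2 (vertex S.base k)
      (by rw [S.pt_fst]; exact vertex_eq_δ₀ _ _)
      (by rw [hf, S.pt_fst]; exact σ₁_edge _ _) (S.pt_refl k)
    obtain ⟨e', he'⟩ := S.comp_refl_right hik f hf h
    exact ⟨e.trans (congrArg _ e'), by rw [he, he', eqToHom_map, eqToHom_trans]⟩
  comp_assoc hij hjk hkl f₀ f₁ f₂ f₃ hf₀ hf₁ hf₂ hf₃ h₀ h₁ h₂ h₃ := by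
    obtain ⟨s, e₀, e₁, e₂, e₃⟩ := exists_tetra S.base hij hjk hkl
    exact F.comp_assoc_aux s f₀ f₁ f₂ f₃ (hf₀.trans e₀) (hf₁.trans e₁) (hf₂.trans e₂)
      (hf₃.trans e₃) h₀ h₁ h₂ h₃ _ _ _ _ _ _ _ _ _ _
      (S.comp_assoc hij hjk hkl f₀ f₁ f₂ f₃ hf₀ hf₁ hf₂ hf₃ h₀ h₁ h₂ h₃)

/-- The operadic Grothendieck construction, as a functor from the category of categorical operads
over `X` to simplicial sets over `X`. -/
def grothendieck (X : SSet.{max w v u}) : CatOperad.{max w v u, v, u} X ⥤ Over X where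
  obj P := Over.mk (Y := total P) { app := fun _ => ↾fun S => S.base }
  map {P Q} F := Over.homMk { app := fun _ => ↾fun S => S.map F }
  map_id P := by
    ext n S
    refine TotalSimplex.ext' rfl (fun _ => rfl) ?_
    intro i j k hij hjk f hf hf' h h'
    exact heq_of_eq (Category.id_comp _)
  map_comp {P Q R} F G := by
    ext n S
    refine TotalSimplex.ext' rfl (fun _ => rfl) ?_
    intro i j k hij hjk f hf hf' h h'
    exact heq_of_eq ((Category.assoc _ _ _).trans (congrArg _ ((G.app _).map_comp _ _).symm))

/-! ### Strict monoidal categories and the operadic 2-category `V^△` -/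

open MonoidalCategory Functor.LaxMonoidal

/-- The one-object bicategory `BV` of a monoidal category `V`: the 1-cells are the objects of `V`,
the 2-cells are the morphisms of `V`, and the composite `g ∘ f` is `g ⊗ f`. -/
inductive Deloop (V : Type u)
  | star

instance (V : Type u) [Category.{v} V] [MonoidalCategory V] : Bicategory (Deloop V) where
  Hom _ _ := V
  id _ := 𝟙_ V
  comp f g := g ⊗ f
  homCategory _ _ := inferInstanceAs (Category V)
  whiskerLeft f _ _ η := η ▷ f
  whiskerRight η h := h ◁ η
  associator f g h := (α_ h g f).symm
  leftUnitor f := ρ_ f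
  rightUnitor f := λ_ f
  whisker_exchange η θ := (MonoidalCategory.whisker_exchange θ η).symm

/-- The simplicial set underlying the unary operadic 2-category `V^△`, that is, the nerve of `BV`:
a 1-simplex is an object of `V`, and a 2-simplex is a morphism `x₁₂ ⊗ x₀₁ ⟶ x₀₂`. -/
def triangle (V : Type u) [Category.{v} V] [MonoidalCategory V] : SSet.{max v u} :=
  duskinNerve (Deloop V)

/-- A lax monoidal functor is normal if it preserves the monoidal unit strictly. -/
def IsNormal {V : Type*} [Category* V] [MonoidalCategory V] {W : Type*} [Category* W]
    [MonoidalCategory W] (F : V ⥤ W) [F.LaxMonoidal] : Prop :=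
  ∃ h : 𝟙_ W = F.obj (𝟙_ V), ε F = eqToHom h

lemma triangle_assoc_aux {V : Type*} [Category* V] [MonoidalCategory V] {W : Type*} [Category* W]
    [MonoidalCategory W] (F : V ⥤ W) [F.LaxMonoidal] (a b c d e f : V)
    (α₃ : b ⊗ a ⟶ d) (α₀ : c ⊗ b ⟶ e) (α₁ : c ⊗ d ⟶ f) (α₂ : e ⊗ a ⟶ f)
    (h : c ◁ α₃ ≫ α₁ = (α_ c b a).inv ≫ α₀ ▷ a ≫ α₂) :
    F.obj c ◁ (μ F b a ≫ F.map α₃) ≫ μ F c d ≫ F.map α₁ =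
      (α_ (F.obj c) (F.obj b) (F.obj a)).inv ≫
        (μ F c b ≫ F.map α₀) ▷ F.obj a ≫ μ F e a ≫ F.map α₂ := by
  rw [MonoidalCategory.whiskerLeft_comp_assoc, μ_natural_right_assoc, ← F.map_comp, h,
    MonoidalCategory.comp_whiskerRight_assoc, μ_natural_left_assoc]
  simp

/-- The action of a normal lax monoidal functor on simplices: the 2-cells are sent to the
composites `F x ⊗ F y ⟶ F (x ⊗ y) ⟶ F z`. -/
def triangleSimplexMap {V : Type*} [Category* V] [MonoidalCategory V] {W : Type*} [Category* W]
    [MonoidalCategory W] (F : V ⥤ W) [F.LaxMonoidal] (hF : IsNormal F) {n : ℕ}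
    (S : NerveSimplex (Deloop V) n) : NerveSimplex (Deloop W) n where
  obj _ := .star
  hom h := F.obj (S.hom h)
  comp hij hjk := μ F (S.hom hjk) (S.hom hij) ≫ F.map (S.comp hij hjk)
  hom_refl i := (congrArg F.obj (S.hom_refl i)).trans hF.choose.symm
  comp_refl_left {i k} h := by
    have he : ε F = eqToHom hF.choose := hF.choose_spec
    have h₁ := μ_natural_right F (X := S.hom (le_refl i)) (Y := 𝟙_ V) (S.hom h)
      (eqToHom (S.hom_refl i))
    have h₂ := right_unitality F (S.hom h)
    have h₃ : S.comp (le_refl i) h =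
      ((S.hom h : V) ◁ (eqToHom (S.hom_refl i) : (S.hom (le_refl i) : V) ⟶ 𝟙_ V)) ≫
        (ρ_ (S.hom h : V)).hom := S.comp_refl_left h
    change μ F (S.hom h : V) (S.hom (le_refl i)) ≫ F.map (S.comp (le_refl i) h) =
      (F.obj (S.hom h) ◁ eqToHom _) ≫ (ρ_ (F.obj (S.hom h : V))).hom
    rw [h₃, h₂, F.map_comp]
    erw [← reassoc_of% h₁]
    simp only [he, eqToHom_map]
    rw [← MonoidalCategory.whiskerLeft_comp_assoc, eqToHom_trans]
  comp_refl_right {i k} h := by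
    have he : ε F = eqToHom hF.choose := hF.choose_spec
    have h₁ := μ_natural_left F (X := S.hom (le_refl k)) (Y := 𝟙_ V)
      (eqToHom (S.hom_refl k)) (S.hom h)
    have h₂ := left_unitality F (S.hom h)
    have h₃ : S.comp h (le_refl k) =
      ((eqToHom (S.hom_refl k) : (S.hom (le_refl k) : V) ⟶ 𝟙_ V) ▷ (S.hom h : V)) ≫
        (λ_ (S.hom h : V)).hom := S.comp_refl_right h
    change μ F (S.hom (le_refl k) : V) (S.hom h) ≫ F.map (S.comp h (le_refl k)) =
      (eqToHom _ ▷ F.obj (S.hom h)) ≫ (λ_ (F.obj (S.hom h : V))).hom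
    rw [h₃, h₂, F.map_comp]
    erw [← reassoc_of% h₁]
    simp only [he, eqToHom_map]
    rw [← MonoidalCategory.comp_whiskerRight_assoc, eqToHom_trans]
  comp_assoc {i j k l} hij hjk hkl := by
    exact triangle_assoc_aux F _ _ _ _ _ _ (S.comp hij hjk) (S.comp hjk hkl)
      (S.comp (hij.trans hjk) hkl) (S.comp hij (hjk.trans hkl)) (S.comp_assoc hij hjk hkl)

lemma NerveSimplex.deloop_ext {V : Type*} [Category* V] [MonoidalCategory V] {n : ℕ}
    {S T : NerveSimplex (Deloop V) n}
    (hhom : ∀ {i j : Fin (n + 1)} (h : i ≤ j), (S.hom h : V) = T.hom h)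
    (hcomp : ∀ {i j k : Fin (n + 1)} (hij : i ≤ j) (hjk : j ≤ k),
      HEq (S.comp hij hjk) (T.comp hij hjk)) : S = T := by
  rcases S with ⟨o, f, c, _, _, _, _⟩
  rcases T with ⟨o', f', c', _, _, _, _⟩
  obtain rfl : o = o' := by
    funext i
    cases o i
    cases o' i
    rfl
  obtain rfl : @f = @f' := by
    funext i j h
    exact hhom h
  obtain rfl : @c = @c' := by
    funext i j k hij hjk
    exact eq_of_heq (hcomp hij hjk)
  rfl

/-- The map `V^△ → W^△` induced by a normal lax monoidal functor. -/
def triangleMap {V : Type u} [Category.{v} V] [MonoidalCategory V] {W : Type u} [Category.{v} W]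
    [MonoidalCategory W] (F : V ⥤ W) [F.LaxMonoidal] (hF : IsNormal F) :
    triangle V ⟶ triangle W where
  app _ := ↾fun S => triangleSimplexMap F hF S

/-- A monoidal category is strict if its associator and unitors are identities. -/
structure IsStrictMonoidal (V : Type u) [Category.{v} V] [MonoidalCategory V] : Prop where
  tensor_assoc : ∀ x y z : V, (x ⊗ y) ⊗ z = x ⊗ (y ⊗ z)
  unit_tensor : ∀ x : V, 𝟙_ V ⊗ x = x
  tensor_unit : ∀ x : V, x ⊗ 𝟙_ V = x
  associator_eq : ∀ x y z : V, α_ x y z = eqToIso (tensor_assoc x y z)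
  leftUnitor_eq : ∀ x : V, λ_ x = eqToIso (unit_tensor x)
  rightUnitor_eq : ∀ x : V, ρ_ x = eqToIso (tensor_unit x)

/-- A strict monoidal category. -/
structure StrMonCat where
  V : Type u
  [category : Category.{v} V]
  [monoidal : MonoidalCategory V]
  strict : IsStrictMonoidal V

attribute [instance] StrMonCat.category StrMonCat.monoidal

/-- Morphisms of strict monoidal categories: normal lax monoidal functors. -/
structure StrMonCat.Hom (V W : StrMonCat.{v, u}) where
  functor : V.V ⥤ W.V
  [lax : functor.LaxMonoidal]
  normal : IsNormal functor

attribute [instance] StrMonCat.Hom.lax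

lemma StrMonCat.Hom.ext' {V W : StrMonCat.{v, u}} {F G : V.V ⥤ W.V} (h : F = G)
    (hF : F.LaxMonoidal) (hG : G.LaxMonoidal) (nF : IsNormal F) (nG : IsNormal G)
    (hμ : ∀ x y, HEq (μ F x y) (μ G x y)) : (⟨F, nF⟩ : StrMonCat.Hom V W) = ⟨G, nG⟩ := by
  subst h
  have : hF = hG := by
    obtain ⟨e, he⟩ := nF
    obtain ⟨e', he'⟩ := nG
    rcases hF with ⟨ε₁, μ₁, _, _, _, _, _⟩
    rcases hG with ⟨ε₂, μ₂, _, _, _, _, _⟩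
    obtain rfl : ε₁ = ε₂ := he.trans he'.symm
    obtain rfl : μ₁ = μ₂ := by
      funext x y
      exact eq_of_heq (hμ x y)
    rfl
  subst this
  rfl

lemma IsNormal.id (V : Type*) [Category* V] [MonoidalCategory V] : IsNormal (𝟭 V) :=
  ⟨rfl, (eqToHom_refl _ _).symm⟩

lemma IsNormal.comp {V W Z : Type*} [Category* V] [MonoidalCategory V] [Category* W]
    [MonoidalCategory W] [Category* Z] [MonoidalCategory Z] {F : V ⥤ W} [F.LaxMonoidal]
    {G : W ⥤ Z} [G.LaxMonoidal] (hF : IsNormal F) (hG : IsNormal G) : IsNormal (F ⋙ G) := by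
  obtain ⟨e, h⟩ := hF
  obtain ⟨e', h'⟩ := hG
  exact ⟨e'.trans (congrArg _ e), by simp [h, h', eqToHom_map]⟩

instance : Category StrMonCat.{v, u} where
  Hom := StrMonCat.Hom
  id V := ⟨𝟭 V.V, IsNormal.id V.V⟩
  comp F G := ⟨F.functor ⋙ G.functor, F.normal.comp G.normal⟩
  id_comp F := StrMonCat.Hom.ext' rfl _ _ _ _ fun x y => heq_of_eq <|
    (congrArg (μ F.functor x y ≫ ·) (F.functor.map_id _)).trans (Category.comp_id _)
  comp_id F := StrMonCat.Hom.ext' rfl _ _ _ _ fun x y => heq_of_eq <|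
    Category.id_comp (μ F.functor x y)
  assoc F G H := StrMonCat.Hom.ext' rfl _ _ _ _ fun x y => heq_of_eq <|
    (congrArg (μ H.functor _ _ ≫ ·) (H.functor.map_comp (μ G.functor _ _)
      (G.functor.map (μ F.functor x y)))).trans (Category.assoc _ _ _).symm

/-- The assignment `V ↦ V^△` as a functor. -/
def triangleFunctor : StrMonCat.{v, u} ⥤ SSet.{max v u} where
  obj V := triangle V.V
  map F := triangleMap F.functor F.normal
  map_id V := by
    ext n S
    exact NerveSimplex.deloop_ext (fun _ => rfl) fun _ _ => heq_of_eq (Category.id_comp _)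
  map_comp F G := by
    ext n S
    refine NerveSimplex.deloop_ext (fun _ => rfl) fun _ _ => heq_of_eq ?_
    exact (Category.assoc _ _ _).trans (congrArg _ (G.functor.map_comp _ _).symm)


namespace IsStrictMonoidal

lemma tensorHom_assoc {V : Type u} [Category.{v} V] [MonoidalCategory V]
    (hV : IsStrictMonoidal V) {x x' y y' z z' : V} (f : x ⟶ x') (g : y ⟶ y') (h : z ⟶ z') :
    (f ⊗ₘ g) ⊗ₘ h = eqToHom (hV.tensor_assoc x y z) ≫ (f ⊗ₘ (g ⊗ₘ h)) ≫
      eqToHom (hV.tensor_assoc x' y' z').symm := by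
  have := associator_naturality f g h
  rw [hV.associator_eq, hV.associator_eq, eqToIso.hom, eqToIso.hom] at this
  rw [← reassoc_of% this]
  simp

lemma whiskerRight_unit {V : Type u} [Category.{v} V] [MonoidalCategory V]
    (hV : IsStrictMonoidal V) {x x' : V} (f : x ⟶ x') :
    f ⊗ₘ 𝟙 (𝟙_ V) = eqToHom (hV.tensor_unit x) ≫ f ≫ eqToHom (hV.tensor_unit x').symm := by
  have := rightUnitor_naturality f
  rw [hV.rightUnitor_eq, hV.rightUnitor_eq, eqToIso.hom, eqToIso.hom] at this
  rw [← reassoc_of% this]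
  simp

lemma unit_whiskerLeft {V : Type u} [Category.{v} V] [MonoidalCategory V]
    (hV : IsStrictMonoidal V) {x x' : V} (f : x ⟶ x') :
    𝟙 (𝟙_ V) ⊗ₘ f = eqToHom (hV.unit_tensor x) ≫ f ≫ eqToHom (hV.unit_tensor x').symm := by
  have := leftUnitor_naturality f
  rw [hV.leftUnitor_eq, hV.leftUnitor_eq, eqToIso.hom, eqToIso.hom] at this
  rw [← reassoc_of% this]
  simp

variable {V W : Type u} [Category.{v} V] [MonoidalCategory V] [Category.{v} W]
  [MonoidalCategory W] (F : V ⥤ W) [F.LaxMonoidal]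

lemma μ_assoc (hV : IsStrictMonoidal V) (hW : IsStrictMonoidal W) (a b c : V) :
    (μ F a b ⊗ₘ 𝟙 (F.obj c)) ≫ μ F (a ⊗ b) c ≫
        eqToHom (congrArg F.obj (hV.tensor_assoc a b c)) =
      eqToHom (hW.tensor_assoc _ _ _) ≫ (𝟙 (F.obj a) ⊗ₘ μ F b c) ≫ μ F a (b ⊗ c) := by
  have h := associativity F a b c
  rw [hV.associator_eq, hW.associator_eq, eqToIso.hom, eqToIso.hom, eqToHom_map] at h
  simpa using h

lemma μ_unit (hV : IsStrictMonoidal V) (hW : IsStrictMonoidal W) (hF : IsNormal F) (a : V) :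
    ∃ e, μ F a (𝟙_ V) = eqToHom e := by
  obtain ⟨e, he⟩ := hF
  have h := right_unitality F a
  rw [hV.rightUnitor_eq, hW.rightUnitor_eq, eqToIso.hom, eqToIso.hom, eqToHom_map, he,
    whiskerLeft_eqToHom] at h
  have h' := congrArg (eqToHom (congrArg (F.obj a ⊗ ·) e.symm) ≫ · ≫
    eqToHom (congrArg F.obj (hV.tensor_unit a).symm)) h
  simp only [Category.assoc, eqToHom_trans, eqToHom_trans_assoc, eqToHom_refl,
    Category.comp_id, Category.id_comp] at h'
  exact ⟨_, h'.symm⟩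

lemma unit_μ (hV : IsStrictMonoidal V) (hW : IsStrictMonoidal W) (hF : IsNormal F) (a : V) :
    ∃ e, μ F (𝟙_ V) a = eqToHom e := by
  obtain ⟨e, he⟩ := hF
  have h := left_unitality F a
  rw [hV.leftUnitor_eq, hW.leftUnitor_eq, eqToIso.hom, eqToIso.hom, eqToHom_map, he,
    eqToHom_whiskerRight] at h
  have h' := congrArg (eqToHom (congrArg (· ⊗ F.obj a) e.symm) ≫ · ≫
    eqToHom (congrArg F.obj (hV.unit_tensor a).symm)) h
  simp only [Category.assoc, eqToHom_trans, eqToHom_trans_assoc, eqToHom_refl,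
    Category.comp_id, Category.id_comp] at h'
  exact ⟨_, h'.symm⟩

end IsStrictMonoidal

/-- A strict monoidal category, viewed as a categorical operad over the terminal unary operadic
2-category: there is a single category `V`, and the product is the tensor product. -/
def StrMonCat.operad (V : StrMonCat.{v, u}) : CatOperad.{w, v, u} UOpCat.terminal.{w}.X where
  cat _ := Cat.of V.V
  mul _ _ := tensor V.V
  unit _ := 𝟙_ V.V
  assoc _ _ _ _ _ _ _ _ _ _ _ := CategoryTheory.Functor.ext
    (fun _ => V.strict.tensor_assoc _ _ _)
    (fun _ _ f => V.strict.tensorHom_assoc (V := V.V) f.1.1 f.1.2 f.2)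
  mul_unit _ := CategoryTheory.Functor.ext (fun _ => V.strict.tensor_unit _)
    (fun _ _ f => V.strict.whiskerRight_unit (V := V.V) f)
  unit_mul _ := CategoryTheory.Functor.ext (fun _ => V.strict.unit_tensor _)
    (fun _ _ f => V.strict.unit_whiskerLeft (V := V.V) f)

/-- The identification of the category of strict monoidal categories with the category of
categorical operads over the terminal unary operadic 2-category, as a functor. -/
def StrMonCat.toOperad : StrMonCat.{v, u} ⥤ CatOperad.{w, v, u} UOpCat.terminal.{w}.X where
  obj V := V.operad
  map {V W} F :=
    { app := fun _ => F.functor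
      lax := fun _ _ =>
        { app := fun x => μ F.functor x.1 x.2
          naturality := fun _ _ f => μ_natural F.functor f.1 f.2 }
      app_unit := fun _ => F.normal.choose.symm
      lax_assoc := fun _ _ _ _ _ _ _ _ _ _ _ a b c =>
        ⟨_, _, IsStrictMonoidal.μ_assoc F.functor V.strict W.strict a b c⟩
      lax_mul_unit := fun a => IsStrictMonoidal.μ_unit F.functor V.strict W.strict F.normal a
      lax_unit_mul := fun a => IsStrictMonoidal.unit_μ F.functor V.strict W.strict F.normal a }
  map_id _ := rfl
  map_comp _ _ := rfl

/-! ### The universal operadic functor `(1/Cat)^△ → Cat^△` -/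

/-- An object of the lax coslice category `1/Cat`: a functor `1 ⥤ D`, that is, a category `D`
together with an object of `D`. -/
structure PtCat where
  cat : Cat.{v, u}
  pt : cat

/-- A morphism `(D, d) ⟶ (E, e)` of `1/Cat`: a functor `H : D ⥤ E` and a morphism `H d ⟶ e`. -/
structure PtCat.Hom (D E : PtCat.{v, u}) where
  functor : D.cat ⟶ E.cat
  map : functor.toFunctor.obj D.pt ⟶ E.pt

lemma PtCat.Hom.ext' {D E : PtCat.{v, u}} {F G : PtCat.Hom D E} (h : F.functor = G.functor)
    (h' : HEq F.map G.map) : F = G := by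
  cases F
  cases G
  cases h
  cases h'
  rfl

lemma PtCat.Hom.id_map_comp {D E : PtCat.{v, u}} (F : PtCat.Hom D E) :
    F.map = F.functor.toFunctor.map (𝟙 D.pt) ≫ F.map := by
  rw [CategoryTheory.Functor.map_id, Category.id_comp]

instance : Category PtCat.{v, u} where
  Hom := PtCat.Hom
  id D := ⟨𝟙 D.cat, 𝟙 D.pt⟩
  comp F G := ⟨F.functor ≫ G.functor, G.functor.toFunctor.map F.map ≫ G.map⟩
  id_comp F := PtCat.Hom.ext' (Category.id_comp _) (heq_of_eq (by
    exact (congrArg (· ≫ F.map) (F.functor.toFunctor.map_id _)).trans (Category.id_comp _)))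
  comp_id F := PtCat.Hom.ext' (Category.comp_id _) (heq_of_eq (by
    exact Category.comp_id _))
  assoc F G H := PtCat.Hom.ext' (Category.assoc _ _ _) (heq_of_eq (by
    exact ((Category.assoc _ _ _).symm.trans
      (congrArg (· ≫ H.map) (H.functor.toFunctor.map_comp _ _).symm)).symm))

/-- The pointwise cartesian product of pointed categories. -/
instance : MonoidalCategory PtCat.{v, u} where
  tensorObj D E := ⟨D.cat ⊗ E.cat, (D.pt, E.pt)⟩
  whiskerLeft D _ _ F := ⟨D.cat ◁ F.functor, Prod.mkHom (𝟙 D.pt) F.map⟩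
  whiskerRight F E := ⟨F.functor ▷ E.cat, Prod.mkHom F.map (𝟙 E.pt)⟩
  tensorHom F G := ⟨F.functor ⊗ₘ G.functor, Prod.mkHom F.map G.map⟩
  tensorUnit := ⟨𝟙_ Cat, ⟨⟨⟨⟩⟩⟩⟩
  associator D E F :=
    { hom := ⟨(α_ D.cat E.cat F.cat).hom, 𝟙 (D.pt, E.pt, F.pt)⟩
      inv := ⟨(α_ D.cat E.cat F.cat).inv, 𝟙 ((D.pt, E.pt), F.pt)⟩
      hom_inv_id := PtCat.Hom.ext' (α_ D.cat E.cat F.cat).hom_inv_id (heq_of_eq (Category.comp_id _))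
      inv_hom_id := PtCat.Hom.ext' (α_ D.cat E.cat F.cat).inv_hom_id (heq_of_eq (Category.comp_id _)) }
  leftUnitor D :=
    { hom := ⟨(λ_ D.cat).hom, 𝟙 D.pt⟩
      inv := ⟨(λ_ D.cat).inv, 𝟙 (_, D.pt)⟩
      hom_inv_id := PtCat.Hom.ext' (λ_ D.cat).hom_inv_id (heq_of_eq (Category.comp_id _))
      inv_hom_id := PtCat.Hom.ext' (λ_ D.cat).inv_hom_id (heq_of_eq (Category.comp_id _)) }
  rightUnitor D :=
    { hom := ⟨(ρ_ D.cat).hom, 𝟙 D.pt⟩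
      inv := ⟨(ρ_ D.cat).inv, 𝟙 (D.pt, _)⟩
      hom_inv_id := PtCat.Hom.ext' (ρ_ D.cat).hom_inv_id (heq_of_eq (Category.comp_id _))
      inv_hom_id := PtCat.Hom.ext' (ρ_ D.cat).inv_hom_id (heq_of_eq (Category.comp_id _)) }
  tensorHom_def F G := PtCat.Hom.ext' (MonoidalCategory.tensorHom_def _ _) (heq_of_eq (by
    refine Prod.ext ?_ ?_
    · exact (Category.comp_id _).symm
    · exact (PtCat.Hom.id_map_comp G)))
  id_tensorHom_id D E := PtCat.Hom.ext' (MonoidalCategory.id_tensorHom_id _ _) (heq_of_eq rfl)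
  tensorHom_comp_tensorHom F G H K := PtCat.Hom.ext'
    (MonoidalCategory.tensorHom_comp_tensorHom _ _ _ _) (heq_of_eq rfl)
  whiskerLeft_id D E := PtCat.Hom.ext' (MonoidalCategory.whiskerLeft_id _ _) (heq_of_eq rfl)
  id_whiskerRight D E := PtCat.Hom.ext' (MonoidalCategory.id_whiskerRight _ _) (heq_of_eq rfl)
  associator_naturality F G H := PtCat.Hom.ext' (MonoidalCategory.associator_naturality _ _ _)
    (heq_of_eq (by
      refine Prod.ext ?_ (Prod.ext ?_ ?_)
      · exact (Category.comp_id _).trans (PtCat.Hom.id_map_comp F)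
      · exact (Category.comp_id _).trans (PtCat.Hom.id_map_comp G)
      · exact (Category.comp_id _).trans (PtCat.Hom.id_map_comp H)))
  leftUnitor_naturality F := PtCat.Hom.ext' (MonoidalCategory.leftUnitor_naturality _)
    (heq_of_eq (by exact (Category.comp_id _).trans (PtCat.Hom.id_map_comp F)))
  rightUnitor_naturality F := PtCat.Hom.ext' (MonoidalCategory.rightUnitor_naturality _)
    (heq_of_eq (by exact (Category.comp_id _).trans (PtCat.Hom.id_map_comp F)))
  pentagon D E F G := PtCat.Hom.ext' (MonoidalCategory.pentagon _ _ _ _)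
    (heq_of_eq (by
      refine Prod.ext ?_ (Prod.ext ?_ (Prod.ext ?_ ?_))
      all_goals exact congrArg (𝟙 _ ≫ ·) (Category.comp_id _)))
  triangle D E := PtCat.Hom.ext' (MonoidalCategory.triangle _ _)
    (heq_of_eq (by exact Prod.ext (Category.comp_id _) (Category.comp_id _)))

/-- The codomain projection `1/Cat ⥤ Cat`. -/
def PtCat.forget : PtCat.{v, u} ⥤ Cat.{v, u} where
  obj D := D.cat
  map F := F.functor

/-- The codomain projection is strictly monoidal. -/
instance : PtCat.forget.{v, u}.LaxMonoidal where
  ε := 𝟙 _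
  μ _ _ := 𝟙 _

lemma PtCat.forget_isNormal : IsNormal PtCat.forget.{v, u} :=
  ⟨rfl, rfl⟩

/-! ### 1-connected operads as operadic functors to `Cat^△` -/

section OfTriangle

/-- Transport of a functor of two variables along equalities of categories. -/
def castMul {x y z B A C : Cat.{v, u}} (hB : B = x) (hA : A = y) (hC : C = z)
    (m : x ⊗ y ⟶ z) : B ⊗ A ⟶ C :=
  eqToHom (by rw [hB, hA]) ≫ m ≫ eqToHom hC.symm

lemma castMul_assoc {x₀₁ x₁₂ x₂₃ x₀₂ x₁₃ x₀₃ A₀₁ A₁₂ A₂₃ A₀₂ A₁₃ A₀₃ : Cat.{v, u}}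
    {m₀ : x₂₃ ⊗ x₁₂ ⟶ x₁₃} {m₁ : x₂₃ ⊗ x₀₂ ⟶ x₀₃} {m₂ : x₁₃ ⊗ x₀₁ ⟶ x₀₃} {m₃ : x₁₂ ⊗ x₀₁ ⟶ x₀₂}
    (h : x₂₃ ◁ m₃ ≫ m₁ = (α_ x₂₃ x₁₂ x₀₁).inv ≫ m₀ ▷ x₀₁ ≫ m₂)
    (h₀₁ : A₀₁ = x₀₁) (h₁₂ : A₁₂ = x₁₂) (h₂₃ : A₂₃ = x₂₃) (h₀₂ : A₀₂ = x₀₂) (h₁₃ : A₁₃ = x₁₃)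
    (h₀₃ : A₀₃ = x₀₃) :
    castMul h₂₃ h₁₂ h₁₃ m₀ ▷ A₀₁ ≫ castMul h₁₃ h₀₁ h₀₃ m₂ =
      (α_ A₂₃ A₁₂ A₀₁).hom ≫ A₂₃ ◁ castMul h₁₂ h₀₁ h₀₂ m₃ ≫ castMul h₂₃ h₀₂ h₀₃ m₁ := by
  subst h₀₁ h₁₂ h₂₃ h₀₂ h₁₃ h₀₃
  simp [castMul, h]

lemma castMul_unit {x y B A : Cat.{v, u}} {m : x ⊗ y ⟶ x} (hy : y = 𝟙_ Cat)
    (h : m = x ◁ eqToHom hy ≫ (ρ_ x).hom) (hB : B = x) (hA : A = y) (a : A)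
    (ha : a = (eqToHom (hA.trans hy).symm).toFunctor.obj ⟨⟨⟨⟩⟩⟩) :
    (𝟭 B).prod' ((Functor.const _).obj a) ⋙ (castMul hB hA hB m).toFunctor = 𝟭 B := by
  subst hB hA hy h ha
  simp only [castMul, eqToHom_refl, Category.comp_id, Category.id_comp,
    MonoidalCategory.whiskerLeft_id]
  rfl

lemma unit_castMul {x y B A : Cat.{v, u}} {m : x ⊗ y ⟶ y} (hx : x = 𝟙_ Cat)
    (h : m = eqToHom hx ▷ y ≫ (λ_ y).hom) (hB : B = x) (hA : A = y) (b : B)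
    (hb : b = (eqToHom (hB.trans hx).symm).toFunctor.obj ⟨⟨⟨⟩⟩⟩) :
    ((Functor.const _).obj b).prod' (𝟭 A) ⋙ (castMul hB hA hA m).toFunctor = 𝟭 A := by
  subst hB hA hx h hb
  simp only [castMul, eqToHom_refl, Category.comp_id, Category.id_comp,
    MonoidalCategory.id_whiskerRight]
  rfl

variable {X : SSet.{max (u + 1) (v + 1)}} (p : X ⟶ triangle Cat.{v, u})

/-- The simplex of `Cat^△` assigned to a simplex of `X`. -/
def simplexOf {n : ℕ} (x : X _⦋n⦌) : NerveSimplex (Deloop Cat.{v, u}) n :=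
  p.app _ x

lemma simplexOf_map {n m : ℕ} (f : ⦋m⦌ ⟶ ⦋n⦌) (x : X _⦋n⦌) :
    simplexOf p (X.map f.op x) = (simplexOf p x).precomp f.toOrderHom :=
  ConcreteCategory.congr_hom (p.naturality f.op) x

/-- The object of a monoidal category `V` assigned to an edge of a simplex of `V^△`. -/
def NerveSimplex.ob {V : Type u} [Category.{v} V] [MonoidalCategory V] {n : ℕ}
    (S : NerveSimplex (Deloop V) n) (i j : Fin (n + 1)) (h : i ≤ j) : V :=
  S.hom h

/-- The morphism of `V` assigned to a 2-dimensional face of a simplex of `V^△`. -/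
def NerveSimplex.mul {V : Type u} [Category.{v} V] [MonoidalCategory V] {n : ℕ}
    (S : NerveSimplex (Deloop V) n) (i j k : Fin (n + 1)) (hij : i ≤ j) (hjk : j ≤ k) :
    S.ob j k hjk ⊗ S.ob i j hij ⟶ S.ob i k (hij.trans hjk) :=
  S.comp hij hjk

/-- The category assigned to an edge of `X`. -/
def catOf (A : X _⦋1⦌) : Cat.{v, u} :=
  (simplexOf p A).ob 0 1 (by decide)

lemma catOf_d0 {f : X _⦋2⦌} {B A C : X _⦋1⦌} (h : IsTri f B A C) :
    catOf p B = (simplexOf p f).ob 1 2 (by decide) := by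
  rw [← h.d0]
  exact congrArg (fun S => S.ob 0 1 (by decide)) (simplexOf_map p (SimplexCategory.δ 0) f)

lemma catOf_d2 {f : X _⦋2⦌} {B A C : X _⦋1⦌} (h : IsTri f B A C) :
    catOf p A = (simplexOf p f).ob 0 1 (by decide) := by
  rw [← h.d2]
  exact congrArg (fun S => S.ob 0 1 (by decide)) (simplexOf_map p (SimplexCategory.δ 2) f)

lemma catOf_d1 {f : X _⦋2⦌} {B A C : X _⦋1⦌} (h : IsTri f B A C) :
    catOf p C = (simplexOf p f).ob 0 2 (by decide) := by
  rw [← h.d1]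
  exact congrArg (fun S => S.ob 0 1 (by decide)) (simplexOf_map p (SimplexCategory.δ 1) f)

lemma catOf_σ₀ (c : X _⦋0⦌) : 𝟙_ Cat = catOf p (X.σ 0 c) :=
  ((congrArg (fun S => S.ob 0 1 (by decide)) (simplexOf_map p (SimplexCategory.σ 0) c)).trans
    ((simplexOf p c).hom_refl 0)).symm

/-- The product `P_{d₀ f} × P_{d₂ f} ⟶ P_{d₁ f}` of the operad corresponding to `p`. -/
def mulOf {B A C : X _⦋1⦌} (f : X _⦋2⦌) (h : IsTri f B A C) :
    catOf p B ⊗ catOf p A ⟶ catOf p C :=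
  castMul (catOf_d0 p h) (catOf_d2 p h) (catOf_d1 p h)
    ((simplexOf p f).mul 0 1 2 (by decide) (by decide))

/-- `mulOf` can be computed in any simplex which has `f` as a face. -/
lemma mulOf_eq {n : ℕ} (x : X _⦋n⦌) (g : ⦋2⦌ ⟶ ⦋n⦌) {B A C : X _⦋1⦌} (f : X _⦋2⦌)
    (h : IsTri f B A C) (hf : f = X.map g.op x) (i j k : Fin (n + 1)) (hij : i ≤ j) (hjk : j ≤ k)
    (hi : g.toOrderHom 0 = i) (hj : g.toOrderHom 1 = j) (hk : g.toOrderHom 2 = k) :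
    ∃ hB hA hC, mulOf p f h = castMul hB hA hC ((simplexOf p x).mul i j k hij hjk) := by
  subst hf hi hj hk
  have key : ∀ (S T : NerveSimplex (Deloop Cat.{v, u}) 2) (hST : S = T) hB hA hC,
      ∃ hB' hA' hC', castMul (B := catOf p B) (A := catOf p A) (C := catOf p C) hB hA hC
        (S.mul 0 1 2 (by decide) (by decide)) =
        castMul hB' hA' hC' (T.mul 0 1 2 (by decide) (by decide)) := by
    rintro S _ rfl hB hA hC
    exact ⟨hB, hA, hC, rfl⟩
  exact key _ _ (simplexOf_map p g x) _ _ _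

/-- The categorical operad corresponding to an operadic functor `X ⟶ Cat^△`: the categories and
functors of the operad are those assigned to the 1-simplices and 2-simplices of `X`, and the unit
in `P_{s₀ c} = 1` is the unique object. -/
def CatOperad.ofTriangle : CatOperad.{max (u + 1) (v + 1), v, u} X where
  cat A := catOf p A
  mul f h := (mulOf p f h).toFunctor
  unit c := (eqToHom (catOf_σ₀ p c)).toFunctor.obj ⟨⟨⟨⟩⟩⟩
  assoc s _ _ _ _ _ _ h₀ h₁ h₂ h₃ := by
    obtain ⟨a₀, b₀, c₀, e₀⟩ := mulOf_eq p s (SimplexCategory.δ 0) _ h₀ rfl 1 2 3 (by decide)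
      (by decide) rfl rfl rfl
    obtain ⟨a₁, b₁, c₁, e₁⟩ := mulOf_eq p s (SimplexCategory.δ 1) _ h₁ rfl 0 2 3 (by decide)
      (by decide) rfl rfl rfl
    obtain ⟨a₂, b₂, c₂, e₂⟩ := mulOf_eq p s (SimplexCategory.δ 2) _ h₂ rfl 0 1 3 (by decide)
      (by decide) rfl rfl rfl
    obtain ⟨a₃, b₃, c₃, e₃⟩ := mulOf_eq p s (SimplexCategory.δ 3) _ h₃ rfl 0 1 2 (by decide)
      (by decide) rfl rfl rfl
    have := castMul_assoc ((simplexOf p s).comp_assoc (i := 0) (j := 1) (k := 2) (l := 3)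
      (by decide) (by decide) (by decide)) b₂ b₀ a₀ b₁ c₀ c₁
    rw [e₀, e₁, e₂, e₃]
    exact congrArg Cat.Hom.toFunctor this
  mul_unit A := by
    obtain ⟨a, b, c, e⟩ := mulOf_eq p A (SimplexCategory.σ 0) _ (isTri_σ₀ A) rfl 0 0 1 (by decide)
      (by decide) rfl rfl rfl
    rw [e]
    exact castMul_unit ((simplexOf p A).hom_refl 0) ((simplexOf p A).comp_refl_left _) a b _ rfl
  unit_mul A := by
    obtain ⟨a, b, c, e⟩ := mulOf_eq p A (SimplexCategory.σ 1) _ (isTri_σ₁ A) rfl 0 1 1 (by decide)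
      (by decide) rfl rfl rfl
    rw [e]
    exact unit_castMul ((simplexOf p A).hom_refl 1) ((simplexOf p A).comp_refl_right _) a b _ rfl

end OfTriangle

end OperadicGrothendieck

open OperadicGrothendieck

/-!
# The Grothendieck construction of categorical operads

**Full faithfulness.** A simplex of `∫ P` is determined by its base and its edges and triangles, and
it can be prescribed on strictly increasing indices, subject to the cocycle condition
(`TotalSimplex.exists_of_lt`). Hence a map `∫ P ⟶ ∫ Q` over `X` amounts to a map of objects
`P_A → Q_A` for each edge `A` and a map on the morphisms `b ·_f p ⟶ c` for each triangle `f`, which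
preserve units and the cocycle condition over 3-simplices. Morphisms of `P_A` are the triangles over
`s₀ A`. The cocycle condition over `s₀ f` shows that the map is functorial on the fibres, that it is
natural in the second variable of the product, and that its value on `α : b ·_f p ⟶ c` is the value
on the identity of `b ·_f p` followed by the image of `α` (`TotalMap.tri_comp_map`); the cocycle
condition over `s₁ f` gives naturality in the first variable (`TotalMap.tri_natural_left`). The
values on identities are then the lax structure of a morphism of operads, whose coherence is the
cocycle condition for identities (`TotalMap.tri_assoc`). So every map over `X` comes from a unique
morphism of operads (`grothendieck_full`, `grothendieck_faithful`).

**The 2-category of `∫ P`.** Let `dec X` be the nerve of a strict 2-category `C`. An operad over `X`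
then assigns categories `E A` to the objects and `F f` to the 1-cells of `C`, with products
`F g × F f ⥤ F h` over the 2-cells `g ∘ f ⇒ h` and actions `E B × F f ⥤ E A` over the 1-cells
`f : A ⟶ B` (`Coefficients`, `coefficients`). Such a system has a strict 2-category of elements: a
1-cell `(A, a) ⟶ (B, b)` is a 1-cell `f : A ⟶ B` with `p` in `F f` and a morphism `b · p ⟶ a`, and a
2-cell is a 2-cell of `C` with a compatible morphism in the fibre. A lax triangle of this 2-category
is a lax triangle of `C` with a morphism `q · p ⟶ m` (`Coefficients.TwoCell.lax`), and the cocycle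
condition splits accordingly (`Coefficients.TwoCell.cocycle_iff`). Therefore its nerve has the same
simplices as `dec ∫ P`: the edges of a simplex to its last vertex are the objects `a`, the other
edges are the objects `p`, and the triangles are the morphisms `b · p ⟶ a` and `q · p ⟶ m`
(`Corresponds`, `decTotalIso`).

**Strict monoidal categories.** Over the terminal unary operadic 2-category `⊙`, being a functor
over the base is no condition, a morphism of operads is a normal lax monoidal functor, and a simplex
of `∫ V` is a simplex of `V^△` (`totalTriangleIso`).

**1-connected operads.** A simplex of `∫ P` over `x` consists of points `a_ij` of the categories
`P_{x_ij}` and maps `a_jk · a_ij ⟶ a_ik`, which is the same as a lift of the simplex `P x` of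
`Cat^△` to `(1/Cat)^△`. This is the pullback square (`isPullback_totalToPointed`).
-/

namespace OperadicGrothendieck

open Bicategory

/-! ### Simplices of the Duskin nerve -/

section NerveSimplices

variable {B : Type u} [Bicategory.{w, v} B]

lemma nerve_assoc_refl_refl {a b c : B} {f : a ⟶ b} {g : b ⟶ c} {h : a ⟶ c} (γ : f ≫ g ⟶ h) :
    (λ_ f).hom ▷ g ≫ γ = (α_ (𝟙 a) f g).hom ≫ 𝟙 a ◁ γ ≫ (λ_ h).hom := by
  simp

lemma nerve_assoc_refl_mid {a b c : B} {f : a ⟶ b} {m : b ⟶ b} {g : b ⟶ c} {h : a ⟶ c}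
    (e : m = 𝟙 b) (γ : f ≫ g ⟶ h) :
    (f ◁ eqToHom e ≫ (ρ_ f).hom) ▷ g ≫ γ =
      (α_ f m g).hom ≫ f ◁ (eqToHom e ▷ g ≫ (λ_ g).hom) ≫ γ := by
  subst e; simp

lemma nerve_assoc_refl_right {a b c : B} {f : a ⟶ b} {g : b ⟶ c} {m : c ⟶ c} {h : a ⟶ c}
    (e : m = 𝟙 c) (γ : f ≫ g ⟶ h) :
    γ ▷ m ≫ h ◁ eqToHom e ≫ (ρ_ h).hom =
      (α_ f g m).hom ≫ f ◁ (g ◁ eqToHom e ≫ (ρ_ g).hom) ≫ γ := by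
  subst e; simp

lemma rightUnitor_eq_whiskerLeft_refl {a b : B} (f : a ⟶ b) (e : 𝟙 b = 𝟙 b) :
    (ρ_ f).hom = f ◁ eqToHom e ≫ (ρ_ f).hom := by
  simp

lemma leftUnitor_eq_whiskerRight_refl {a b : B} (f : a ⟶ b) (e : 𝟙 a = 𝟙 a) :
    (λ_ f).hom = eqToHom e ▷ f ≫ (λ_ f).hom := by
  simp

/-- A simplex of the nerve is determined by its values on strictly increasing indices. -/
lemma NerveSimplex.ext_of_lt {n : ℕ} {S T : NerveSimplex B n} (hobj : ∀ i, S.obj i = T.obj i)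
    (hhom : ∀ i j (h : i < j), HEq (S.hom h.le) (T.hom h.le))
    (hcomp : ∀ i j k (h : i < j) (h' : j < k), HEq (S.comp h.le h'.le) (T.comp h.le h'.le)) :
    S = T := by
  rcases S with ⟨o, f, c, h₁, h₂, h₃, h₄⟩
  rcases T with ⟨o', f', c', h₁', h₂', h₃', h₄'⟩
  obtain rfl : o = o' := funext hobj
  obtain rfl : @f = @f' := by
    funext i j h
    rcases h.eq_or_lt with rfl | h
    · rw [h₁, h₁']
    · exact eq_of_heq (hhom i j h)
  obtain rfl : @c = @c' := by
    funext i j k h h'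
    rcases h.eq_or_lt with rfl | h
    · rw [h₂, h₂']
    · rcases h'.eq_or_lt with rfl | h'
      · rw [h₃, h₃']
      · exact eq_of_heq (hcomp i j k h h')
  rfl

/-- The extension of a simplex of the nerve by a new initial vertex `A`: the new edges are
`f i : A ⟶ N_i`, and the new triangles are `γ : N_ij ∘ f i ⇒ f j`. The cocycle condition for `γ` is
needed on strictly increasing indices only, as it is automatic on degenerate ones. -/
def NerveSimplex.cocone {n : ℕ} (N : NerveSimplex B n) (A : B) (f : ∀ i, A ⟶ N.obj i)
    (γ : ∀ {i j} (h : i ≤ j), f i ≫ N.hom h ⟶ f j)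
    (γ_refl : ∀ i, γ (le_refl i) = f i ◁ eqToHom (N.hom_refl i) ≫ (ρ_ (f i)).hom)
    (γ_assoc : ∀ i j k (h : i < j) (h' : j < k),
      γ h.le ▷ N.hom h'.le ≫ γ h'.le =
        (α_ (f i) (N.hom h.le) (N.hom h'.le)).hom ≫ f i ◁ N.comp h.le h'.le ≫
          γ (h.le.trans h'.le)) : NerveSimplex B (n + 1) where
  obj i := match i with
    | ⟨0, _⟩ => A
    | ⟨i + 1, hi⟩ => N.obj ⟨i, by omega⟩
  hom {i j} h := match i, j, h with
    | ⟨0, _⟩, ⟨0, _⟩, _ => 𝟙 A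
    | ⟨0, _⟩, ⟨j + 1, hj⟩, _ => f ⟨j, by omega⟩
    | ⟨i + 1, hi⟩, ⟨j + 1, hj⟩, h => N.hom (i := ⟨i, by omega⟩) (j := ⟨j, by omega⟩)
        (by simpa using h)
    | ⟨i + 1, hi⟩, ⟨0, hj⟩, h => absurd h (by simp)
  comp {i j k} h h' := match i, j, k, h, h' with
    | ⟨0, _⟩, ⟨0, _⟩, ⟨0, _⟩, _, _ => (λ_ (𝟙 A)).hom
    | ⟨0, _⟩, ⟨0, _⟩, ⟨k + 1, _⟩, _, _ => (λ_ (f ⟨k, by omega⟩)).hom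
    | ⟨0, _⟩, ⟨j + 1, _⟩, ⟨k + 1, _⟩, _, h' => γ (i := ⟨j, by omega⟩) (j := ⟨k, by omega⟩)
        (by simpa using h')
    | ⟨i + 1, _⟩, ⟨j + 1, _⟩, ⟨k + 1, _⟩, h, h' =>
        N.comp (i := ⟨i, by omega⟩) (j := ⟨j, by omega⟩) (k := ⟨k, by omega⟩)
          (by simpa using h) (by simpa using h')
    | ⟨i + 1, hi⟩, ⟨0, hj⟩, _, h, _ => absurd h (by simp)
    | _, ⟨i + 1, hi⟩, ⟨0, hj⟩, _, h => absurd h (by simp)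
  hom_refl i := match i with
    | ⟨0, _⟩ => rfl
    | ⟨i + 1, hi⟩ => N.hom_refl ⟨i, by omega⟩
  comp_refl_left {i k} h := match i, k, h with
    | ⟨0, _⟩, ⟨0, _⟩, _ => leftUnitor_eq_whiskerRight_refl _ rfl
    | ⟨0, _⟩, ⟨j + 1, hj⟩, _ => leftUnitor_eq_whiskerRight_refl _ rfl
    | ⟨i + 1, hi⟩, ⟨j + 1, hj⟩, h => N.comp_refl_left _
    | ⟨i + 1, hi⟩, ⟨0, hj⟩, h => absurd h (by simp)
  comp_refl_right {i k} h := match i, k, h with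
    | ⟨0, _⟩, ⟨0, _⟩, _ => unitors_equal.trans (rightUnitor_eq_whiskerLeft_refl _ rfl)
    | ⟨0, _⟩, ⟨j + 1, hj⟩, _ => γ_refl _
    | ⟨i + 1, hi⟩, ⟨j + 1, hj⟩, h => N.comp_refl_right _
    | ⟨i + 1, hi⟩, ⟨0, hj⟩, h => absurd h (by simp)
  comp_assoc {i j k l} h h' h'' := match i, j, k, l, h, h', h'' with
    | ⟨0, _⟩, ⟨0, _⟩, ⟨0, _⟩, ⟨0, _⟩, _, _, _ => nerve_assoc_refl_refl _
    | ⟨0, _⟩, ⟨0, _⟩, ⟨0, _⟩, ⟨l + 1, _⟩, _, _, _ => nerve_assoc_refl_refl _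
    | ⟨0, _⟩, ⟨0, _⟩, ⟨k + 1, _⟩, ⟨l + 1, _⟩, _, _, _ => nerve_assoc_refl_refl _
    | ⟨0, _⟩, ⟨j + 1, _⟩, ⟨k + 1, _⟩, ⟨l + 1, _⟩, _, h', h'' => by
      rcases h'.eq_or_lt with e | h'
      · cases e
        have := N.comp_refl_left (i := ⟨j, by omega⟩) (k := ⟨l, by omega⟩) (by simpa using h'')
        simp only [this, γ_refl]
        exact nerve_assoc_refl_mid _ _
      · rcases h''.eq_or_lt with e | h''
        · cases e
          have := N.comp_refl_right (i := ⟨j, by omega⟩) (k := ⟨k, by omega⟩)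
            (by simpa using h'.le)
          simp only [this, γ_refl]
          exact nerve_assoc_refl_right _ _
        · exact γ_assoc _ _ _ (by simpa using h') (by simpa using h'')
    | ⟨i + 1, _⟩, ⟨j + 1, _⟩, ⟨k + 1, _⟩, ⟨l + 1, _⟩, h, h', h'' => N.comp_assoc _ _ _
    | ⟨i + 1, hi⟩, ⟨0, hj⟩, _, _, h, _, _ => absurd h (by simp)
    | _, ⟨i + 1, hi⟩, ⟨0, hj⟩, _, _, h, _ => absurd h (by simp)
    | _, _, ⟨i + 1, hi⟩, ⟨0, hj⟩, _, _, h => absurd h (by simp)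

/-- The 0-simplex on an object. -/
def NerveSimplex.point (A : B) : NerveSimplex B 0 where
  obj _ := A
  hom _ := 𝟙 A
  comp _ _ := (λ_ (𝟙 A)).hom
  hom_refl _ := rfl
  comp_refl_left _ := by simp
  comp_refl_right _ := by simp [unitors_equal]
  comp_assoc _ _ _ := by simp [unitors_equal]

/-- The 1-simplex on a 1-cell. -/
def NerveSimplex.arrow {a b : B} (f : a ⟶ b) : NerveSimplex B 1 :=
  (NerveSimplex.point b).cocone a (fun _ => f) (fun _ => (ρ_ f).hom)
    (fun _ => rightUnitor_eq_whiskerLeft_refl _ rfl) (fun i j _ h => absurd h (by omega))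

/-- The 2-simplex on a 2-cell `g ∘ f ⇒ h`. -/
def NerveSimplex.triangle {a b c : B} {f : a ⟶ b} {g : b ⟶ c} {h : a ⟶ c} (σ : f ≫ g ⟶ h) :
    NerveSimplex B 2 :=
  (NerveSimplex.arrow g).cocone a
    (fun i => match i with
      | ⟨0, _⟩ => f
      | ⟨1, _⟩ => h)
    (fun {i j} hij => match i, j, hij with
      | ⟨0, _⟩, ⟨0, _⟩, _ => (ρ_ f).hom
      | ⟨0, _⟩, ⟨1, _⟩, _ => σ
      | ⟨1, _⟩, ⟨1, _⟩, _ => (ρ_ h).hom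
      | ⟨1, _⟩, ⟨0, _⟩, h => absurd h (by simp))
    (fun i => match i with
      | ⟨0, _⟩ => rightUnitor_eq_whiskerLeft_refl _ rfl
      | ⟨1, _⟩ => rightUnitor_eq_whiskerLeft_refl _ rfl)
    (fun i j k h h' => absurd (h.trans h') (by omega))

/-- The 3-simplex on a quadruple of 2-cells which satisfies the cocycle condition. -/
def NerveSimplex.tetrahedron {a b c d : B} {f : a ⟶ b} {g : b ⟶ c} {h : c ⟶ d} {p : a ⟶ c}
    {q : b ⟶ d} {r : a ⟶ d} (σ : f ≫ g ⟶ p) (τ : p ≫ h ⟶ r) (σ' : g ≫ h ⟶ q) (τ' : f ≫ q ⟶ r)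
    (e : σ ▷ h ≫ τ = (α_ f g h).hom ≫ f ◁ σ' ≫ τ') :
    NerveSimplex B 3 :=
  (NerveSimplex.triangle σ').cocone a
    (fun i => match i with
      | ⟨0, _⟩ => f
      | ⟨1, _⟩ => p
      | ⟨2, _⟩ => r)
    (fun {i j} hij => match i, j, hij with
      | ⟨0, _⟩, ⟨0, _⟩, _ => (ρ_ f).hom
      | ⟨0, _⟩, ⟨1, _⟩, _ => σ
      | ⟨0, _⟩, ⟨2, _⟩, _ => τ'
      | ⟨1, _⟩, ⟨1, _⟩, _ => (ρ_ p).hom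
      | ⟨1, _⟩, ⟨2, _⟩, _ => τ
      | ⟨2, _⟩, ⟨2, _⟩, _ => (ρ_ r).hom
      | ⟨1, _⟩, ⟨0, _⟩, h => absurd h (by simp)
      | ⟨2, _⟩, ⟨0, _⟩, h => absurd h (by simp)
      | ⟨2, _⟩, ⟨1, _⟩, h => absurd h (by simp))
    (fun i => match i with
      | ⟨0, _⟩ => rightUnitor_eq_whiskerLeft_refl _ rfl
      | ⟨1, _⟩ => rightUnitor_eq_whiskerLeft_refl _ rfl
      | ⟨2, _⟩ => rightUnitor_eq_whiskerLeft_refl _ rfl)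
    (fun i j k h h' => by
      obtain ⟨rfl, rfl, rfl⟩ : i = 0 ∧ j = 1 ∧ k = 2 := by
        revert i j k; decide
      exact e)

/-- Stated for a monotone map `φ` from `Fin 1`, not just for a vertex, so that it applies to the
faces and constant maps of a simplex without rewriting the simplicial operator. -/
lemma NerveSimplex.precomp_eq_point {n : ℕ} (N : NerveSimplex B n)
    (φ : Fin 1 →o Fin (n + 1)) {A : B} (h : N.obj (φ 0) = A) : N.precomp φ = point A := by
  subst h
  refine ext_of_lt (fun i => ?_) (fun i j h => absurd h (by omega))
    (fun i j k h => absurd h (by omega))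
  obtain rfl : i = 0 := by omega
  rfl

lemma NerveSimplex.eq_arrow (N : NerveSimplex B 1) : N = arrow (N.hom (show 0 ≤ 1 by decide)) := by
  refine ext_of_lt (fun i => ?_) (fun i j h => ?_) (fun i j k h h' => absurd h (by omega))
  · fin_cases i <;> rfl
  · obtain ⟨rfl, rfl⟩ : i = 0 ∧ j = 1 := by
      revert i j; decide
    rfl

lemma NerveSimplex.eq_triangle (N : NerveSimplex B 2) :
    N = triangle (N.comp (show 0 ≤ 1 by decide) (show 1 ≤ 2 by decide)) := by
  refine ext_of_lt (fun i => ?_) (fun i j h => ?_) (fun i j k h h' => ?_)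
  · fin_cases i <;> rfl
  · fin_cases i <;> fin_cases j <;> first | rfl | exact absurd h (by decide)
  · obtain ⟨rfl, rfl, rfl⟩ : i = 0 ∧ j = 1 ∧ k = 2 := by
      revert i j k; decide
    rfl

end NerveSimplices

end OperadicGrothendieck

namespace OperadicGrothendieck

/-! ### Triangles and tetrahedra of a categorical operad -/

section Total

variable {X : SSet.{w}} {P : CatOperad.{w, v, u} X}

/-- The unit law with all degeneracies replaced by equalities: faces of a simplex on repeated
indices are degenerate only up to propositional equality. The same form of hypotheses recurs
below. -/
lemma CatOperad.mul_obj_right_unit {A B : X _⦋1⦌} (f : X _⦋2⦌) (h : IsTri f B A B) (b : P.cat B)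
    (p : P.cat A) (c : X _⦋0⦌) (hc : c = X.δ 1 B) (hf : f = X.σ 0 B)
    (hp : (⟨A, p⟩ : Σ A, P.cat A) = ⟨X.σ 0 c, P.unit c⟩) : (P.mul f h).obj (b, p) = b := by
  subst hf hc
  cases hp
  exact P.mul_unit_obj b

lemma CatOperad.mul_obj_left_unit {A B : X _⦋1⦌} (f : X _⦋2⦌) (h : IsTri f B A A) (b : P.cat B)
    (p : P.cat A) (c : X _⦋0⦌) (hc : c = X.δ 0 A) (hf : f = X.σ 1 A)
    (hb : (⟨B, b⟩ : Σ A, P.cat A) = ⟨X.σ 0 c, P.unit c⟩) : (P.mul f h).obj (b, p) = p := by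
  subst hf hc
  cases hb
  exact P.unit_mul_obj p

/-- The condition on four morphisms over the faces of a 3-simplex that the two composites
`(a₂₃ · a₁₂) · a₀₁ = a₂₃ · (a₁₂ · a₀₁) ⟶ a₀₃` agree. The triangles `f_i` need not be literally the
faces of a 3-simplex; the equality `e` of the two products is part of the condition, so that it can
be stated for any four triangles with matching edges. -/
def CatOperad.Cocycle (P : CatOperad.{w, v, u} X) {f₀ f₁ f₂ f₃ : X _⦋2⦌}
    {A₀₁ A₁₂ A₂₃ A₀₂ A₁₃ A₀₃ : X _⦋1⦌}
    (h₀ : IsTri f₀ A₂₃ A₁₂ A₁₃) (h₁ : IsTri f₁ A₂₃ A₀₂ A₀₃)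
    (h₂ : IsTri f₂ A₁₃ A₀₁ A₀₃) (h₃ : IsTri f₃ A₁₂ A₀₁ A₀₂)
    {a₀₁ : P.cat A₀₁} {a₁₂ : P.cat A₁₂} {a₂₃ : P.cat A₂₃} {a₀₂ : P.cat A₀₂} {a₁₃ : P.cat A₁₃}
    {a₀₃ : P.cat A₀₃} (α₀ : (P.mul f₀ h₀).obj (a₂₃, a₁₂) ⟶ a₁₃)
    (α₁ : (P.mul f₁ h₁).obj (a₂₃, a₀₂) ⟶ a₀₃) (α₂ : (P.mul f₂ h₂).obj (a₁₃, a₀₁) ⟶ a₀₃)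
    (α₃ : (P.mul f₃ h₃).obj (a₁₂, a₀₁) ⟶ a₀₂) : Prop :=
  ∃ e, (P.mul f₂ h₂).map (Prod.mkHom α₀ (𝟙 a₀₁)) ≫ α₂ =
    eqToHom e ≫ (P.mul f₁ h₁).map (Prod.mkHom (𝟙 a₂₃) α₃) ≫ α₁

lemma map_eqToHom_left {C D E : Type*} [Category* C] [Category* D] [Category* E] (F : C × D ⥤ E)
    {c c' : C} (e : c = c') (d : D) :
    F.map (Prod.mkHom (eqToHom e) (𝟙 d)) = eqToHom (by rw [e]) := by
  subst e
  exact F.map_id _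

lemma map_eqToHom_right {C D E : Type*} [Category* C] [Category* D] [Category* E] (F : C × D ⥤ E)
    (c : C) {d d' : D} (e : d = d') :
    F.map (Prod.mkHom (𝟙 c) (eqToHom e)) = eqToHom (by rw [e]) := by
  subst e
  exact F.map_id _

lemma CatOperad.mul_unit_map (P : CatOperad.{w, v, u} X) {A : X _⦋1⦌} {a a' : P.cat A}
    (x : a ⟶ a') : (P.mul _ (isTri_σ₀ A)).map (Prod.mkHom x (𝟙 (P.unit (X.δ 1 A)))) =
      eqToHom (P.mul_unit_obj a) ≫ x ≫ eqToHom (P.mul_unit_obj a').symm :=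
  Functor.congr_hom (P.mul_unit A) x

lemma CatOperad.unit_mul_map (P : CatOperad.{w, v, u} X) {A : X _⦋1⦌} {a a' : P.cat A}
    (x : a ⟶ a') : (P.mul _ (isTri_σ₁ A)).map (Prod.mkHom (𝟙 (P.unit (X.δ 0 A))) x) =
      eqToHom (P.unit_mul_obj a) ≫ x ≫ eqToHom (P.unit_mul_obj a').symm :=
  Functor.congr_hom (P.unit_mul A) x

/-- The cocycle condition is automatic on `i ≤ i ≤ k ≤ l`. -/
lemma CatOperad.cocycle_refl_left {f f₂ f₃ : X _⦋2⦌} {A₁₂ A₂₃ A₁₃ E : X _⦋1⦌}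
    (h : IsTri f A₂₃ A₁₂ A₁₃) (h₂ : IsTri f₂ A₁₃ E A₁₃) (h₃ : IsTri f₃ A₁₂ E A₁₂)
    {e : P.cat E} {a₁₂ : P.cat A₁₂} {a₂₃ : P.cat A₂₃} {a₁₃ : P.cat A₁₃}
    (α : (P.mul f h).obj (a₂₃, a₁₂) ⟶ a₁₃) (α₂ : (P.mul f₂ h₂).obj (a₁₃, e) ⟶ a₁₃)
    (α₃ : (P.mul f₃ h₃).obj (a₁₂, e) ⟶ a₁₂) (h_id₂ : ∃ d, α₂ = eqToHom d)
    (h_id₃ : ∃ d, α₃ = eqToHom d) (c : X _⦋0⦌) (hc : c = X.δ 1 A₁₃) (hf : f₂ = X.σ 0 A₁₃)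
    (he : (⟨E, e⟩ : Σ A, P.cat A) = ⟨X.σ 0 c, P.unit c⟩) :
    P.Cocycle h h h₂ h₃ α α α₂ α₃ := by
  subst hc hf
  cases he
  obtain ⟨d, rfl⟩ := h_id₂
  obtain ⟨d', rfl⟩ := h_id₃
  refine ⟨(P.mul_unit_obj _).trans (congrArg (fun z => (P.mul f h).obj (a₂₃, z)) d'.symm), ?_⟩
  rw [map_eqToHom_right, P.mul_unit_map]
  simp

/-- The cocycle condition is automatic on `i ≤ j ≤ j ≤ l`. -/
lemma CatOperad.cocycle_refl_mid {f f₀ f₃ : X _⦋2⦌} {A₀₁ A₂₃ A₀₃ E : X _⦋1⦌}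
    (h : IsTri f A₂₃ A₀₁ A₀₃) (h₀ : IsTri f₀ A₂₃ E A₂₃) (h₃ : IsTri f₃ E A₀₁ A₀₁)
    {e : P.cat E} {a₀₁ : P.cat A₀₁} {a₂₃ : P.cat A₂₃} {a₀₃ : P.cat A₀₃}
    (α : (P.mul f h).obj (a₂₃, a₀₁) ⟶ a₀₃) (α₀ : (P.mul f₀ h₀).obj (a₂₃, e) ⟶ a₂₃)
    (α₃ : (P.mul f₃ h₃).obj (e, a₀₁) ⟶ a₀₁) (h_id₀ : ∃ d, α₀ = eqToHom d)
    (h_id₃ : ∃ d, α₃ = eqToHom d) :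
    P.Cocycle h₀ h h h₃ α₀ α α α₃ := by
  obtain ⟨d, rfl⟩ := h_id₀
  obtain ⟨d', rfl⟩ := h_id₃
  refine ⟨(congrArg (fun z => (P.mul f h).obj (z, a₀₁)) d).trans
    (congrArg (fun z => (P.mul f h).obj (a₂₃, z)) d'.symm), ?_⟩
  rw [map_eqToHom_left, map_eqToHom_right]
  simp

/-- The cocycle condition is automatic on `i ≤ j ≤ k ≤ k`. -/
lemma CatOperad.cocycle_refl_right {f f₀ f₁ : X _⦋2⦌} {A₁₂ A₀₁ A₀₂ E : X _⦋1⦌}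
    (h : IsTri f A₁₂ A₀₁ A₀₂) (h₀ : IsTri f₀ E A₁₂ A₁₂) (h₁ : IsTri f₁ E A₀₂ A₀₂)
    {e : P.cat E} {a₁₂ : P.cat A₁₂} {a₀₁ : P.cat A₀₁} {a₀₂ : P.cat A₀₂}
    (α : (P.mul f h).obj (a₁₂, a₀₁) ⟶ a₀₂) (α₀ : (P.mul f₀ h₀).obj (e, a₁₂) ⟶ a₁₂)
    (α₁ : (P.mul f₁ h₁).obj (e, a₀₂) ⟶ a₀₂) (h_id₀ : ∃ d, α₀ = eqToHom d)
    (h_id₁ : ∃ d, α₁ = eqToHom d) (c : X _⦋0⦌) (hc : c = X.δ 0 A₀₂) (hf : f₁ = X.σ 1 A₀₂)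
    (he : (⟨E, e⟩ : Σ A, P.cat A) = ⟨X.σ 0 c, P.unit c⟩) :
    P.Cocycle h₀ h₁ h h α₀ α₁ α α := by
  subst hc hf
  cases he
  obtain ⟨d, rfl⟩ := h_id₀
  obtain ⟨d', rfl⟩ := h_id₁
  refine ⟨(congrArg (fun z => (P.mul f h).obj (z, a₀₁)) d).trans (P.unit_mul_obj _).symm, ?_⟩
  rw [map_eqToHom_left, P.unit_mul_map]
  simp

/-! ### Simplices of the Grothendieck construction -/

/-- A simplex of the Grothendieck construction is determined by its values on strictly increasing
indices. -/
lemma TotalSimplex.ext_of_lt {n : ℕ} {S T : TotalSimplex P n} (hbase : S.base = T.base)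
    (hpt : ∀ i j (h : i < j), S.pt h.le = T.pt h.le)
    (hcomp : ∀ i j k (h : i < j) (h' : j < k) f hf hf' t t',
      HEq (S.comp h.le h'.le f hf t) (T.comp h.le h'.le f hf' t')) : S = T := by
  rcases S with ⟨b, p, h₁, c, h₂, h₃, h₄, _⟩
  rcases T with ⟨b', p', h₁', c', h₂', h₃', h₄', _⟩
  obtain rfl : b = b' := hbase
  obtain rfl : @p = @p' := by
    funext i j h
    rcases h.eq_or_lt with rfl | h
    · rw [h₂, h₂']
    · exact hpt i j h
  obtain rfl : @c = @c' := by
    funext i j k h h' f hf t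
    rcases h.eq_or_lt with rfl | h
    · obtain ⟨e, he⟩ := h₃ h' f hf t
      obtain ⟨e', he'⟩ := h₃' h' f hf t
      rw [he, he']
    · rcases h'.eq_or_lt with rfl | h'
      · obtain ⟨e, he⟩ := h₄ h.le f hf t
        obtain ⟨e', he'⟩ := h₄' h.le f hf t
        rw [he, he']
      · exact eq_of_heq (hcomp i j k h h' f hf hf t t)
  rfl

/-- Data on strictly increasing indices which satisfy the cocycle condition extend to a simplex of
the Grothendieck construction. -/
theorem TotalSimplex.exists_of_lt {n : ℕ} (base : X _⦋n⦌)
    (pt : ∀ i j : Fin (n + 1), i < j → Σ A, P.cat A)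
    (pt_fst : ∀ i j h, (pt i j h).1 = edge base h.le)
    (comp : ∀ i j k (h : i < j) (h' : j < k) (f : X _⦋2⦌), f = face base h.le h'.le →
      ∀ t : IsTri f (pt j k h').1 (pt i j h).1 (pt i k (h.trans h')).1,
        ((P.mul f t).obj ((pt j k h').2, (pt i j h).2) ⟶ (pt i k (h.trans h')).2))
    (assoc : ∀ i j k l (h : i < j) (h' : j < k) (h'' : k < l) f₀ f₁ f₂ f₃ hf₀ hf₁ hf₂ hf₃
      t₀ t₁ t₂ t₃, P.Cocycle t₀ t₁ t₂ t₃ (comp j k l h' h'' f₀ hf₀ t₀)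
        (comp i k l (h.trans h') h'' f₁ hf₁ t₁) (comp i j l h (h'.trans h'') f₂ hf₂ t₂)
        (comp i j k h h' f₃ hf₃ t₃)) :
    ∃ S : TotalSimplex P n, S.base = base ∧ (∀ i j (h : i < j), S.pt h.le = pt i j h) ∧
      ∀ i j k (h : i < j) (h' : j < k) f hf hf' t t',
        HEq (S.comp h.le h'.le f hf t) (comp i j k h h' f hf' t') := by
  -- the objects, extended by the units on the diagonal
  obtain ⟨q, hq, hq_refl⟩ : ∃ q : ∀ i j : Fin (n + 1), i ≤ j → Σ A, P.cat A,
      (∀ i j h, pt i j h = q i j h.le) ∧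
        ∀ i, q i i le_rfl = ⟨X.σ 0 (vertex base i), P.unit (vertex base i)⟩ := by
    refine ⟨fun i j h => if h' : i < j then pt i j h' else
      ⟨X.σ 0 (vertex base i), P.unit (vertex base i)⟩, fun i j h => ?_, fun i => ?_⟩
    · exact (dif_pos h).symm
    · exact dif_neg (lt_irrefl i)
  obtain rfl : pt = fun i j h => q i j h.le := by
    funext i j h
    exact hq i j h
  have q_fst : ∀ i j h, (q i j h).1 = edge base h := by
    intro i j h
    rcases h.eq_or_lt with rfl | h
    · rw [hq_refl]
      have := (isTri_face base (le_refl i) (le_refl i)).d2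
      rw [σ₀_edge] at this
      rw [vertex_eq_δ₁ base (le_refl i)]
      exact (isTri_σ₀ _).d2.symm.trans this
    · exact pt_fst i j h
  -- over a degenerate triangle the morphism has to be an identity
  have key : ∀ i j k (h : i ≤ j) (h' : j ≤ k) (f : X _⦋2⦌) (_ : f = face base h h')
      (t : IsTri f (q j k h').1 (q i j h).1 (q i k (h.trans h')).1),
      ∃ α : (P.mul f t).obj ((q j k h').2, (q i j h).2) ⟶ (q i k (h.trans h')).2,
        (∀ (l : i < j) (l' : j < k) hf, α = comp i j k l l' f hf t) ∧
          (i = j → ∃ e, α = eqToHom e) ∧ (j = k → ∃ e, α = eqToHom e) := by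
    intro i j k h h' f hf t
    rcases h.eq_or_lt with rfl | h
    · have e := P.mul_obj_right_unit f t (q i k h').2 (q i i le_rfl).2 (vertex base i)
        (by rw [q_fst]; exact vertex_eq_δ₁ _ _)
        (by rw [hf, q_fst]; exact σ₀_edge _ _) (hq_refl i)
      exact ⟨eqToHom e, fun l => absurd l (lt_irrefl _), fun _ => ⟨e, rfl⟩, fun _ => ⟨e, rfl⟩⟩
    · rcases h'.eq_or_lt with rfl | h'
      · have e := P.mul_obj_left_unit f t (q j j le_rfl).2 (q i j h.le).2 (vertex base j)
          (by rw [q_fst]; exact vertex_eq_δ₀ _ _)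
          (by rw [hf, q_fst]; exact σ₁_edge _ _) (hq_refl j)
        exact ⟨eqToHom e, fun _ l => absurd l (lt_irrefl _), fun _ => ⟨e, rfl⟩, fun _ => ⟨e, rfl⟩⟩
      · exact ⟨comp i j k h h' f hf t, fun _ _ _ => rfl, fun e => absurd e h.ne,
          fun e => absurd e h'.ne⟩
  choose c hc hc_left hc_right using key
  refine ⟨{
    base := base
    pt := fun {i j} h => q i j h
    pt_fst := fun h => q_fst _ _ h
    comp := fun {i j k} h h' f hf t => c i j k h h' f hf t
    pt_refl := hq_refl
    comp_refl_left := fun _ f hf t => hc_left _ _ _ _ _ f hf t rfl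
    comp_refl_right := fun _ f hf t => hc_right _ _ _ _ _ f hf t rfl
    comp_assoc := ?_ }, rfl, fun i j h => rfl, fun i j k h h' f hf hf' t t' =>
      heq_of_eq (hc i j k h.le h'.le f hf t h h' hf)⟩
  intro i j k l h h' h'' f₀ f₁ f₂ f₃ hf₀ hf₁ hf₂ hf₃ t₀ t₁ t₂ t₃
  rcases h.eq_or_lt with rfl | h
  · obtain rfl : f₀ = f₁ := hf₀.trans hf₁.symm
    exact P.cocycle_refl_left t₀ t₂ t₃ _ _ _ (hc_left _ _ _ _ _ f₂ hf₂ t₂ rfl)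
      (hc_left _ _ _ _ _ f₃ hf₃ t₃ rfl) (vertex base i)
      (by rw [q_fst]; exact vertex_eq_δ₁ _ _) (by rw [hf₂, q_fst]; exact σ₀_edge _ _) (hq_refl i)
  · rcases h'.eq_or_lt with rfl | h'
    · obtain rfl : f₁ = f₂ := hf₁.trans hf₂.symm
      exact P.cocycle_refl_mid t₁ t₀ t₃ _ _ _ (hc_left _ _ _ _ _ f₀ hf₀ t₀ rfl)
        (hc_right _ _ _ _ _ f₃ hf₃ t₃ rfl)
    · rcases h''.eq_or_lt with rfl | h''
      · obtain rfl : f₂ = f₃ := hf₂.trans hf₃.symm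
        exact P.cocycle_refl_right t₂ t₀ t₁ _ _ _ (hc_right _ _ _ _ _ f₀ hf₀ t₀ rfl)
          (hc_right _ _ _ _ _ f₁ hf₁ t₁ rfl) (vertex base k)
          (by rw [q_fst]; exact vertex_eq_δ₀ _ _) (by rw [hf₁, q_fst]; exact σ₁_edge _ _)
          (hq_refl k)
      · rw [hc i j k h.le h'.le f₃ hf₃ t₃ h h' hf₃, hc j k l h'.le h''.le f₀ hf₀ t₀ h' h'' hf₀,
          hc i k l (h.le.trans h'.le) h''.le f₁ hf₁ t₁ (h.trans h') h'' hf₁,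
          hc i j l h.le (h'.le.trans h''.le) f₂ hf₂ t₂ h (h'.trans h'') hf₂]
        exact assoc i j k l h h' h'' f₀ f₁ f₂ f₃ hf₀ hf₁ hf₂ hf₃ t₀ t₁ t₂ t₃

end Total

/-! ### Faces of simplices of the Grothendieck construction -/

section Faces

variable {X : SSet.{w}} {P : CatOperad.{w, v, u} X}

lemma TotalSimplex.isTri {n : ℕ} (S : TotalSimplex P n) {i j k : Fin (n + 1)} (hij : i ≤ j)
    (hjk : j ≤ k) :
    IsTri (face S.base hij hjk) (S.pt hjk).1 (S.pt hij).1 (S.pt (hij.trans hjk)).1 := by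
  rw [S.pt_fst, S.pt_fst, S.pt_fst]
  exact isTri_face _ _ _

/-- The 2-dimensional face of a simplex on the vertices `i, j, k` is the 2-simplex over `f` with
edges `b`, `p`, `c` and 2-cell `α : b ·_f p ⟶ c`. The equalities between dependent data are stated
with `HEq`, so that a face can be described without transport. -/
structure TotalSimplex.HasFace {n : ℕ} (S : TotalSimplex P n) {i j k : Fin (n + 1)} (hij : i ≤ j)
    (hjk : j ≤ k) {B A C : X _⦋1⦌} {f : X _⦋2⦌} (h : IsTri f B A C) {b : P.cat B} {p : P.cat A}
    {c : P.cat C} (α : (P.mul f h).obj (b, p) ⟶ c) : Prop where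
  base : f = face S.base hij hjk
  pt_jk : S.pt hjk = ⟨B, b⟩
  pt_ij : S.pt hij = ⟨A, p⟩
  pt_ik : S.pt (hij.trans hjk) = ⟨C, c⟩
  comp : ∀ f' hf' h', HEq (S.comp hij hjk f' hf' h') α

namespace TotalSimplex

variable {n : ℕ} {S : TotalSimplex P n}

lemma hasFace_comp (S : TotalSimplex P n) {i j k : Fin (n + 1)} (hij : i ≤ j) (hjk : j ≤ k)
    (f hf h) : S.HasFace hij hjk h (S.comp hij hjk f hf h) :=
  ⟨hf, rfl, rfl, rfl, fun f' hf' h' => by subst hf hf'; rfl⟩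

lemma exists_hasFace {i j k : Fin (n + 1)} {hij : i ≤ j} {hjk : j ≤ k} {B A C : X _⦋1⦌}
    {f : X _⦋2⦌} (h : IsTri f B A C) {b : P.cat B} {p : P.cat A} {c : P.cat C}
    (hf : f = face S.base hij hjk) (h₁ : S.pt hjk = ⟨B, b⟩) (h₂ : S.pt hij = ⟨A, p⟩)
    (h₃ : S.pt (hij.trans hjk) = ⟨C, c⟩) :
    ∃ α : (P.mul f h).obj (b, p) ⟶ c, S.HasFace hij hjk h α := by
  obtain ⟨rfl, hb⟩ := Sigma.mk.inj_iff.1 h₁.symm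
  obtain ⟨rfl, hp⟩ := Sigma.mk.inj_iff.1 h₂.symm
  obtain ⟨rfl, hc⟩ := Sigma.mk.inj_iff.1 h₃.symm
  obtain rfl := eq_of_heq hb
  obtain rfl := eq_of_heq hp
  obtain rfl := eq_of_heq hc
  exact ⟨_, S.hasFace_comp hij hjk f hf h⟩

lemma hasFace_precomp_iff {m : ℕ} (φ : ⦋m⦌ ⟶ ⦋n⦌) {i j k : Fin (m + 1)} {hij : i ≤ j}
    {hjk : j ≤ k} {B A C : X _⦋1⦌}
    {f : X _⦋2⦌} {h : IsTri f B A C} {b : P.cat B} {p : P.cat A} {c : P.cat C}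
    {α : (P.mul f h).obj (b, p) ⟶ c} : (S.precomp φ).HasFace hij hjk h α ↔
      S.HasFace (φ.toOrderHom.monotone hij) (φ.toOrderHom.monotone hjk) h α :=
  ⟨fun H => ⟨H.base.trans (face_map φ S.base hij hjk), H.pt_jk, H.pt_ij, H.pt_ik,
      fun f' hf' => H.comp f' (hf'.trans (face_map φ S.base hij hjk).symm)⟩,
    fun H => ⟨H.base.trans (face_map φ S.base hij hjk).symm, H.pt_jk, H.pt_ij, H.pt_ik,
      fun f' hf' => H.comp f' (hf'.trans (face_map φ S.base hij hjk))⟩⟩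

/-- The faces of a tetrahedron in a simplex satisfy the cocycle condition. -/
lemma HasFace.cocycle {i j k l : Fin (n + 1)} {hij : i ≤ j} {hjk : j ≤ k} {hkl : k ≤ l}
    {f₀ f₁ f₂ f₃ : X _⦋2⦌} {A₀₁ A₁₂ A₂₃ A₀₂ A₁₃ A₀₃ : X _⦋1⦌}
    {h₀ : IsTri f₀ A₂₃ A₁₂ A₁₃} {h₁ : IsTri f₁ A₂₃ A₀₂ A₀₃}
    {h₂ : IsTri f₂ A₁₃ A₀₁ A₀₃} {h₃ : IsTri f₃ A₁₂ A₀₁ A₀₂}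
    {a₀₁ : P.cat A₀₁} {a₁₂ : P.cat A₁₂} {a₂₃ : P.cat A₂₃} {a₀₂ : P.cat A₀₂} {a₁₃ : P.cat A₁₃}
    {a₀₃ : P.cat A₀₃} {α₀ : (P.mul f₀ h₀).obj (a₂₃, a₁₂) ⟶ a₁₃}
    {α₁ : (P.mul f₁ h₁).obj (a₂₃, a₀₂) ⟶ a₀₃} {α₂ : (P.mul f₂ h₂).obj (a₁₃, a₀₁) ⟶ a₀₃}
    {α₃ : (P.mul f₃ h₃).obj (a₁₂, a₀₁) ⟶ a₀₂}
    (H₀ : S.HasFace hjk hkl h₀ α₀) (H₁ : S.HasFace (hij.trans hjk) hkl h₁ α₁)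
    (H₂ : S.HasFace hij (hjk.trans hkl) h₂ α₂) (H₃ : S.HasFace hij hjk h₃ α₃) :
    P.Cocycle h₀ h₁ h₂ h₃ α₀ α₁ α₂ α₃ := by
  obtain ⟨rfl, e⟩ := Sigma.mk.inj_iff.1 H₃.pt_ij.symm
  obtain rfl := eq_of_heq e
  obtain ⟨rfl, e⟩ := Sigma.mk.inj_iff.1 H₃.pt_jk.symm
  obtain rfl := eq_of_heq e
  obtain ⟨rfl, e⟩ := Sigma.mk.inj_iff.1 H₃.pt_ik.symm
  obtain rfl := eq_of_heq e
  obtain ⟨rfl, e⟩ := Sigma.mk.inj_iff.1 H₀.pt_jk.symm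
  obtain rfl := eq_of_heq e
  obtain ⟨rfl, e⟩ := Sigma.mk.inj_iff.1 H₀.pt_ik.symm
  obtain rfl := eq_of_heq e
  obtain ⟨rfl, e⟩ := Sigma.mk.inj_iff.1 H₁.pt_ik.symm
  obtain rfl := eq_of_heq e
  have b₀ := H₀.base
  obtain rfl := eq_of_heq (H₀.comp _ b₀ h₀)
  have b₁ := H₁.base
  obtain rfl := eq_of_heq (H₁.comp _ b₁ h₁)
  have b₂ := H₂.base
  obtain rfl := eq_of_heq (H₂.comp _ b₂ h₂)
  have b₃ := H₃.base
  obtain rfl := eq_of_heq (H₃.comp _ b₃ h₃)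
  exact S.comp_assoc hij hjk hkl _ _ _ _ _ _ _ _ _ _ _ _

lemma edge_self (A : X _⦋1⦌) : edge A (show (0 : Fin 2) ≤ 1 by decide) = A := by
  have : SimplexCategory.mkOfLe (0 : Fin 2) 1 (by decide) = 𝟙 ⦋1⦌ := by
    ext a : 3
    fin_cases a <;> rfl
  rw [edge, this, op_id, X.map_id]
  rfl

lemma face_self (f : X _⦋2⦌) :
    face f (show (0 : Fin 3) ≤ 1 by decide) (show (1 : Fin 3) ≤ 2 by decide) = f := by
  have : SimplexCategory.mkOfLeComp (0 : Fin 3) 1 2 (by decide) (by decide) = 𝟙 ⦋2⦌ := by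
    ext a : 3
    fin_cases a <;> rfl
  rw [face, this, op_id, X.map_id]
  rfl

/-- Every object of a fibre is the edge of a 1-simplex of the Grothendieck construction. -/
lemma exists_edge {A : X _⦋1⦌} (a : P.cat A) :
    ∃ S : TotalSimplex P 1, S.base = A ∧ S.pt (show 0 ≤ 1 by decide) = ⟨A, a⟩ := by
  obtain ⟨S, h, h', -⟩ := TotalSimplex.exists_of_lt (P := P) (n := 1) A (fun _ _ _ => ⟨A, a⟩)
    (fun i j h => by
      obtain ⟨rfl, rfl⟩ : i = 0 ∧ j = 1 := by
        revert i j; decide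
      exact (edge_self A).symm)
    (fun i j k h h' => absurd (h.trans h') (by omega))
    (fun i j k l h h' => absurd (h.trans h') (by omega))
  exact ⟨S, h, h' 0 1 (by decide)⟩

/-- Every morphism over a triangle is the 2-cell of a 2-simplex of the Grothendieck construction. -/
lemma exists_triangle {B A C : X _⦋1⦌} {f : X _⦋2⦌} (h : IsTri f B A C) {b : P.cat B}
    {p : P.cat A} {c : P.cat C} (α : (P.mul f h).obj (b, p) ⟶ c) :
    ∃ S : TotalSimplex P 2, S.base = f ∧ S.HasFace (i := 0) (j := 1) (k := 2) (by decide)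
      (by decide) h α := by
  let pt (i j : Fin 3) (_ : i < j) : Σ A, P.cat A :=
    if i = 0 then if j = 1 then ⟨A, p⟩ else ⟨C, c⟩ else ⟨B, b⟩
  have key : ∀ i j k : Fin 3, i < j → j < k → i = 0 ∧ j = 1 ∧ k = 2 := by decide
  have hf := isTri_face f (show (0 : Fin 3) ≤ 1 by decide) (show (1 : Fin 3) ≤ 2 by decide)
  rw [face_self] at hf
  have hcomp : ∀ i j k (hij : i < j) (hjk : j < k) f', f' = face f hij.le hjk.le →
      ∀ t : IsTri f' (pt j k hjk).1 (pt i j hij).1 (pt i k (hij.trans hjk)).1,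
        ∃ β : (P.mul f' t).obj ((pt j k hjk).2, (pt i j hij).2) ⟶ (pt i k (hij.trans hjk)).2,
          HEq β α := by
    intro i j k hij hjk f' hf' t
    obtain ⟨rfl, rfl, rfl⟩ := key i j k hij hjk
    obtain rfl := hf'.trans (face_self f)
    exact ⟨α, HEq.rfl⟩
  choose comp hcomp using hcomp
  obtain ⟨S, rfl, hpt, hS⟩ := TotalSimplex.exists_of_lt (P := P) (n := 2) f pt
    (fun i j hij => by
      obtain ⟨rfl, rfl⟩ | ⟨rfl, rfl⟩ | ⟨rfl, rfl⟩ :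
          i = 0 ∧ j = 1 ∨ i = 1 ∧ j = 2 ∨ i = 0 ∧ j = 2 := by
        clear * - hij; revert i j; decide
      · exact h.d2.symm.trans hf.d2
      · exact h.d0.symm.trans hf.d0
      · exact h.d1.symm.trans hf.d1)
    comp
    (fun i j k l hij hjk hkl => by
      have := key i j k hij hjk
      have := key j k l hjk hkl
      simp_all)
  refine ⟨S, rfl, (face_self _).symm, hpt 1 2 (by decide), hpt 0 1 (by decide),
    hpt 0 2 (by decide), fun f' hf' h' => ?_⟩
  obtain rfl := hf'.trans (face_self _)
  exact (hS 0 1 2 (by decide) (by decide) _ _ hf' h' h).trans (hcomp _ _ _ _ _ _ _ _)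

/-- Every quadruple of 2-cells which satisfies the cocycle condition consists of the faces of a
3-simplex of the Grothendieck construction. -/
lemma exists_tetrahedron (s : X _⦋3⦌)
    {A₀₁ A₁₂ A₂₃ A₀₂ A₁₃ A₀₃ : X _⦋1⦌}
    {h₀ : IsTri (X.δ 0 s) A₂₃ A₁₂ A₁₃} {h₁ : IsTri (X.δ 1 s) A₂₃ A₀₂ A₀₃}
    {h₂ : IsTri (X.δ 2 s) A₁₃ A₀₁ A₀₃} {h₃ : IsTri (X.δ 3 s) A₁₂ A₀₁ A₀₂}
    {a₀₁ : P.cat A₀₁} {a₁₂ : P.cat A₁₂} {a₂₃ : P.cat A₂₃} {a₀₂ : P.cat A₀₂} {a₁₃ : P.cat A₁₃}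
    {a₀₃ : P.cat A₀₃} {α₀ : (P.mul _ h₀).obj (a₂₃, a₁₂) ⟶ a₁₃}
    {α₁ : (P.mul _ h₁).obj (a₂₃, a₀₂) ⟶ a₀₃} {α₂ : (P.mul _ h₂).obj (a₁₃, a₀₁) ⟶ a₀₃}
    {α₃ : (P.mul _ h₃).obj (a₁₂, a₀₁) ⟶ a₀₂} (H : P.Cocycle h₀ h₁ h₂ h₃ α₀ α₁ α₂ α₃) :
    ∃ S : TotalSimplex P 3,
      S.HasFace (i := 1) (j := 2) (k := 3) (by decide) (by decide) h₀ α₀ ∧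
      S.HasFace (i := 0) (j := 2) (k := 3) (by decide) (by decide) h₁ α₁ ∧
      S.HasFace (i := 0) (j := 1) (k := 3) (by decide) (by decide) h₂ α₂ ∧
      S.HasFace (i := 0) (j := 1) (k := 2) (by decide) (by decide) h₃ α₃ := by
  let pt (i j : Fin 4) (_ : i < j) : Σ A, P.cat A :=
    if i = 0 then if j = 1 then ⟨_, a₀₁⟩ else if j = 2 then ⟨_, a₀₂⟩ else ⟨_, a₀₃⟩
    else if i = 1 then if j = 2 then ⟨_, a₁₂⟩ else ⟨_, a₁₃⟩ else ⟨_, a₂₃⟩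
  have key : ∀ i j k : Fin 4, i < j → j < k → i = 1 ∧ j = 2 ∧ k = 3 ∨ i = 0 ∧ j = 2 ∧ k = 3 ∨
    i = 0 ∧ j = 1 ∧ k = 3 ∨ i = 0 ∧ j = 1 ∧ k = 2 := by decide
  have face_δ (l : Fin 4) (i j k : Fin 4) (hij : i ≤ j) (hjk : j ≤ k)
      (e : SimplexCategory.mkOfLeComp i j k hij hjk = SimplexCategory.δ l) :
      face s hij hjk = X.δ l s := by
    rw [face, e]
    rfl
  have f₀ : face s (show (1 : Fin 4) ≤ 2 by decide) (show (2 : Fin 4) ≤ 3 by decide) = X.δ 0 s :=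
    face_δ _ _ _ _ _ _ (by ext a : 3; fin_cases a <;> rfl)
  have f₁ : face s (show (0 : Fin 4) ≤ 2 by decide) (show (2 : Fin 4) ≤ 3 by decide) = X.δ 1 s :=
    face_δ _ _ _ _ _ _ (by ext a : 3; fin_cases a <;> rfl)
  have f₂ : face s (show (0 : Fin 4) ≤ 1 by decide) (show (1 : Fin 4) ≤ 3 by decide) = X.δ 2 s :=
    face_δ _ _ _ _ _ _ (by ext a : 3; fin_cases a <;> rfl)
  have f₃ : face s (show (0 : Fin 4) ≤ 1 by decide) (show (1 : Fin 4) ≤ 2 by decide) = X.δ 3 s :=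
    face_δ _ _ _ _ _ _ (by ext a : 3; fin_cases a <;> rfl)
  have hcomp : ∀ i j k (hij : i < j) (hjk : j < k) f', f' = face s hij.le hjk.le →
      ∀ t : IsTri f' (pt j k hjk).1 (pt i j hij).1 (pt i k (hij.trans hjk)).1,
        ∃ β : (P.mul f' t).obj ((pt j k hjk).2, (pt i j hij).2) ⟶ (pt i k (hij.trans hjk)).2,
          (i = 1 ∧ j = 2 ∧ k = 3 → HEq β α₀) ∧ (i = 0 ∧ j = 2 ∧ k = 3 → HEq β α₁) ∧
            (i = 0 ∧ j = 1 ∧ k = 3 → HEq β α₂) ∧ (i = 0 ∧ j = 1 ∧ k = 2 → HEq β α₃) := by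
    intro i j k hij hjk f' hf' t
    obtain ⟨rfl, rfl, rfl⟩ | ⟨rfl, rfl, rfl⟩ | ⟨rfl, rfl, rfl⟩ | ⟨rfl, rfl, rfl⟩ :=
      key i j k hij hjk
    · obtain rfl := hf'.trans f₀
      exact ⟨α₀, fun _ => HEq.rfl, fun h => absurd h (by decide), fun h => absurd h (by decide),
        fun h => absurd h (by decide)⟩
    · obtain rfl := hf'.trans f₁
      exact ⟨α₁, fun h => absurd h (by decide), fun _ => HEq.rfl, fun h => absurd h (by decide),
        fun h => absurd h (by decide)⟩
    · obtain rfl := hf'.trans f₂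
      exact ⟨α₂, fun h => absurd h (by decide), fun h => absurd h (by decide), fun _ => HEq.rfl,
        fun h => absurd h (by decide)⟩
    · obtain rfl := hf'.trans f₃
      exact ⟨α₃, fun h => absurd h (by decide), fun h => absurd h (by decide),
        fun h => absurd h (by decide), fun _ => HEq.rfl⟩
  choose comp hcomp₀ hcomp₁ hcomp₂ hcomp₃ using hcomp
  have t₀ := isTri_face s (show (1 : Fin 4) ≤ 2 by decide) (show (2 : Fin 4) ≤ 3 by decide)
  have t₁ := isTri_face s (show (0 : Fin 4) ≤ 2 by decide) (show (2 : Fin 4) ≤ 3 by decide)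
  have t₃ := isTri_face s (show (0 : Fin 4) ≤ 1 by decide) (show (1 : Fin 4) ≤ 2 by decide)
  rw [f₀] at t₀
  rw [f₁] at t₁
  rw [f₃] at t₃
  obtain ⟨S, rfl, hpt, hS⟩ := TotalSimplex.exists_of_lt (P := P) (n := 3) s pt
    (fun i j hij => by
      obtain ⟨rfl, rfl⟩ | ⟨rfl, rfl⟩ | ⟨rfl, rfl⟩ | ⟨rfl, rfl⟩ | ⟨rfl, rfl⟩ | ⟨rfl, rfl⟩ :
          i = 0 ∧ j = 1 ∨ i = 1 ∧ j = 2 ∨ i = 0 ∧ j = 2 ∨ i = 0 ∧ j = 3 ∨ i = 1 ∧ j = 3 ∨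
            i = 2 ∧ j = 3 := by
        clear * - hij; revert i j; decide
      · exact h₃.d2.symm.trans t₃.d2
      · exact h₃.d0.symm.trans t₃.d0
      · exact h₃.d1.symm.trans t₃.d1
      · exact h₁.d1.symm.trans t₁.d1
      · exact h₀.d1.symm.trans t₀.d1
      · exact h₀.d0.symm.trans t₀.d0)
    comp
    (fun i j k l hij hjk hkl g₀ g₁ g₂ g₃ hg₀ hg₁ hg₂ hg₃ r₀ r₁ r₂ r₃ => by
      obtain ⟨rfl, rfl, rfl, rfl⟩ : i = 0 ∧ j = 1 ∧ k = 2 ∧ l = 3 := by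
        clear * - hij hjk hkl
        revert i j k l
        decide
      obtain rfl := hg₀.trans f₀
      obtain rfl := hg₁.trans f₁
      obtain rfl := hg₂.trans f₂
      obtain rfl := hg₃.trans f₃
      have e₀ := eq_of_heq (hcomp₀ _ _ _ hjk hkl _ hg₀ r₀ (by decide))
      have e₁ := eq_of_heq (hcomp₁ _ _ _ (hij.trans hjk) hkl _ hg₁ r₁ (by decide))
      have e₂ := eq_of_heq (hcomp₂ _ _ _ hij (hjk.trans hkl) _ hg₂ r₂ (by decide))
      have e₃ := eq_of_heq (hcomp₃ _ _ _ hij hjk _ hg₃ r₃ (by decide))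
      rw [e₀, e₁, e₂, e₃]
      exact H)
  refine ⟨S, ⟨f₀.symm, hpt 2 3 (by decide), hpt 1 2 (by decide), hpt 1 3 (by decide), ?_⟩,
    ⟨f₁.symm, hpt 2 3 (by decide), hpt 0 2 (by decide), hpt 0 3 (by decide), ?_⟩,
    ⟨f₂.symm, hpt 1 3 (by decide), hpt 0 1 (by decide), hpt 0 3 (by decide), ?_⟩,
    ⟨f₃.symm, hpt 1 2 (by decide), hpt 0 1 (by decide), hpt 0 2 (by decide), ?_⟩⟩
  · intro f' hf' h'
    obtain rfl := hf'.trans f₀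
    exact (hS _ _ _ (by decide) (by decide) _ _ hf' h' h₀).trans
      (hcomp₀ _ _ _ _ _ _ _ _ (by decide))
  · intro f' hf' h'
    obtain rfl := hf'.trans f₁
    exact (hS _ _ _ (by decide) (by decide) _ _ hf' h' h₁).trans
      (hcomp₁ _ _ _ _ _ _ _ _ (by decide))
  · intro f' hf' h'
    obtain rfl := hf'.trans f₂
    exact (hS _ _ _ (by decide) (by decide) _ _ hf' h' h₂).trans
      (hcomp₂ _ _ _ _ _ _ _ _ (by decide))
  · intro f' hf' h'
    obtain rfl := hf'.trans f₃
    exact (hS _ _ _ (by decide) (by decide) _ _ hf' h' h₃).trans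
      (hcomp₃ _ _ _ _ _ _ _ _ (by decide))

/-- Two simplices with the same faces of dimensions 0, 1 and 2 are equal. -/
lemma ext_of_hasFace {T : TotalSimplex P n} (hbase : S.base = T.base)
    (hpt : ∀ i j (h : i < j), S.pt h.le = T.pt h.le)
    (hface : ∀ i j k (h : i < j) (h' : j < k), ∃ (B A C : X _⦋1⦌) (f : X _⦋2⦌) (t : IsTri f B A C)
      (b : P.cat B) (p : P.cat A) (c : P.cat C) (α : (P.mul f t).obj (b, p) ⟶ c),
      S.HasFace h.le h'.le t α ∧ T.HasFace h.le h'.le t α) : S = T := by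
  refine ext_of_lt hbase hpt fun i j k h h' f hf hf' t t' => ?_
  obtain ⟨B, A, C, g, t, b, p, c, α, hα, hα'⟩ := hface i j k h h'
  exact (hα.comp _ _ _).trans (hα'.comp _ _ _).symm

end TotalSimplex
end Faces

/-! ### Maps between Grothendieck constructions over the base -/

section FullyFaithful

variable {X : SSet.{w}} {P Q : CatOperad.{w, v, u} X}

lemma TotalSimplex.HasFace.map {n : ℕ} {S : TotalSimplex P n} (F : CatOperad.Hom P Q)
    {i j k : Fin (n + 1)} {hij : i ≤ j} {hjk : j ≤ k} {B A C : X _⦋1⦌} {f : X _⦋2⦌}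
    {h : IsTri f B A C} {b : P.cat B} {p : P.cat A} {c : P.cat C}
    {α : (P.mul f h).obj (b, p) ⟶ c} (H : S.HasFace hij hjk h α) :
    (S.map F).HasFace hij hjk h ((F.lax f h).app (b, p) ≫ (F.app C).map α) := by
  obtain ⟨rfl, e⟩ := Sigma.mk.inj_iff.1 H.pt_ij.symm
  obtain rfl := eq_of_heq e
  obtain ⟨rfl, e⟩ := Sigma.mk.inj_iff.1 H.pt_jk.symm
  obtain rfl := eq_of_heq e
  obtain ⟨rfl, e⟩ := Sigma.mk.inj_iff.1 H.pt_ik.symm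
  obtain rfl := eq_of_heq e
  have b₀ := H.base
  obtain rfl := eq_of_heq (H.comp _ b₀ h)
  exact (S.map F).hasFace_comp hij hjk f b₀ h

lemma TotalSimplex.HasFace.refl_left {n : ℕ} {S : TotalSimplex P n} {i k : Fin (n + 1)}
    {hik : i ≤ k} {B A C : X _⦋1⦌} {f : X _⦋2⦌}
    {h : IsTri f B A C} {b : P.cat B} {p : P.cat A} {c : P.cat C}
    {α : (P.mul f h).obj (b, p) ⟶ c} (H : S.HasFace (le_refl i) hik h α) :
    ∃ e, α = eqToHom e := by
  obtain ⟨rfl, e⟩ := Sigma.mk.inj_iff.1 H.pt_ij.symm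
  obtain rfl := eq_of_heq e
  obtain ⟨rfl, e⟩ := Sigma.mk.inj_iff.1 H.pt_jk.symm
  obtain rfl := eq_of_heq e
  obtain ⟨rfl, e⟩ := Sigma.mk.inj_iff.1 H.pt_ik.symm
  obtain rfl := eq_of_heq e
  have b₀ := H.base
  obtain rfl := eq_of_heq (H.comp _ b₀ h)
  exact S.comp_refl_left _ _ _ _

lemma TotalSimplex.HasFace.refl_right {n : ℕ} {S : TotalSimplex P n} {i k : Fin (n + 1)}
    {hik : i ≤ k} {B A C : X _⦋1⦌} {f : X _⦋2⦌}
    {h : IsTri f B A C} {b : P.cat B} {p : P.cat A} {c : P.cat C}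
    {α : (P.mul f h).obj (b, p) ⟶ c} (H : S.HasFace hik (le_refl k) h α) :
    ∃ e, α = eqToHom e := by
  obtain ⟨rfl, e⟩ := Sigma.mk.inj_iff.1 H.pt_ij.symm
  obtain rfl := eq_of_heq e
  obtain ⟨rfl, e⟩ := Sigma.mk.inj_iff.1 H.pt_jk.symm
  obtain rfl := eq_of_heq e
  obtain ⟨rfl, e⟩ := Sigma.mk.inj_iff.1 H.pt_ik.symm
  obtain rfl := eq_of_heq e
  have b₀ := H.base
  obtain rfl := eq_of_heq (H.comp _ b₀ h)
  exact S.comp_refl_right _ _ _ _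

/-- A map of simplicial sets between Grothendieck constructions which commutes with the
projections to the base. -/
structure TotalMap (P Q : CatOperad.{w, v, u} X) where
  toFun : ∀ {n : ℕ}, TotalSimplex P n → TotalSimplex Q n
  base : ∀ {n : ℕ} (S : TotalSimplex P n), (toFun S).base = S.base
  precomp : ∀ {n m : ℕ} (S : TotalSimplex P n) (φ : ⦋m⦌ ⟶ ⦋n⦌),
    toFun (S.precomp φ) = (toFun S).precomp φ

namespace TotalMap

variable (g : TotalMap P Q)

/-- A map of Grothendieck constructions acts on edges through the objects of the fibres,
uniformly in all simplices which have the given edge: the edge is the restriction of the simplex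
along a map from `⦋1⦌`. -/
lemma exists_obj {A : X _⦋1⦌} (a : P.cat A) : ∃ b : Q.cat A, ∀ {n : ℕ} (S : TotalSimplex P n)
    {i j : Fin (n + 1)} (h : i ≤ j), S.pt h = ⟨A, a⟩ → (g.toFun S).pt h = ⟨A, b⟩ := by
  obtain ⟨E, rfl, hE⟩ := TotalSimplex.exists_edge a
  have h := (g.toFun E).pt_fst (show 0 ≤ 1 by decide)
  rw [g.base, TotalSimplex.edge_self] at h
  obtain ⟨b, hb⟩ : ∃ b : Q.cat E.base, (g.toFun E).pt (show 0 ≤ 1 by decide) = ⟨E.base, b⟩ := by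
    generalize (g.toFun E).pt (show 0 ≤ 1 by decide) = z at h
    obtain ⟨z₁, z₂⟩ := z
    cases h
    exact ⟨z₂, rfl⟩
  refine ⟨b, fun {n} S {i j} h hS => ?_⟩
  have e : S.precomp (SimplexCategory.mkOfLe i j h) = E := by
    refine TotalSimplex.ext_of_lt ?_ (fun k l hkl => ?_)
      (fun i j k h h' => absurd (h.trans h') (by omega))
    · exact (S.pt_fst h).symm.trans (congrArg Sigma.fst hS)
    · obtain ⟨rfl, rfl⟩ : k = 0 ∧ l = 1 := by
        clear * - hkl; revert k l; decide
      exact hS.trans hE.symm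
  have := g.precomp S (SimplexCategory.mkOfLe i j h)
  rw [e] at this
  rw [this] at hb
  exact hb

/-- The action of a map of Grothendieck constructions on the objects of the fibres. -/
noncomputable def obj {A : X _⦋1⦌} (a : P.cat A) : Q.cat A := (g.exists_obj a).choose

lemma pt_eq {n : ℕ} (S : TotalSimplex P n) {i j : Fin (n + 1)} (h : i ≤ j) {A : X _⦋1⦌}
    {a : P.cat A} (hS : S.pt h = ⟨A, a⟩) : (g.toFun S).pt h = ⟨A, g.obj a⟩ :=
  (g.exists_obj a).choose_spec S h hS

/-- A map of Grothendieck constructions acts on 2-dimensional faces through their 2-cells,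
uniformly in all simplices which have the given face. -/
lemma exists_tri {B A C : X _⦋1⦌} {f : X _⦋2⦌}
    (h : IsTri f B A C) {b : P.cat B} {p : P.cat A} {c : P.cat C}
    (α : (P.mul f h).obj (b, p) ⟶ c) :
    ∃ β : (Q.mul f h).obj (g.obj b, g.obj p) ⟶ g.obj c,
      ∀ {n : ℕ} (S : TotalSimplex P n) {i j k : Fin (n + 1)} (hij : i ≤ j) (hjk : j ≤ k),
        S.HasFace hij hjk h α → (g.toFun S).HasFace hij hjk h β := by
  obtain ⟨T, hT, H⟩ := TotalSimplex.exists_triangle h α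
  obtain ⟨β, hβ⟩ := TotalSimplex.exists_hasFace (S := g.toFun T) h
    (by rw [g.base]; exact H.base) (g.pt_eq T _ H.pt_jk) (g.pt_eq T _ H.pt_ij)
    (g.pt_eq T _ H.pt_ik)
  refine ⟨β, fun {n} S {i j k} hij hjk hS => ?_⟩
  have e : S.precomp (SimplexCategory.mkOfLeComp i j k hij hjk) = T := by
    have hS' : (S.precomp (SimplexCategory.mkOfLeComp i j k hij hjk)).HasFace
        (show (0 : Fin 3) ≤ 1 by decide) (show (1 : Fin 3) ≤ 2 by decide) h α :=
      (TotalSimplex.hasFace_precomp_iff (SimplexCategory.mkOfLeComp i j k hij hjk)).2 hS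
    refine TotalSimplex.ext_of_hasFace ?_ (fun k l hkl => ?_) (fun k l m h₁ h₂ => ?_)
    · exact hS.base.symm.trans hT.symm
    · obtain ⟨rfl, rfl⟩ | ⟨rfl, rfl⟩ | ⟨rfl, rfl⟩ :
          k = 0 ∧ l = 1 ∨ k = 1 ∧ l = 2 ∨ k = 0 ∧ l = 2 := by
        clear * - hkl; revert k l; decide
      · exact hS'.pt_ij.trans H.pt_ij.symm
      · exact hS'.pt_jk.trans H.pt_jk.symm
      · exact hS'.pt_ik.trans H.pt_ik.symm
    · obtain ⟨rfl, rfl, rfl⟩ : k = 0 ∧ l = 1 ∧ m = 2 := by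
        clear * - h₁ h₂; revert k l m; decide
      exact ⟨_, _, _, _, _, _, _, _, _, hS', H⟩
  have := g.precomp S (SimplexCategory.mkOfLeComp i j k hij hjk)
  rw [e] at this
  rw [this] at hβ
  exact (TotalSimplex.hasFace_precomp_iff (SimplexCategory.mkOfLeComp i j k hij hjk)).1 hβ

/-- The action of a map of Grothendieck constructions on the 2-cells of 2-simplices. -/
noncomputable def tri {B A C : X _⦋1⦌} {f : X _⦋2⦌}
    (h : IsTri f B A C) {b : P.cat B} {p : P.cat A} {c : P.cat C}
    (α : (P.mul f h).obj (b, p) ⟶ c) : (Q.mul f h).obj (g.obj b, g.obj p) ⟶ g.obj c :=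
  (g.exists_tri h α).choose

variable {g} in
lemma _root_.OperadicGrothendieck.TotalSimplex.HasFace.tri {n : ℕ} {S : TotalSimplex P n}
    {i j k : Fin (n + 1)} {hij : i ≤ j} {hjk : j ≤ k} {B A C : X _⦋1⦌} {f : X _⦋2⦌}
    {h : IsTri f B A C} {b : P.cat B} {p : P.cat A} {c : P.cat C}
    {α : (P.mul f h).obj (b, p) ⟶ c} (H : S.HasFace hij hjk h α) :
    (g.toFun S).HasFace hij hjk h (g.tri h α) :=
  (g.exists_tri h α).choose_spec S hij hjk H

/-- A map of Grothendieck constructions preserves the cocycle condition, as it preserves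
3-simplices. -/
lemma tri_cocycle (s : X _⦋3⦌) {f₀ f₁ f₂ f₃ : X _⦋2⦌} (e₀ : f₀ = X.δ 0 s) (e₁ : f₁ = X.δ 1 s)
    (e₂ : f₂ = X.δ 2 s) (e₃ : f₃ = X.δ 3 s)
    {A₀₁ A₁₂ A₂₃ A₀₂ A₁₃ A₀₃ : X _⦋1⦌}
    {h₀ : IsTri f₀ A₂₃ A₁₂ A₁₃} {h₁ : IsTri f₁ A₂₃ A₀₂ A₀₃}
    {h₂ : IsTri f₂ A₁₃ A₀₁ A₀₃} {h₃ : IsTri f₃ A₁₂ A₀₁ A₀₂}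
    {a₀₁ : P.cat A₀₁} {a₁₂ : P.cat A₁₂} {a₂₃ : P.cat A₂₃} {a₀₂ : P.cat A₀₂} {a₁₃ : P.cat A₁₃}
    {a₀₃ : P.cat A₀₃} {α₀ : (P.mul _ h₀).obj (a₂₃, a₁₂) ⟶ a₁₃}
    {α₁ : (P.mul _ h₁).obj (a₂₃, a₀₂) ⟶ a₀₃} {α₂ : (P.mul _ h₂).obj (a₁₃, a₀₁) ⟶ a₀₃}
    {α₃ : (P.mul _ h₃).obj (a₁₂, a₀₁) ⟶ a₀₂} (H : P.Cocycle h₀ h₁ h₂ h₃ α₀ α₁ α₂ α₃) :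
    Q.Cocycle h₀ h₁ h₂ h₃ (g.tri h₀ α₀) (g.tri h₁ α₁) (g.tri h₂ α₂) (g.tri h₃ α₃) := by
  subst e₀ e₁ e₂ e₃
  obtain ⟨S, H₀, H₁, H₂, H₃⟩ := TotalSimplex.exists_tetrahedron s H
  exact H₀.tri.cocycle H₁.tri H₂.tri H₃.tri

lemma obj_unit (c : X _⦋0⦌) : g.obj (P.unit c) = Q.unit c := by
  obtain ⟨E, hb, hE⟩ := TotalSimplex.exists_edge (P.unit c)
  have h := E.pt_refl 0
  have hc : vertex E.base 0 = c := by
    rw [vertex_eq_δ₁ E.base (show 0 ≤ 1 by decide), TotalSimplex.edge_self, hb]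
    exact ConcreteCategory.congr_hom (X.δ_comp_σ_succ (i := 0)) c
  rw [hc] at h
  have h' := g.pt_eq E _ h
  rw [(g.toFun E).pt_refl 0, g.base, hc] at h'
  exact (eq_of_heq (Sigma.mk.inj_iff.1 h').2).symm

/-- A map of Grothendieck constructions preserves the 2-cells of the degenerate 2-simplices `s₀
a`. -/
lemma tri_σ₀_eqToHom {A E : X _⦋1⦌} {f : X _⦋2⦌} (h : IsTri f A E A) {a : P.cat A} {e : P.cat E}
    (c : X _⦋0⦌) (hc : c = X.δ 1 A) (hf : f = X.σ 0 A)
    (he : (⟨E, e⟩ : Σ A, P.cat A) = ⟨X.σ 0 c, P.unit c⟩) (d : (P.mul f h).obj (a, e) = a) :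
    ∃ d', g.tri h (eqToHom d) = eqToHom d' := by
  obtain ⟨S, rfl, hS⟩ := TotalSimplex.exists_edge a
  have hv : vertex S.base 0 = c := by
    rw [hc, vertex_eq_δ₁ S.base (show 0 ≤ 1 by decide), TotalSimplex.edge_self]
  obtain ⟨α, H⟩ := TotalSimplex.exists_hasFace (S := S) (hij := le_refl 0)
    (hjk := (show 0 ≤ 1 by decide)) h (by rw [hf, σ₀_edge, TotalSimplex.edge_self]) hS
    (by rw [S.pt_refl, he, hv]) hS
  obtain ⟨d₁, rfl⟩ := H.refl_left
  exact H.tri.refl_left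

/-- A map of Grothendieck constructions preserves the 2-cells of the degenerate 2-simplices `s₁
a`. -/
lemma tri_σ₁_eqToHom {A E : X _⦋1⦌} {f : X _⦋2⦌} (h : IsTri f E A A) {a : P.cat A} {e : P.cat E}
    (c : X _⦋0⦌) (hc : c = X.δ 0 A) (hf : f = X.σ 1 A)
    (he : (⟨E, e⟩ : Σ A, P.cat A) = ⟨X.σ 0 c, P.unit c⟩) (d : (P.mul f h).obj (e, a) = a) :
    ∃ d', g.tri h (eqToHom d) = eqToHom d' := by
  obtain ⟨S, rfl, hS⟩ := TotalSimplex.exists_edge a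
  have hv : vertex S.base 1 = c := by
    rw [hc, vertex_eq_δ₀ S.base (show 0 ≤ 1 by decide), TotalSimplex.edge_self]
  obtain ⟨α, H⟩ := TotalSimplex.exists_hasFace (S := S) (hij := (show 0 ≤ 1 by decide))
    (hjk := le_refl 1) h (by rw [hf, σ₁_edge, TotalSimplex.edge_self])
    (by rw [S.pt_refl, he, hv]) hS hS
  obtain ⟨d₁, rfl⟩ := H.refl_right
  exact H.tri.refl_right

/-- The 2-cell over `s₀ A` given by a morphism of the fibre over `A`. -/
def _root_.OperadicGrothendieck.CatOperad.ofHom (P : CatOperad.{w, v, u} X) {A : X _⦋1⦌}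
    {a a' : P.cat A} (x : a ⟶ a') :
    (P.mul _ (isTri_σ₀ A)).obj (a, P.unit (X.δ 1 A)) ⟶ a' :=
  eqToHom (P.mul_unit_obj a) ≫ x

/-- The action of a map of Grothendieck constructions on the morphisms of the fibres. -/
noncomputable def map {A : X _⦋1⦌} {a a' : P.cat A} (x : a ⟶ a') : g.obj a ⟶ g.obj a' :=
  eqToHom (by rw [g.obj_unit, Q.mul_unit_obj]) ≫ g.tri (isTri_σ₀ A) (P.ofHom x)

lemma tri_eqToHom_comp {A E : X _⦋1⦌} {f : X _⦋2⦌} (h : IsTri f A E A) {a a' : P.cat A}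
    {e : P.cat E} (c : X _⦋0⦌) (hc : c = X.δ 1 A) (hf : f = X.σ 0 A)
    (he : (⟨E, e⟩ : Σ A, P.cat A) = ⟨X.σ 0 c, P.unit c⟩) (d : (P.mul f h).obj (a, e) = a)
    (x : a ⟶ a') : ∃ d', g.tri h (eqToHom d ≫ x) = eqToHom d' ≫ g.map x := by
  subst hc hf
  cases he
  refine ⟨by rw [g.obj_unit, Q.mul_unit_obj], ?_⟩
  simp [map, CatOperad.ofHom]

lemma map_id {A : X _⦋1⦌} (a : P.cat A) : g.map (𝟙 a) = 𝟙 (g.obj a) := by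
  have e : P.ofHom (𝟙 a) = eqToHom (P.mul_unit_obj a) := Category.comp_id _
  obtain ⟨d, hd⟩ := g.tri_σ₀_eqToHom (isTri_σ₀ A) _ rfl rfl rfl (P.mul_unit_obj a)
  rw [map, e, hd, eqToHom_trans, eqToHom_refl]

end TotalMap

lemma CatOperad.mul_map_right_unit {A E : X _⦋1⦌} {f : X _⦋2⦌} (h : IsTri f A E A)
    {a a' : P.cat A} {e : P.cat E} (c : X _⦋0⦌) (hc : c = X.δ 1 A) (hf : f = X.σ 0 A)
    (he : (⟨E, e⟩ : Σ A, P.cat A) = ⟨X.σ 0 c, P.unit c⟩) (x : a ⟶ a') :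
    ∃ d d', (P.mul f h).map (Prod.mkHom x (𝟙 e)) = eqToHom d ≫ x ≫ eqToHom d' := by
  subst hc hf
  cases he
  exact ⟨_, _, P.mul_unit_map x⟩

lemma CatOperad.map_mkHom_comp_right {B A C : X _⦋1⦌} {f : X _⦋2⦌} (h : IsTri f B A C)
    (b : P.cat B) {p p' p'' : P.cat A} (x : p ⟶ p') (y : p' ⟶ p'') :
    (P.mul f h).map (Prod.mkHom (𝟙 b) (x ≫ y)) =
      (P.mul f h).map (Prod.mkHom (𝟙 b) x) ≫ (P.mul f h).map (Prod.mkHom (𝟙 b) y) := by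
  rw [← Functor.map_comp]
  congr 1
  exact Prod.ext (Category.comp_id _).symm rfl

lemma CatOperad.map_mkHom_comp_left {B A C : X _⦋1⦌} {f : X _⦋2⦌} (h : IsTri f B A C)
    {b b' b'' : P.cat B} (p : P.cat A) (x : b ⟶ b') (y : b' ⟶ b'') :
    (P.mul f h).map (Prod.mkHom (x ≫ y) (𝟙 p)) =
      (P.mul f h).map (Prod.mkHom x (𝟙 p)) ≫ (P.mul f h).map (Prod.mkHom y (𝟙 p)) := by
  rw [← Functor.map_comp]
  congr 1
  exact Prod.ext rfl (Category.comp_id _).symm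

/-- The cocycle condition over `s₀ f`: it compares the action of morphisms of the fibres by
postcomposition and through the product in the second variable. -/
lemma CatOperad.cocycle_σ₀_iff {f f₂ f₃ : X _⦋2⦌} {A B C E : X _⦋1⦌}
    (h : IsTri f B A C) (h₂ : IsTri f₂ C E C) (h₃ : IsTri f₃ A E A)
    {e : P.cat E} {p p' : P.cat A} {b : P.cat B} {c c' : P.cat C} (v : X _⦋0⦌) (hv : v = X.δ 1 C)
    (hf₂ : f₂ = X.σ 0 C) (he : (⟨E, e⟩ : Σ A, P.cat A) = ⟨X.σ 0 v, P.unit v⟩)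
    (α : (P.mul f h).obj (b, p') ⟶ c') (β : (P.mul f h).obj (b, p) ⟶ c)
    (d₂ : (P.mul f₂ h₂).obj (c', e) = c') (d₃ : (P.mul f₃ h₃).obj (p', e) = p')
    (z : c' ⟶ c) (x : p' ⟶ p) :
    P.Cocycle h h h₂ h₃ α β (eqToHom d₂ ≫ z) (eqToHom d₃ ≫ x) ↔
      α ≫ z = (P.mul f h).map (Prod.mkHom (𝟙 b) x) ≫ β := by
  obtain ⟨d, d', hα⟩ := P.mul_map_right_unit h₂ v hv hf₂ he α
  have hx := P.map_mkHom_comp_right h b (eqToHom d₃) x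
  rw [map_eqToHom_right] at hx
  rw [CatOperad.Cocycle, hα, hx]
  constructor
  · rintro ⟨k, H⟩
    simpa [← cancel_epi (eqToHom d)] using H
  · intro H
    refine ⟨d.trans (congrArg (fun z => (P.mul f h).obj (b, z)) d₃.symm), ?_⟩
    simp [H]

/-- The cocycle condition over `s₁ f`: it describes the action of morphisms of the fibres through
the product in the first variable. -/
lemma CatOperad.cocycle_σ₁_iff {f f₀ f₃ : X _⦋2⦌} {A B C E : X _⦋1⦌}
    (h : IsTri f B A C) (h₀ : IsTri f₀ B E B) (h₃ : IsTri f₃ E A A)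
    {e : P.cat E} {p : P.cat A} {b b' : P.cat B} {c : P.cat C}
    (α₁ : (P.mul f h).obj (b, p) ⟶ c) (α₂ : (P.mul f h).obj (b', p) ⟶ c)
    (d₀ : (P.mul f₀ h₀).obj (b, e) = b) (d₃ : (P.mul f₃ h₃).obj (e, p) = p)
    (y : b ⟶ b') :
    P.Cocycle h₀ h h h₃ (eqToHom d₀ ≫ y) α₁ α₂ (eqToHom d₃) ↔
      (P.mul f h).map (Prod.mkHom y (𝟙 p)) ≫ α₂ = α₁ := by
  have hy := P.map_mkHom_comp_left h p (eqToHom d₀) y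
  rw [map_eqToHom_left] at hy
  rw [CatOperad.Cocycle, hy, map_eqToHom_right]
  constructor
  · rintro ⟨k, H⟩
    rw [eqToHom_trans_assoc, Category.assoc] at H
    exact (cancel_epi _).1 H
  · rintro rfl
    refine ⟨(congrArg (fun z => (P.mul f h).obj (z, p)) d₀).trans
      (congrArg (fun z => (P.mul f h).obj (b, z)) d₃.symm), ?_⟩
    simp

namespace TotalMap

variable (g : TotalMap P Q)

/-- The relation between the values of a map of Grothendieck constructions on the faces of a
3-simplex over `s₀ f`. Functoriality on the fibres, naturality in the second variable and the
reduction to 2-simplices with identity 2-cells are all special cases. -/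
lemma tri_comp_map {f : X _⦋2⦌} {A B C : X _⦋1⦌} (h : IsTri f B A C) {p p' : P.cat A}
    {b : P.cat B} {c c' : P.cat C} {α : (P.mul f h).obj (b, p') ⟶ c'}
    {β : (P.mul f h).obj (b, p) ⟶ c} {z : c' ⟶ c} {x : p' ⟶ p}
    (H : α ≫ z = (P.mul f h).map (Prod.mkHom (𝟙 b) x) ≫ β) :
    g.tri h α ≫ g.map z =
      (Q.mul f h).map (Prod.mkHom (𝟙 (g.obj b)) (g.map x)) ≫ g.tri h β := by
  have hE : X.δ 1 C = X.δ 1 A := by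
    rw [← h.d1, ← h.d2]
    exact ConcreteCategory.congr_hom (X.δ_comp_δ_self (n := 0) (i := 1)) f
  have e₀ : f = X.δ 0 (X.σ 0 f) := Eq.symm (b := f)
    (ConcreteCategory.congr_hom (X.δ_comp_σ_self (n := 2) (i := 0)) f)
  have e₁ : f = X.δ 1 (X.σ 0 f) := Eq.symm (b := f)
    (ConcreteCategory.congr_hom (X.δ_comp_σ_succ (n := 2) (i := 0)) f)
  have e₂ : X.σ 0 C = X.δ 2 (X.σ 0 f) := by
    rw [← h.d1]
    exact (ConcreteCategory.congr_hom
      (X.δ_comp_σ_of_gt (i := 1) (j := 0) (by decide)) f).symm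
  have e₃ : X.σ 0 A = X.δ 3 (X.σ 0 f) := by
    rw [← h.d2]
    exact (ConcreteCategory.congr_hom
      (X.δ_comp_σ_of_gt (i := 2) (j := 0) (by decide)) f).symm
  have he : (⟨X.σ 0 (X.δ 1 A), P.unit _⟩ : Σ A, P.cat A) = ⟨X.σ 0 (X.δ 1 C), P.unit _⟩ := by
    rw [hE]
  have he' : (⟨X.σ 0 (X.δ 1 A), g.obj (P.unit _)⟩ : Σ A, Q.cat A) =
      ⟨X.σ 0 (X.δ 1 C), Q.unit _⟩ := by
    rw [hE, g.obj_unit]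
  have h₂ : IsTri (X.σ 0 C) C (X.σ 0 (X.δ 1 A)) C := hE ▸ isTri_σ₀ C
  have d₂ : (P.mul _ h₂).obj (c', P.unit _) = c' := P.mul_obj_right_unit _ h₂ _ _ _ rfl rfl he
  have key := g.tri_cocycle (X.σ 0 f) e₀ e₁ e₂ e₃ ((P.cocycle_σ₀_iff h h₂ (isTri_σ₀ A) _ rfl rfl he
    α β d₂ (P.mul_unit_obj p') z x).2 H)
  obtain ⟨k, hk⟩ := g.tri_eqToHom_comp h₂ _ rfl rfl he d₂ z
  obtain ⟨k', hk'⟩ := g.tri_eqToHom_comp (isTri_σ₀ A) _ rfl rfl rfl (P.mul_unit_obj p') x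
  rw [hk, hk'] at key
  exact (Q.cocycle_σ₀_iff h h₂ (isTri_σ₀ A) _ rfl rfl he' _ _ k k' _ _).1 key

lemma map_comp {A : X _⦋1⦌} {a a' a'' : P.cat A} (x : a ⟶ a') (y : a' ⟶ a'') :
    g.map (x ≫ y) = g.map x ≫ g.map y := by
  have H := g.tri_comp_map (isTri_σ₀ A) (b := a) (x := 𝟙 (P.unit _)) (α := P.ofHom x) (z := y)
    (β := P.ofHom (x ≫ y)) (by
      rw [show Prod.mkHom (𝟙 a) (𝟙 (P.unit (X.δ 1 A))) = 𝟙 (a, P.unit (X.δ 1 A)) from rfl,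
        CategoryTheory.Functor.map_id, Category.id_comp, CatOperad.ofHom, CatOperad.ofHom,
        Category.assoc])
  rw [g.map_id, show Prod.mkHom (𝟙 (g.obj a)) (𝟙 (g.obj (P.unit (X.δ 1 A)))) = 𝟙 (_, _) from rfl,
    CategoryTheory.Functor.map_id, Category.id_comp] at H
  rw [map, map, ← H, Category.assoc]

/-- The action of a map of Grothendieck constructions on the fibres. -/
noncomputable def functor (A : X _⦋1⦌) : P.cat A ⥤ Q.cat A where
  obj := g.obj
  map := g.map
  map_id := g.map_id
  map_comp := g.map_comp

lemma map_eqToHom {A : X _⦋1⦌} {a a' : P.cat A} (e : a = a') :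
    g.map (eqToHom e) = eqToHom (congrArg g.obj e) := by
  subst e
  exact g.map_id _

/-- A map of Grothendieck constructions is determined on 2-simplices by its values on the
2-simplices whose 2-cell is an identity. -/
lemma tri_eq {f : X _⦋2⦌} {A B C : X _⦋1⦌} (h : IsTri f B A C) {p : P.cat A}
    {b : P.cat B} {c : P.cat C} (α : (P.mul f h).obj (b, p) ⟶ c) :
    g.tri h α = g.tri h (𝟙 ((P.mul f h).obj (b, p))) ≫ g.map α := by
  have H := g.tri_comp_map h (α := 𝟙 ((P.mul f h).obj (b, p))) (z := α) (β := α) (x := 𝟙 p) (by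
    rw [show Prod.mkHom (𝟙 b) (𝟙 p) = 𝟙 (b, p) from rfl, CategoryTheory.Functor.map_id])
  rw [H, g.map_id, show Prod.mkHom (𝟙 (g.obj b)) (𝟙 (g.obj p)) = 𝟙 (_, _) from rfl,
    CategoryTheory.Functor.map_id, Category.id_comp]

lemma tri_natural_right {f : X _⦋2⦌} {A B C : X _⦋1⦌} (h : IsTri f B A C) {p p' : P.cat A}
    (b : P.cat B) (x : p' ⟶ p) :
    (Q.mul f h).map (Prod.mkHom (𝟙 (g.obj b)) (g.map x)) ≫ g.tri h (𝟙 _) =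
      g.tri h (𝟙 _) ≫ g.map ((P.mul f h).map (Prod.mkHom (𝟙 b) x)) :=
  (g.tri_comp_map h (by rw [Category.id_comp, Category.comp_id])).symm

/-- Naturality in the first variable comes from a 3-simplex over `s₁ f`. -/
lemma tri_natural_left {f : X _⦋2⦌} {A B C : X _⦋1⦌} (h : IsTri f B A C) (p : P.cat A)
    {b b' : P.cat B} (y : b ⟶ b') :
    (Q.mul f h).map (Prod.mkHom (g.map y) (𝟙 (g.obj p))) ≫ g.tri h (𝟙 _) =
      g.tri h (𝟙 _) ≫ g.map ((P.mul f h).map (Prod.mkHom y (𝟙 p))) := by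
  have hE : X.δ 0 A = X.δ 1 B := by
    rw [← h.d0, ← h.d2]
    exact ConcreteCategory.congr_hom (X.δ_comp_δ (i := 0) (j := 1) (by decide)) f
  have e₀ : X.σ 0 B = X.δ 0 (X.σ 1 f) := by
    rw [← h.d0]
    exact (ConcreteCategory.congr_hom
      (X.δ_comp_σ_of_le (i := 0) (j := 0) (by decide)) f).symm
  have e₁ : f = X.δ 1 (X.σ 1 f) := Eq.symm (b := f)
    (ConcreteCategory.congr_hom (X.δ_comp_σ_self (n := 2) (i := 1)) f)
  have e₂ : f = X.δ 2 (X.σ 1 f) := Eq.symm (b := f)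
    (ConcreteCategory.congr_hom (X.δ_comp_σ_succ (n := 2) (i := 1)) f)
  have e₃ : X.σ 1 A = X.δ 3 (X.σ 1 f) := by
    rw [← h.d2]
    exact (ConcreteCategory.congr_hom
      (X.δ_comp_σ_of_gt (i := 2) (j := 1) (by decide)) f).symm
  have he : (⟨X.σ 0 (X.δ 1 B), P.unit _⟩ : Σ A, P.cat A) = ⟨X.σ 0 (X.δ 0 A), P.unit _⟩ := by
    rw [hE]
  have h₃ : IsTri (X.σ 1 A) (X.σ 0 (X.δ 1 B)) A A := hE ▸ isTri_σ₁ A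
  have d₃ : (P.mul _ h₃).obj (P.unit _, p) = p := P.mul_obj_left_unit _ h₃ _ _ _ rfl rfl he
  have key := g.tri_cocycle (X.σ 1 f) e₀ e₁ e₂ e₃ ((P.cocycle_σ₁_iff h (isTri_σ₀ B) h₃
    ((P.mul f h).map (Prod.mkHom y (𝟙 p))) (𝟙 ((P.mul f h).obj (b', p))) (P.mul_unit_obj b) d₃
    y).2 (Category.comp_id _))
  obtain ⟨k, hk⟩ := g.tri_eqToHom_comp (isTri_σ₀ B) _ rfl rfl rfl (P.mul_unit_obj b) y
  obtain ⟨k', hk'⟩ := g.tri_σ₁_eqToHom h₃ _ rfl rfl he d₃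
  rw [hk, hk'] at key
  exact ((Q.cocycle_σ₁_iff h (isTri_σ₀ B) h₃ _ _ k k' _).1 key).trans (g.tri_eq h _)

lemma tri_natural {f : X _⦋2⦌} {A B C : X _⦋1⦌} (h : IsTri f B A C) {p p' : P.cat A}
    {b b' : P.cat B} (y : b ⟶ b') (x : p ⟶ p') :
    (Q.mul f h).map (Prod.mkHom (g.map y) (g.map x)) ≫ g.tri h (𝟙 _) =
      g.tri h (𝟙 _) ≫ g.map ((P.mul f h).map (Prod.mkHom y x)) := by
  have e : Prod.mkHom y x = Prod.mkHom y (𝟙 p) ≫ Prod.mkHom (𝟙 b') x :=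
    Prod.ext (Category.comp_id _).symm (Category.id_comp _).symm
  have e' : Prod.mkHom (g.map y) (g.map x) =
      Prod.mkHom (g.map y) (𝟙 (g.obj p)) ≫ Prod.mkHom (𝟙 (g.obj b')) (g.map x) :=
    Prod.ext (Category.comp_id _).symm (Category.id_comp _).symm
  rw [e, e', Functor.map_comp, Functor.map_comp, Category.assoc, tri_natural_right,
    reassoc_of% (g.tri_natural_left h p y), map_comp]

/-- The coherence of the lax structure is the cocycle condition for the 3-simplex over `s` with
three identity 2-cells. -/
lemma tri_assoc (s : X _⦋3⦌) {A₀₁ A₁₂ A₂₃ A₀₂ A₁₃ A₀₃ : X _⦋1⦌}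
    (h₀ : IsTri (X.δ 0 s) A₂₃ A₁₂ A₁₃) (h₁ : IsTri (X.δ 1 s) A₂₃ A₀₂ A₀₃)
    (h₂ : IsTri (X.δ 2 s) A₁₃ A₀₁ A₀₃) (h₃ : IsTri (X.δ 3 s) A₁₂ A₀₁ A₀₂)
    (a : P.cat A₂₃) (b : P.cat A₁₂) (c : P.cat A₀₁) : ∃ e e',
    (Q.mul _ h₂).map (Prod.mkHom (g.tri h₀ (𝟙 ((P.mul _ h₀).obj (a, b)))) (𝟙 (g.obj c))) ≫
        g.tri h₂ (𝟙 ((P.mul _ h₂).obj ((P.mul _ h₀).obj (a, b), c))) ≫ eqToHom e =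
      eqToHom e' ≫
        (Q.mul _ h₁).map (Prod.mkHom (𝟙 (g.obj a)) (g.tri h₃ (𝟙 ((P.mul _ h₃).obj (b, c))))) ≫
          g.tri h₁ (𝟙 ((P.mul _ h₁).obj (a, (P.mul _ h₃).obj (b, c)))) := by
  have e : (P.mul _ h₁).obj (a, (P.mul _ h₃).obj (b, c)) =
      (P.mul _ h₂).obj ((P.mul _ h₀).obj (a, b), c) :=
    (Functor.congr_obj (P.assoc s h₀ h₁ h₂ h₃) ((a, b), c)).symm
  have H : P.Cocycle h₀ h₁ h₂ h₃ (𝟙 ((P.mul _ h₀).obj (a, b))) (eqToHom e)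
      (𝟙 ((P.mul _ h₂).obj ((P.mul _ h₀).obj (a, b), c))) (𝟙 ((P.mul _ h₃).obj (b, c))) := by
    refine ⟨e.symm, ?_⟩
    rw [show Prod.mkHom (𝟙 a) (𝟙 ((P.mul _ h₃).obj (b, c))) = 𝟙 (_, _) from rfl,
      show Prod.mkHom (𝟙 ((P.mul _ h₀).obj (a, b))) (𝟙 c) = 𝟙 (_, _) from rfl,
      CategoryTheory.Functor.map_id, CategoryTheory.Functor.map_id, Category.id_comp,
      Category.id_comp, eqToHom_trans, eqToHom_refl]
  obtain ⟨k, hk⟩ := g.tri_cocycle s rfl rfl rfl rfl H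
  rw [g.tri_eq h₁ (eqToHom e), g.map_eqToHom] at hk
  refine ⟨congrArg g.obj e.symm, k, ?_⟩
  have hk' := congrArg (· ≫ eqToHom (congrArg g.obj e.symm)) hk
  simp only [Category.assoc, eqToHom_trans, eqToHom_refl, Category.comp_id] at hk'
  exact hk'

lemma tri_mul_unit {A : X _⦋1⦌} (a : P.cat A) : ∃ e,
    g.tri (isTri_σ₀ A) (𝟙 ((P.mul _ (isTri_σ₀ A)).obj (a, P.unit (X.δ 1 A)))) = eqToHom e := by
  obtain ⟨d, hd⟩ := g.tri_σ₀_eqToHom (isTri_σ₀ A) _ rfl rfl rfl (P.mul_unit_obj a)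
  rw [g.tri_eq, g.map_eqToHom, comp_eqToHom_iff, eqToHom_trans] at hd
  exact ⟨_, hd⟩

lemma tri_unit_mul {A : X _⦋1⦌} (a : P.cat A) : ∃ e,
    g.tri (isTri_σ₁ A) (𝟙 ((P.mul _ (isTri_σ₁ A)).obj (P.unit (X.δ 0 A), a))) = eqToHom e := by
  obtain ⟨d, hd⟩ := g.tri_σ₁_eqToHom (isTri_σ₁ A) _ rfl rfl rfl (P.unit_mul_obj a)
  rw [g.tri_eq, g.map_eqToHom, comp_eqToHom_iff, eqToHom_trans] at hd
  exact ⟨_, hd⟩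

/-- The morphism of operads which induces a given map of Grothendieck constructions. -/
noncomputable def toHom : CatOperad.Hom P Q where
  app := g.functor
  lax f h :=
    { app := fun x => g.tri h (𝟙 ((P.mul f h).obj (x.1, x.2)))
      naturality := fun _ _ k => g.tri_natural h k.1 k.2 }
  app_unit := g.obj_unit
  lax_assoc s _ _ _ _ _ _ h₀ h₁ h₂ h₃ a b c := g.tri_assoc s h₀ h₁ h₂ h₃ a b c
  lax_mul_unit a := g.tri_mul_unit a
  lax_unit_mul a := g.tri_unit_mul a

/-- A map of Grothendieck constructions is the one induced by its morphism of operads. -/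
lemma map_toHom {n : ℕ} (S : TotalSimplex P n) : S.map g.toHom = g.toFun S := by
  refine TotalSimplex.ext_of_hasFace (g.base S).symm (fun i j h => ?_) (fun i j k h h' => ?_)
  · exact (g.pt_eq S h.le rfl).symm
  · have H := S.hasFace_comp h.le h'.le _ rfl (S.isTri h.le h'.le)
    refine ⟨_, _, _, _, _, _, _, _, _, H.map g.toHom, ?_⟩
    have := H.tri (g := g)
    rw [g.tri_eq] at this
    exact this

end TotalMap

lemma CatOperad.Hom.app_obj_eq {F G : CatOperad.Hom P Q}
    (h : ∀ {n : ℕ} (S : TotalSimplex P n), S.map F = S.map G) {A : X _⦋1⦌} (a : P.cat A) :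
    (F.app A).obj a = (G.app A).obj a := by
  obtain ⟨S, -, hS⟩ := TotalSimplex.exists_edge a
  have e : (⟨A, (F.app A).obj a⟩ : Σ A, Q.cat A) = ⟨A, (G.app A).obj a⟩ := by
    have : ∀ (K : CatOperad.Hom P Q), (S.map K).pt (show 0 ≤ 1 by decide) =
        ⟨A, (K.app A).obj a⟩ := fun K => by
      change (⟨(S.pt _).1, (K.app _).obj (S.pt _).2⟩ : Σ A, Q.cat A) = _
      rw [hS]
    rw [← this F, ← this G, h]
  exact eq_of_heq (Sigma.mk.inj_iff.1 e).2

lemma CatOperad.Hom.lax_comp_heq {F G : CatOperad.Hom P Q}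
    (h : ∀ {n : ℕ} (S : TotalSimplex P n), S.map F = S.map G) {A B C : X _⦋1⦌} {f : X _⦋2⦌}
    (t : IsTri f B A C) {b : P.cat B} {p : P.cat A} {c : P.cat C}
    (α : (P.mul f t).obj (b, p) ⟶ c) :
    HEq ((F.lax f t).app (b, p) ≫ (F.app C).map α) ((G.lax f t).app (b, p) ≫ (G.app C).map α) := by
  obtain ⟨S, rfl, H⟩ := TotalSimplex.exists_triangle t α
  have hF := H.map F
  have hG := H.map G
  rw [h] at hF
  exact (hF.comp _ rfl (TotalSimplex.isTri _ _ _)).symm.trans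
    (hG.comp _ rfl (TotalSimplex.isTri _ _ _))

/-- A morphism of operads is determined by its action on the Grothendieck constructions. -/
lemma CatOperad.Hom.ext_of_map {F G : CatOperad.Hom P Q}
    (h : ∀ {n : ℕ} (S : TotalSimplex P n), S.map F = S.map G) : F = G := by
  have happ : F.app = G.app := by
    funext A
    refine Functor.hext (fun a => app_obj_eq h a) (fun a a' x => ?_)
    have H := lax_comp_heq h (isTri_σ₀ A) (P.ofHom x)
    obtain ⟨d, hd⟩ := F.lax_mul_unit a
    obtain ⟨d', hd'⟩ := G.lax_mul_unit a
    rw [hd, hd', CatOperad.ofHom, Functor.map_comp, Functor.map_comp, eqToHom_map, eqToHom_map,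
      eqToHom_trans_assoc, eqToHom_trans_assoc] at H
    exact (eqToHom_comp_heq _ _).symm.trans (H.trans (eqToHom_comp_heq _ _))
  have hlax : ∀ {B A C : X _⦋1⦌} (f : X _⦋2⦌) (t : IsTri f B A C) (x : P.cat B × P.cat A),
      HEq ((F.lax f t).app x) ((G.lax f t).app x) := by
    intro B A C f t x
    have H := lax_comp_heq h t (𝟙 ((P.mul f t).obj x))
    rw [CategoryTheory.Functor.map_id, CategoryTheory.Functor.map_id] at H
    have e := Category.comp_id ((F.lax f t).app x)
    have e' := Category.comp_id ((G.lax f t).app x)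
    exact (heq_of_eq e.symm).trans (H.trans (heq_of_eq e'))
  rcases F with ⟨F, μ, _, _, _, _⟩
  rcases G with ⟨G, ν, _, _, _, _⟩
  obtain rfl : F = G := happ
  obtain rfl : @μ = @ν := by
    funext B A C f t
    ext x
    exact eq_of_heq (hlax f t x)
  rfl

end FullyFaithful

/-- The Grothendieck construction is full over any base. -/
theorem grothendieck_full (X : SSet.{max w v u}) : (grothendieck.{w, v, u} X).Full where
  map_surjective {P Q} φ := by
    let g : TotalMap P Q :=
      { toFun := fun {n} S => φ.left.app (op ⦋n⦌) S
        base := fun {n} S => by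
          have := ConcreteCategory.congr_hom (congrArg
            (fun k : ((grothendieck.{w, v, u} X).obj P).left ⟶ X => k.app (op ⦋n⦌)) (Over.w φ)) S
          exact this
        precomp := fun {n m} S f => ConcreteCategory.congr_hom (φ.left.naturality f.op) S }
    refine ⟨g.toHom, ?_⟩
    ext n S
    exact g.map_toHom S

/-- The Grothendieck construction is faithful over any base. -/
theorem grothendieck_faithful (X : SSet.{max w v u}) : (grothendieck.{w, v, u} X).Faithful where
  map_injective {P Q F G} h := by
    refine CatOperad.Hom.ext_of_map fun {n} S => ?_
    exact ConcreteCategory.congr_hom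
      (congrArg (fun k : (grothendieck X).obj P ⟶ (grothendieck X).obj Q =>
        k.left.app (op ⦋n⦌)) h) S

/-! ### Actions of a 2-category on categories -/

section Bimap

variable {A B D : Type*} [Category* A] [Category* B] [Category* D]

/-- The action of a functor of two variables on a pair of morphisms. -/
def bimap (T : A × B ⥤ D) {a a' : A} {b b' : B} (y : a ⟶ a') (x : b ⟶ b') :
    T.obj (a, b) ⟶ T.obj (a', b') :=
  T.map (Prod.mkHom y x)

variable (T : A × B ⥤ D)

lemma bimap_comp {a a' a'' : A} {b b' b'' : B} (y : a ⟶ a') (y' : a' ⟶ a'') (x : b ⟶ b')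
    (x' : b' ⟶ b'') : bimap T (y ≫ y') (x ≫ x') = bimap T y x ≫ bimap T y' x' :=
  T.map_comp (Prod.mkHom y x) (Prod.mkHom y' x')

lemma bimap_id (a : A) (b : B) : bimap T (𝟙 a) (𝟙 b) = 𝟙 _ :=
  T.map_id _

lemma bimap_eqToHom {a a' : A} {b b' : B} (e : a = a') (e' : b = b') :
    bimap T (eqToHom e) (eqToHom e') = eqToHom (by rw [e, e']) := by
  subst e e'
  exact T.map_id _

lemma bimap_eqToHom_left {a a' : A} (e : a = a') (b : B) :
    bimap T (eqToHom e) (𝟙 b) = eqToHom (by rw [e]) :=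
  bimap_eqToHom T e rfl

lemma bimap_eqToHom_right (a : A) {b b' : B} (e : b = b') :
    bimap T (𝟙 a) (eqToHom e) = eqToHom (by rw [e]) :=
  bimap_eqToHom T rfl e

lemma bimap_eqToHom_comp_left {a a' a'' : A} {b b' : B} (e : a = a') (y : a' ⟶ a'')
    (x : b ⟶ b') : bimap T (eqToHom e ≫ y) x = eqToHom (by rw [e]) ≫ bimap T y x := by
  subst e
  simp

lemma bimap_eqToHom_comp_right {a a' : A} {b b' b'' : B} (y : a ⟶ a') (e : b = b')
    (x : b' ⟶ b'') : bimap T y (eqToHom e ≫ x) = eqToHom (by rw [e]) ≫ bimap T y x := by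
  subst e
  simp

lemma bimap_comp_left {a a' a'' : A} {b b' : B} (y : a ⟶ a') (y' : a' ⟶ a'') (x : b ⟶ b') :
    bimap T (y ≫ y') x = bimap T y x ≫ bimap T y' (𝟙 b') := by
  rw [← bimap_comp, Category.comp_id]

lemma bimap_comp_right {a a' : A} {b b' b'' : B} (y : a ⟶ a') (x : b ⟶ b') (x' : b' ⟶ b'') :
    bimap T y (x ≫ x') = bimap T y x ≫ bimap T (𝟙 a') x' := by
  rw [← bimap_comp, Category.comp_id]

end Bimap

open Bicategory

/-- The structure on the fibres of a categorical operad over a unary operadic 2-category `(X, C)`,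
in terms of `C`: categories `E A` for the objects `A` and `F f` for the 1-cells `f` of `C`, products
`F g × F f ⥤ F h` for the lax triangles `g ∘ f ⇒ h`, actions `E B × F f ⥤ E A` for the 1-cells
`f : A ⟶ B`, and units in `F (𝟙 A)`. The categories `E A` sit over the edges to the last vertex of a
simplex of `X`, the categories `F f` over the other edges. The associativity laws are indexed by the
3-simplices and 2-simplices of the nerve of `C`. -/
structure Coefficients (C : Type w) [Bicategory.{w, w} C] where
  E : C → Cat.{v, u}
  F : ∀ {A B : C}, (A ⟶ B) → Cat.{v, u}
  mul : ∀ {A B D : C} {f : A ⟶ B} {g : B ⟶ D} {h : A ⟶ D}, (f ≫ g ⟶ h) → F g × F f ⥤ F h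
  act : ∀ {A B : C} (f : A ⟶ B), E B × F f ⥤ E A
  unit : ∀ A : C, F (𝟙 A)
  mul_assoc : ∀ {a b c d : C} {f : a ⟶ b} {g : b ⟶ c} {h : c ⟶ d} {p : a ⟶ c} {q : b ⟶ d}
    {r : a ⟶ d} (σ : f ≫ g ⟶ p) (τ : p ≫ h ⟶ r) (σ' : g ≫ h ⟶ q) (τ' : f ≫ q ⟶ r),
    σ ▷ h ≫ τ = (α_ f g h).hom ≫ f ◁ σ' ≫ τ' →
      (mul σ').prod (𝟭 (F f)) ⋙ mul τ' =
        prod.associator (F h) (F g) (F f) ⋙ (𝟭 (F h)).prod (mul σ) ⋙ mul τ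
  mul_unit : ∀ {A B : C} (f : A ⟶ B),
    (𝟭 (F f)).prod' ((Functor.const _).obj (unit A)) ⋙ mul (λ_ f).hom = 𝟭 (F f)
  unit_mul : ∀ {A B : C} (f : A ⟶ B),
    ((Functor.const _).obj (unit B)).prod' (𝟭 (F f)) ⋙ mul (ρ_ f).hom = 𝟭 (F f)
  act_mul : ∀ {a b c : C} {f : a ⟶ b} {g : b ⟶ c} {h : a ⟶ c} (σ : f ≫ g ⟶ h),
    (act g).prod (𝟭 (F f)) ⋙ act f =
      prod.associator (E c) (F g) (F f) ⋙ (𝟭 (E c)).prod (mul σ) ⋙ act h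
  act_unit : ∀ A : C,
    (𝟭 (E A)).prod' ((Functor.const _).obj (unit A)) ⋙ act (𝟙 A) = 𝟭 (E A)

namespace Coefficients

variable {C : Type w} [Bicategory.{w, w} C] (K : Coefficients.{w, v, u} C)

/-- The functor between the fibres over two 1-cells induced by a 2-cell. -/
def push {A B : C} {f g : A ⟶ B} (σ : f ⟶ g) : K.F f ⥤ K.F g :=
  ((Functor.const _).obj (K.unit B)).prod' (𝟭 (K.F f)) ⋙ K.mul ((ρ_ f).hom ≫ σ)

/-- The product is natural with respect to 2-cells out of the target; as for the lemmas below,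
this is the associativity law for a tetrahedron with one degenerate edge, with the unit as the
object over that edge. -/
lemma mul_push {A B D : C} {f : A ⟶ B} {g : B ⟶ D} {h h' : A ⟶ D} (σ : f ≫ g ⟶ h) (τ : h ⟶ h') :
    K.mul σ ⋙ K.push τ = K.mul (σ ≫ τ) := by
  have key := K.mul_assoc σ ((ρ_ h).hom ≫ τ) (ρ_ g).hom (σ ≫ τ) (by simp)
  let J : K.F g × K.F f ⥤ (K.F (𝟙 D) × K.F g) × K.F f :=
    (((Functor.const _).obj (K.unit D)).prod' (𝟭 (K.F g))).prod (𝟭 (K.F f))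
  have h₁ : J ⋙ (K.mul (ρ_ g).hom).prod (𝟭 (K.F f)) = 𝟭 _ := by
    change (((Functor.const _).obj (K.unit D)).prod' (𝟭 (K.F g)) ⋙ K.mul (ρ_ g).hom).prod
      (𝟭 (K.F f)) = _
    rw [K.unit_mul]
    rfl
  calc K.mul σ ⋙ K.push τ = J ⋙ prod.associator _ _ _ ⋙
        (𝟭 (K.F (𝟙 D))).prod (K.mul σ) ⋙ K.mul ((ρ_ h).hom ≫ τ) := rfl
    _ = (J ⋙ (K.mul (ρ_ g).hom).prod (𝟭 (K.F f))) ⋙ K.mul (σ ≫ τ) := by rw [← key]; rfl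
    _ = K.mul (σ ≫ τ) := by rw [h₁]; rfl

lemma push_id {A B : C} (f : A ⟶ B) : K.push (𝟙 f) = 𝟭 (K.F f) := by
  rw [push, Category.comp_id, K.unit_mul]

lemma push_comp {A B : C} {f g h : A ⟶ B} (σ : f ⟶ g) (τ : g ⟶ h) :
    K.push (σ ≫ τ) = K.push σ ⋙ K.push τ := by
  rw [push, push, CategoryTheory.Functor.assoc, mul_push, Category.assoc]

lemma prod_push_mul {A B D : C} {f f' : A ⟶ B} {g : B ⟶ D} {h : A ⟶ D} (σ : f ⟶ f')
    (κ : f' ≫ g ⟶ h) : (𝟭 (K.F g)).prod (K.push σ) ⋙ K.mul κ = K.mul (σ ▷ g ≫ κ) := by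
  have key := K.mul_assoc ((ρ_ f).hom ≫ σ) κ (λ_ g).hom (σ ▷ g ≫ κ) (by simp)
  let J : K.F g × K.F f ⥤ (K.F g × K.F (𝟙 B)) × K.F f :=
    ((𝟭 (K.F g)).prod' ((Functor.const _).obj (K.unit B))).prod (𝟭 (K.F f))
  have h₁ : J ⋙ (K.mul (λ_ g).hom).prod (𝟭 (K.F f)) = 𝟭 _ := by
    change ((𝟭 (K.F g)).prod' ((Functor.const _).obj (K.unit B)) ⋙ K.mul (λ_ g).hom).prod
      (𝟭 (K.F f)) = _
    rw [K.mul_unit]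
    rfl
  calc (𝟭 (K.F g)).prod (K.push σ) ⋙ K.mul κ = J ⋙ prod.associator _ _ _ ⋙
        (𝟭 (K.F g)).prod (K.mul ((ρ_ f).hom ≫ σ)) ⋙ K.mul κ := rfl
    _ = (J ⋙ (K.mul (λ_ g).hom).prod (𝟭 (K.F f))) ⋙ K.mul (σ ▷ g ≫ κ) := by rw [← key]; rfl
    _ = _ := by rw [h₁]; rfl

lemma push_prod_mul {A B D : C} {f : A ⟶ B} {g g' : B ⟶ D} {h : A ⟶ D} (τ : g ⟶ g')
    (κ : f ≫ g' ⟶ h) : (K.push τ).prod (𝟭 (K.F f)) ⋙ K.mul κ = K.mul (f ◁ τ ≫ κ) := by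
  have key := K.mul_assoc (𝟙 (f ≫ g)) ((ρ_ (f ≫ g)).hom ≫ f ◁ τ ≫ κ) ((ρ_ g).hom ≫ τ) κ
    (by simp)
  let J : K.F g × K.F f ⥤ (K.F (𝟙 D) × K.F g) × K.F f :=
    (((Functor.const _).obj (K.unit D)).prod' (𝟭 (K.F g))).prod (𝟭 (K.F f))
  calc (K.push τ).prod (𝟭 (K.F f)) ⋙ K.mul κ =
      J ⋙ (K.mul ((ρ_ g).hom ≫ τ)).prod (𝟭 (K.F f)) ⋙ K.mul κ := rfl
    _ = K.mul (𝟙 (f ≫ g)) ⋙ K.push (f ◁ τ ≫ κ) := by rw [key]; rfl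
    _ = _ := by rw [mul_push, Category.id_comp]

lemma prod_push_act {A B : C} {f f' : A ⟶ B} (σ : f ⟶ f') :
    (𝟭 (K.E B)).prod (K.push σ) ⋙ K.act f' = K.act f := by
  have key := K.act_mul ((ρ_ f).hom ≫ σ)
  let J : K.E B × K.F f ⥤ (K.E B × K.F (𝟙 B)) × K.F f :=
    ((𝟭 (K.E B)).prod' ((Functor.const _).obj (K.unit B))).prod (𝟭 (K.F f))
  have h₁ : J ⋙ (K.act (𝟙 B)).prod (𝟭 (K.F f)) = 𝟭 _ := by
    change ((𝟭 (K.E B)).prod' ((Functor.const _).obj (K.unit B)) ⋙ K.act (𝟙 B)).prod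
      (𝟭 (K.F f)) = _
    rw [K.act_unit]
    rfl
  calc (𝟭 (K.E B)).prod (K.push σ) ⋙ K.act f' = J ⋙ prod.associator _ _ _ ⋙
        (𝟭 (K.E B)).prod (K.mul ((ρ_ f).hom ≫ σ)) ⋙ K.act f' := rfl
    _ = (J ⋙ (K.act (𝟙 B)).prod (𝟭 (K.F f))) ⋙ K.act f := by rw [← key]; rfl
    _ = _ := by rw [h₁]; rfl

/-- The product over the composite of two 1-cells. -/
def tensor {A B D : C} (f : A ⟶ B) (g : B ⟶ D) : K.F g × K.F f ⥤ K.F (f ≫ g) :=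
  K.mul (𝟙 (f ≫ g))

lemma tensor_push {A B D : C} {f : A ⟶ B} {g : B ⟶ D} {h : A ⟶ D} (σ : f ≫ g ⟶ h) :
    K.tensor f g ⋙ K.push σ = K.mul σ := by
  rw [tensor, mul_push, Category.id_comp]

lemma push_prod_push_tensor {A B D : C} {f f' : A ⟶ B} {g g' : B ⟶ D} (σ : f ⟶ f') (τ : g ⟶ g') :
    (K.push τ).prod (K.push σ) ⋙ K.tensor f' g' = K.tensor f g ⋙ K.push (σ ▷ g ≫ f' ◁ τ) := by
  calc (K.push τ).prod (K.push σ) ⋙ K.tensor f' g' =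
      (𝟭 (K.F g)).prod (K.push σ) ⋙ (K.push τ).prod (𝟭 (K.F f')) ⋙ K.mul (𝟙 (f' ≫ g')) := rfl
    _ = _ := by rw [push_prod_mul, prod_push_mul, tensor_push, Category.comp_id]

lemma tensor_assoc {a b c d : C} (f : a ⟶ b) (g : b ⟶ c) (h : c ⟶ d) :
    (prod.associator (K.F h) (K.F g) (K.F f) ⋙ (𝟭 (K.F h)).prod (K.tensor f g) ⋙
      K.tensor (f ≫ g) h) ⋙ K.push (α_ f g h).hom =
    (K.tensor g h).prod (𝟭 (K.F f)) ⋙ K.tensor f (g ≫ h) := by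
  have key := K.mul_assoc (𝟙 (f ≫ g)) (α_ f g h).hom (𝟙 (g ≫ h)) (𝟙 (f ≫ g ≫ h)) (by simp)
  rw [CategoryTheory.Functor.assoc, CategoryTheory.Functor.assoc, tensor_push]
  exact key.symm

lemma tensor_unit {A B : C} (f : A ⟶ B) :
    ((𝟭 (K.F f)).prod' ((Functor.const _).obj (K.unit A)) ⋙ K.tensor (𝟙 A) f) ⋙
      K.push (λ_ f).hom = 𝟭 (K.F f) := by
  rw [CategoryTheory.Functor.assoc, tensor_push, K.mul_unit]

lemma unit_tensor {A B : C} (f : A ⟶ B) :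
    (((Functor.const _).obj (K.unit B)).prod' (𝟭 (K.F f)) ⋙ K.tensor f (𝟙 B)) ⋙
      K.push (ρ_ f).hom = 𝟭 (K.F f) := by
  rw [CategoryTheory.Functor.assoc, tensor_push, K.unit_mul]

lemma act_tensor {a b c : C} (f : a ⟶ b) (g : b ⟶ c) :
    prod.associator (K.E c) (K.F g) (K.F f) ⋙ (𝟭 (K.E c)).prod (K.tensor f g) ⋙ K.act (f ≫ g) =
      (K.act g).prod (𝟭 (K.F f)) ⋙ K.act f :=
  (K.act_mul (𝟙 (f ≫ g))).symm

lemma push_id_obj {A B : C} {f : A ⟶ B} (p : K.F f) : (K.push (𝟙 f)).obj p = p :=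
  Functor.congr_obj (K.push_id f) p

lemma push_id_map {A B : C} {f : A ⟶ B} {p p' : K.F f} (x : p ⟶ p') :
    (K.push (𝟙 f)).map x = eqToHom (K.push_id_obj p) ≫ x ≫ eqToHom (K.push_id_obj p').symm :=
  Functor.congr_hom (K.push_id f) x

lemma push_comp_obj {A B : C} {f g h : A ⟶ B} (σ : f ⟶ g) (τ : g ⟶ h) (p : K.F f) :
    (K.push (σ ≫ τ)).obj p = (K.push τ).obj ((K.push σ).obj p) :=
  Functor.congr_obj (K.push_comp σ τ) p

lemma push_comp_map {A B : C} {f g h : A ⟶ B} (σ : f ⟶ g) (τ : g ⟶ h) {p p' : K.F f}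
    (x : p ⟶ p') : (K.push (σ ≫ τ)).map x = eqToHom (K.push_comp_obj σ τ p) ≫
      (K.push τ).map ((K.push σ).map x) ≫ eqToHom (K.push_comp_obj σ τ p').symm :=
  Functor.congr_hom (K.push_comp σ τ) x

lemma act_push_obj {A B : C} {f f' : A ⟶ B} (σ : f ⟶ f') (b : K.E B) (p : K.F f) :
    (K.act f').obj (b, (K.push σ).obj p) = (K.act f).obj (b, p) :=
  Functor.congr_obj (K.prod_push_act σ) (b, p)

lemma act_push_map {A B : C} {f f' : A ⟶ B} (σ : f ⟶ f') {b b' : K.E B} {p p' : K.F f}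
    (y : b ⟶ b') (x : p ⟶ p') : bimap (K.act f') y ((K.push σ).map x) =
      eqToHom (K.act_push_obj σ b p) ≫ bimap (K.act f) y x ≫
        eqToHom (K.act_push_obj σ b' p').symm :=
  Functor.congr_hom (K.prod_push_act σ) (Prod.mkHom y x)

lemma tensor_push_obj {A B D : C} {f f' : A ⟶ B} {g g' : B ⟶ D} (σ : f ⟶ f') (τ : g ⟶ g')
    (q : K.F g) (p : K.F f) :
    (K.tensor f' g').obj ((K.push τ).obj q, (K.push σ).obj p) =
      (K.push (σ ▷ g ≫ f' ◁ τ)).obj ((K.tensor f g).obj (q, p)) :=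
  Functor.congr_obj (K.push_prod_push_tensor σ τ) (q, p)

lemma tensor_push_map {A B D : C} {f f' : A ⟶ B} {g g' : B ⟶ D} (σ : f ⟶ f') (τ : g ⟶ g')
    {q q' : K.F g} {p p' : K.F f} (y : q ⟶ q') (x : p ⟶ p') :
    bimap (K.tensor f' g') ((K.push τ).map y) ((K.push σ).map x) =
      eqToHom (K.tensor_push_obj σ τ q p) ≫
        (K.push (σ ▷ g ≫ f' ◁ τ)).map (bimap (K.tensor f g) y x) ≫
          eqToHom (K.tensor_push_obj σ τ q' p').symm :=
  Functor.congr_hom (K.push_prod_push_tensor σ τ) (Prod.mkHom y x)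

lemma act_tensor_obj {a b c : C} (f : a ⟶ b) (g : b ⟶ c) (d : K.E c) (q : K.F g) (p : K.F f) :
    (K.act (f ≫ g)).obj (d, (K.tensor f g).obj (q, p)) =
      (K.act f).obj ((K.act g).obj (d, q), p) :=
  Functor.congr_obj (K.act_tensor f g) ((d, q), p)

lemma act_tensor_map {a b c : C} (f : a ⟶ b) (g : b ⟶ c) {d d' : K.E c} {q q' : K.F g}
    {p p' : K.F f} (z : d ⟶ d') (y : q ⟶ q') (x : p ⟶ p') :
    bimap (K.act (f ≫ g)) z (bimap (K.tensor f g) y x) =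
      eqToHom (K.act_tensor_obj f g d q p) ≫ bimap (K.act f) (bimap (K.act g) z y) x ≫
        eqToHom (K.act_tensor_obj f g d' q' p').symm :=
  Functor.congr_hom (K.act_tensor f g) (Prod.mkHom (Prod.mkHom z y) x)

lemma tensor_assoc_obj {a b c d : C} (f : a ⟶ b) (g : b ⟶ c) (h : c ⟶ d) (r : K.F h) (q : K.F g)
    (p : K.F f) :
    (K.push (α_ f g h).hom).obj ((K.tensor (f ≫ g) h).obj (r, (K.tensor f g).obj (q, p))) =
      (K.tensor f (g ≫ h)).obj ((K.tensor g h).obj (r, q), p) :=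
  Functor.congr_obj (K.tensor_assoc f g h) ((r, q), p)

lemma tensor_assoc_map {a b c d : C} (f : a ⟶ b) (g : b ⟶ c) (h : c ⟶ d) {r r' : K.F h}
    {q q' : K.F g} {p p' : K.F f} (z : r ⟶ r') (y : q ⟶ q') (x : p ⟶ p') :
    (K.push (α_ f g h).hom).map (bimap (K.tensor (f ≫ g) h) z (bimap (K.tensor f g) y x)) =
      eqToHom (K.tensor_assoc_obj f g h r q p) ≫
        bimap (K.tensor f (g ≫ h)) (bimap (K.tensor g h) z y) x ≫
          eqToHom (K.tensor_assoc_obj f g h r' q' p').symm :=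
  Functor.congr_hom (K.tensor_assoc f g h) (Prod.mkHom (Prod.mkHom z y) x)

lemma tensor_unit_obj {A B : C} {f : A ⟶ B} (p : K.F f) :
    (K.push (λ_ f).hom).obj ((K.tensor (𝟙 A) f).obj (p, K.unit A)) = p :=
  Functor.congr_obj (K.tensor_unit f) p

lemma tensor_unit_map {A B : C} {f : A ⟶ B} {p p' : K.F f} (x : p ⟶ p') :
    (K.push (λ_ f).hom).map (bimap (K.tensor (𝟙 A) f) x (𝟙 (K.unit A))) =
      eqToHom (K.tensor_unit_obj p) ≫ x ≫ eqToHom (K.tensor_unit_obj p').symm :=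
  Functor.congr_hom (K.tensor_unit f) x

lemma unit_tensor_obj {A B : C} {f : A ⟶ B} (p : K.F f) :
    (K.push (ρ_ f).hom).obj ((K.tensor f (𝟙 B)).obj (K.unit B, p)) = p :=
  Functor.congr_obj (K.unit_tensor f) p

lemma unit_tensor_map {A B : C} {f : A ⟶ B} {p p' : K.F f} (x : p ⟶ p') :
    (K.push (ρ_ f).hom).map (bimap (K.tensor f (𝟙 B)) (𝟙 (K.unit B)) x) =
      eqToHom (K.unit_tensor_obj p) ≫ x ≫ eqToHom (K.unit_tensor_obj p').symm :=
  Functor.congr_hom (K.unit_tensor f) x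

lemma act_unit_obj {A : C} (a : K.E A) : (K.act (𝟙 A)).obj (a, K.unit A) = a :=
  Functor.congr_obj (K.act_unit A) a

lemma act_unit_map {A : C} {a a' : K.E A} (x : a ⟶ a') :
    bimap (K.act (𝟙 A)) x (𝟙 (K.unit A)) =
      eqToHom (K.act_unit_obj a) ≫ x ≫ eqToHom (K.act_unit_obj a').symm :=
  Functor.congr_hom (K.act_unit A) x

lemma tensor_push_eq_mul {A B D : C} {f : A ⟶ B} {g : B ⟶ D} {h : A ⟶ D} (σ : f ≫ g ⟶ h)
    (q : K.F g) (p : K.F f) :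
    (K.push σ).obj ((K.tensor f g).obj (q, p)) = (K.mul σ).obj (q, p) :=
  Functor.congr_obj (K.tensor_push σ) (q, p)

end Coefficients

/-! ### The 2-category of a system of coefficients -/

section CellEquality

variable {D D' : Type*} [Category* D] [Category* D']

/-- Two functors are equal if they are related by a natural family of identity morphisms. -/
lemma functor_eq_of_natural {F G : D ⥤ D'} (θ : ∀ x, F.obj x ⟶ G.obj x)
    (hθ : ∀ x, ∃ e, θ x = eqToHom e) (nat : ∀ {x y} (f : x ⟶ y), F.map f ≫ θ y = θ x ≫ G.map f) :
    F = G := by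
  choose e he using hθ
  refine CategoryTheory.Functor.ext e fun x y f => ?_
  have := nat f
  rw [he, he, comp_eqToHom_iff, Category.assoc] at this
  exact this

end CellEquality

namespace Coefficients

variable {C : Type w} [Bicategory.{w, w} C] (K : Coefficients.{w, v, u} C)

/-- An object of the 2-category of `K`: an object `A` of `C` and an object of `E A`. -/
structure Vertex where
  base : C
  fib : K.E base

variable {K}

/-- A 1-cell `(A, a) ⟶ (B, b)` of the 2-category of `K`: a 1-cell `f : A ⟶ B`, an object `p` of
`F f`, and a morphism `b · p ⟶ a` in `E A`. -/
structure OneCell (x y : K.Vertex) where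
  base : x.base ⟶ y.base
  fib : K.F base
  str : (K.act base).obj (y.fib, fib) ⟶ x.fib

variable {x y z t : K.Vertex}

/-- A 2-cell `(f, p, α) ⟶ (g, q, β)` of the 2-category of `K`: a 2-cell `σ : f ⟶ g` and a morphism
`σ_* p ⟶ q` which is compatible with `α` and `β`. -/
structure TwoCell (s s' : OneCell x y) where
  base : s.base ⟶ s'.base
  fib : (K.push base).obj s.fib ⟶ s'.fib
  comm : bimap (K.act s'.base) (𝟙 y.fib) fib ≫ s'.str =
    eqToHom (K.act_push_obj base y.fib s.fib) ≫ s.str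

lemma TwoCell.ext_of_eq {s s' : OneCell x y} {θ θ' : TwoCell s s'} (h : θ.base = θ'.base)
    (h' : θ.fib = eqToHom (by rw [h]) ≫ θ'.fib) : θ = θ' := by
  rcases θ with ⟨σ, f, _⟩
  rcases θ' with ⟨σ', f', _⟩
  obtain rfl : σ = σ' := h
  rw [eqToHom_refl, Category.id_comp] at h'
  obtain rfl : f = f' := h'
  rfl

/-- The category of 1-cells between two objects of the 2-category of `K`, under vertical
composition of 2-cells. -/
instance OneCell.category (x y : K.Vertex) : Category (OneCell x y) where
  Hom := TwoCell
  id s := ⟨𝟙 s.base, eqToHom (K.push_id_obj _), by rw [bimap_eqToHom_right]⟩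
  comp {s s' s''} θ θ' := ⟨θ.base ≫ θ'.base,
    eqToHom (K.push_comp_obj _ _ _) ≫ (K.push θ'.base).map θ.fib ≫ θ'.fib, by
      rw [bimap_eqToHom_comp_right, bimap_comp_right, Category.assoc, Category.assoc, θ'.comm,
        K.act_push_map]
      simp [θ.comm]⟩
  id_comp {s s'} θ := TwoCell.ext_of_eq (Category.id_comp _) (by
    simp [eqToHom_map])
  comp_id {s s'} θ := TwoCell.ext_of_eq (Category.comp_id _) (by
    simp [K.push_id_map])
  assoc {s s' s'' s'''} θ θ' θ'' := TwoCell.ext_of_eq (Category.assoc _ _ _) (by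
    simp [K.push_comp_map, eqToHom_map])

@[simp]
lemma TwoCell.comp_base {s s' s'' : OneCell x y} (θ : s ⟶ s') (θ' : s' ⟶ s'') :
    (θ ≫ θ').base = θ.base ≫ θ'.base := rfl

lemma TwoCell.id_fib (s : OneCell x y) : (𝟙 s : s ⟶ s).fib = eqToHom (K.push_id_obj _) := rfl

lemma TwoCell.comm' {s s' : OneCell x y} (θ : s ⟶ s') :
    bimap (K.act s'.base) (𝟙 y.fib) θ.fib ≫ s'.str =
      eqToHom (K.act_push_obj θ.base y.fib s.fib) ≫ s.str :=
  θ.comm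

lemma TwoCell.hom_ext {s s' : OneCell x y} {θ θ' : s ⟶ s'} (h : θ.base = θ'.base)
    (h' : θ.fib = eqToHom (by rw [h]) ≫ θ'.fib) : θ = θ' :=
  TwoCell.ext_of_eq h h'

/-- A 2-cell is an identity if its components in `C` and in the fibre are identities. -/
lemma TwoCell.eq_eqToHom {s s' : OneCell x y} (θ : s ⟶ s') (h : ∃ e, θ.base = eqToHom e)
    (h' : ∃ e, θ.fib = eqToHom e) : ∃ e, θ = eqToHom e := by
  rcases s with ⟨f, p, α⟩
  rcases s' with ⟨f', p', α'⟩
  rcases θ with ⟨σ, ξ, c⟩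
  obtain ⟨e, rfl⟩ := h
  obtain rfl : f = f' := e
  obtain ⟨e', he'⟩ := h'
  have e'' : (K.push (𝟙 f)).obj p = p' := e'
  have hξ : ξ = eqToHom e'' := he'
  clear he'
  subst hξ
  obtain rfl : p = p' := (K.push_id_obj p).symm.trans e''
  have c' : bimap (K.act f) (𝟙 y.fib) (eqToHom e'') ≫ α' =
    eqToHom (K.act_push_obj (𝟙 f) y.fib p) ≫ α := c
  rw [bimap_eqToHom_right] at c'
  obtain rfl : α' = α := (cancel_epi _).1 c'
  exact ⟨rfl, rfl⟩

/-- The identity 1-cell. -/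
def OneCell.id (x : K.Vertex) : OneCell x x :=
  ⟨𝟙 x.base, K.unit x.base, eqToHom (K.act_unit_obj _)⟩

/-- The composite of two 1-cells. -/
def OneCell.comp (s : OneCell x y) (s' : OneCell y z) : OneCell x z :=
  ⟨s.base ≫ s'.base, (K.tensor s.base s'.base).obj (s'.fib, s.fib),
    eqToHom (K.act_tensor_obj _ _ _ _ _) ≫ bimap (K.act s.base) s'.str (𝟙 s.fib) ≫ s.str⟩

/-- The components of a horizontal composite satisfy the condition on 2-cells. -/
lemma hcomp_comm {A B D : C} {f f' : A ⟶ B} {g g' : B ⟶ D} {σ : f ⟶ f'} {τ : g ⟶ g'}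
    {a : K.E A} {b : K.E B} {d : K.E D} {p : K.F f} {p' : K.F f'} {q : K.F g} {q' : K.F g'}
    {α : (K.act f).obj (b, p) ⟶ a} {α' : (K.act f').obj (b, p') ⟶ a}
    {β : (K.act g).obj (d, q) ⟶ b} {β' : (K.act g').obj (d, q') ⟶ b}
    {ξ : (K.push σ).obj p ⟶ p'} {ζ : (K.push τ).obj q ⟶ q'}
    (h : bimap (K.act f') (𝟙 b) ξ ≫ α' = eqToHom (K.act_push_obj σ b p) ≫ α)
    (h' : bimap (K.act g') (𝟙 d) ζ ≫ β' = eqToHom (K.act_push_obj τ d q) ≫ β) :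
    bimap (K.act (f' ≫ g')) (𝟙 d) (eqToHom (K.tensor_push_obj σ τ q p).symm ≫
        bimap (K.tensor f' g') ζ ξ) ≫
      eqToHom (K.act_tensor_obj _ _ _ _ _) ≫ bimap (K.act f') β' (𝟙 p') ≫ α' =
    eqToHom (K.act_push_obj _ _ _) ≫
      eqToHom (K.act_tensor_obj _ _ _ _ _) ≫ bimap (K.act f) β (𝟙 p) ≫ α := by
  have h₁ : bimap (K.act f') (bimap (K.act g') (𝟙 d) ζ) ξ ≫ bimap (K.act f') β' (𝟙 p') =
      eqToHom (by rw [K.act_push_obj τ]) ≫ bimap (K.act f') β (𝟙 _) ≫ bimap (K.act f') (𝟙 b) ξ := by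
    rw [← bimap_comp, h', ← bimap_comp, Category.comp_id, Category.comp_id, Category.id_comp,
      bimap_eqToHom_comp_left]
  have h₂ := K.act_push_map σ β (𝟙 p)
  rw [CategoryTheory.Functor.map_id] at h₂
  rw [bimap_eqToHom_comp_right, K.act_tensor_map]
  simp only [Category.assoc, eqToHom_trans_assoc, eqToHom_refl, Category.id_comp]
  rw [reassoc_of% h₁, h, h₂]
  simp

/-- The horizontal composite of two 2-cells. -/
def TwoCell.hcomp {s s' : OneCell x y} {r r' : OneCell y z} (θ : s ⟶ s') (ξ : r ⟶ r') :
    s.comp r ⟶ s'.comp r' :=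
  TwoCell.mk (s := s.comp r) (s' := s'.comp r') (θ.base ▷ r.base ≫ s'.base ◁ ξ.base)
    (eqToHom (K.tensor_push_obj θ.base ξ.base r.fib s.fib).symm ≫
      bimap (K.tensor s'.base r'.base) ξ.fib θ.fib) (hcomp_comm θ.comm' ξ.comm')

lemma TwoCell.hcomp_fib {s s' : OneCell x y} {r r' : OneCell y z} (θ : s ⟶ s') (ξ : r ⟶ r') :
    (θ.hcomp ξ).fib = eqToHom (K.tensor_push_obj θ.base ξ.base r.fib s.fib).symm ≫
      bimap (K.tensor s'.base r'.base) ξ.fib θ.fib := rfl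

lemma TwoCell.hcomp_id (s : OneCell x y) (r : OneCell y z) :
    TwoCell.hcomp (𝟙 s) (𝟙 r) = 𝟙 (s.comp r) := by
  have h : 𝟙 s.base ▷ r.base ≫ s.base ◁ 𝟙 r.base = 𝟙 (s.base ≫ r.base) := by simp
  refine TwoCell.hom_ext h ?_
  rw [hcomp_fib, id_fib, id_fib, id_fib, bimap_eqToHom]
  exact (eqToHom_trans _ _).trans (eqToHom_trans _ _).symm

/-- The component in the fibre of the interchange law. The equalities `e_i` are arbitrary, so
that the lemma does not depend on how identities of objects have been proved. -/
lemma hcomp_comp_fib {A B D : C} {f f' f'' : A ⟶ B} {g g' g'' : B ⟶ D} {σ : f ⟶ f'}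
    {σ' : f' ⟶ f''} {τ : g ⟶ g'} {τ' : g' ⟶ g''} {p : K.F f} {p' : K.F f'} {p'' : K.F f''}
    {q : K.F g} {q' : K.F g'} {q'' : K.F g''} (ξ : (K.push σ).obj p ⟶ p')
    (ξ' : (K.push σ').obj p' ⟶ p'') (ζ : (K.push τ).obj q ⟶ q')
    (ζ' : (K.push τ').obj q' ⟶ q'') {k k' : K.F (f'' ≫ g'')} {l : K.F (f' ≫ g')} {m : K.F f''}
    {n : K.F g''} (e₁ : k = (K.tensor f'' g'').obj (n, m)) (e₂ e₃) (e₄ : k = k')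
    (e₅ : k' = (K.push (σ' ▷ g' ≫ f'' ◁ τ')).obj l) (e₆ e₇) :
    eqToHom e₁ ≫ bimap (K.tensor f'' g'') (eqToHom e₂ ≫ (K.push τ').map ζ ≫ ζ')
        (eqToHom e₃ ≫ (K.push σ').map ξ ≫ ξ') =
      eqToHom e₄ ≫ eqToHom e₅ ≫ (K.push (σ' ▷ g' ≫ f'' ◁ τ')).map
        (eqToHom e₆ ≫ bimap (K.tensor f' g') ζ ξ) ≫ eqToHom e₇ ≫
          bimap (K.tensor f'' g'') ζ' ξ' := by
  rw [bimap_eqToHom_comp_left, bimap_eqToHom_comp_right, bimap_comp, K.tensor_push_map,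
    CategoryTheory.Functor.map_comp, eqToHom_map]
  simp

lemma TwoCell.hcomp_comp {s s' s'' : OneCell x y} {r r' r'' : OneCell y z} (θ : s ⟶ s')
    (θ' : s' ⟶ s'') (ξ : r ⟶ r') (ξ' : r' ⟶ r'') :
    TwoCell.hcomp (θ ≫ θ') (ξ ≫ ξ') = θ.hcomp ξ ≫ θ'.hcomp ξ' := by
  have h : (θ ≫ θ').base ▷ r.base ≫ s''.base ◁ (ξ ≫ ξ').base =
      (θ.base ▷ r.base ≫ s'.base ◁ ξ.base) ≫ θ'.base ▷ r'.base ≫ s''.base ◁ ξ'.base := by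
    simp [whisker_exchange_assoc]
  refine TwoCell.hom_ext h ?_
  exact hcomp_comp_fib θ.fib θ'.fib ξ.fib ξ'.fib _ _ _ _ _ _ _

/-- Horizontal composition as a functor. -/
def OneCell.compFunctor (x y z : K.Vertex) : OneCell x y × OneCell y z ⥤ OneCell x z where
  obj s := s.1.comp s.2
  map θ := TwoCell.hcomp θ.1 θ.2
  map_id s := TwoCell.hcomp_id s.1 s.2
  map_comp θ θ' := TwoCell.hcomp_comp θ.1 θ'.1 θ.2 θ'.2

/-- The components of the associator satisfy the condition on 2-cells. -/
lemma assoc_comm {a b c d : C} {f : a ⟶ b} {g : b ⟶ c} {h : c ⟶ d} {x : K.E a} {y : K.E b}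
    {z : K.E c} {t : K.E d} {p : K.F f} {q : K.F g} {r : K.F h} (α : (K.act f).obj (y, p) ⟶ x)
    (β : (K.act g).obj (z, q) ⟶ y) (γ : (K.act h).obj (t, r) ⟶ z) :
    bimap (K.act (f ≫ g ≫ h)) (𝟙 t) (eqToHom (K.tensor_assoc_obj f g h r q p)) ≫
      eqToHom (K.act_tensor_obj _ _ _ _ _) ≫ bimap (K.act f)
        (eqToHom (K.act_tensor_obj _ _ _ _ _) ≫ bimap (K.act g) γ (𝟙 q) ≫ β) (𝟙 p) ≫ α =
    eqToHom (K.act_push_obj _ _ _) ≫ eqToHom (K.act_tensor_obj _ _ _ _ _) ≫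
      bimap (K.act (f ≫ g)) γ (𝟙 ((K.tensor f g).obj (q, p))) ≫
        eqToHom (K.act_tensor_obj _ _ _ _ _) ≫ bimap (K.act f) β (𝟙 p) ≫ α := by
  rw [bimap_eqToHom_right, bimap_eqToHom_comp_left, bimap_comp_left, ← bimap_id,
    K.act_tensor_map]
  simp

/-- The associator. -/
def TwoCell.assoc (s : OneCell x y) (r : OneCell y z) (q : OneCell z t) :
    (s.comp r).comp q ⟶ s.comp (r.comp q) :=
  TwoCell.mk (s := (s.comp r).comp q) (s' := s.comp (r.comp q))
    (α_ s.base r.base q.base).hom (eqToHom (K.tensor_assoc_obj _ _ _ _ _ _))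
    (assoc_comm s.str r.str q.str)

lemma leftUnitor_comm {a b : C} {f : a ⟶ b} {x : K.E a} {y : K.E b} {p : K.F f}
    (α : (K.act f).obj (y, p) ⟶ x) :
    bimap (K.act f) (𝟙 y) (eqToHom (K.tensor_unit_obj p)) ≫ α =
      eqToHom (K.act_push_obj (λ_ f).hom y ((K.tensor (𝟙 a) f).obj (p, K.unit a))) ≫
        eqToHom (K.act_tensor_obj _ _ _ _ _) ≫ bimap (K.act (𝟙 a)) α (𝟙 (K.unit a)) ≫
          eqToHom (K.act_unit_obj x) := by
  rw [bimap_eqToHom_right, K.act_unit_map]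
  simp

/-- The left unitor. -/
def TwoCell.leftUnitor (s : OneCell x y) : (OneCell.id x).comp s ⟶ s :=
  TwoCell.mk (s := (OneCell.id x).comp s) (λ_ s.base).hom (eqToHom (K.tensor_unit_obj s.fib))
    (leftUnitor_comm s.str)

lemma rightUnitor_comm {a b : C} {f : a ⟶ b} {x : K.E a} {y : K.E b} {p : K.F f}
    (α : (K.act f).obj (y, p) ⟶ x) :
    bimap (K.act f) (𝟙 y) (eqToHom (K.unit_tensor_obj p)) ≫ α =
      eqToHom (K.act_push_obj (ρ_ f).hom y ((K.tensor f (𝟙 b)).obj (K.unit b, p))) ≫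
        eqToHom (K.act_tensor_obj _ _ _ _ _) ≫
          bimap (K.act f) (eqToHom (K.act_unit_obj y)) (𝟙 p) ≫ α := by
  rw [bimap_eqToHom_right, bimap_eqToHom_left]
  simp

/-- The right unitor. -/
def TwoCell.rightUnitor (s : OneCell x y) : s.comp (OneCell.id y) ⟶ s :=
  TwoCell.mk (s := s.comp (OneCell.id y)) (ρ_ s.base).hom (eqToHom (K.unit_tensor_obj s.fib))
    (rightUnitor_comm s.str)

lemma assoc_natural_fib {a b c d : C} {f f' : a ⟶ b} {g g' : b ⟶ c} {h h' : c ⟶ d} {σ : f ⟶ f'}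
    {τ : g ⟶ g'} {κ : h ⟶ h'} {p : K.F f} {p' : K.F f'} {q : K.F g} {q' : K.F g'} {r : K.F h}
    {r' : K.F h'} (ξ : (K.push σ).obj p ⟶ p') (ζ : (K.push τ).obj q ⟶ q')
    (θ : (K.push κ).obj r ⟶ r') {k k' : K.F (f' ≫ g' ≫ h')} {l : K.F ((f' ≫ g') ≫ h')}
    {l' : K.F (f' ≫ g')} {l'' : K.F (f ≫ g ≫ h)} {l₃ : K.F (f ≫ g ≫ h)} {m : K.F (g' ≫ h')}
    (e₁ : k = _) (e₂ : l = _) (e₃ : l' = _) (e₄) (e₅ : k = k') (e₆ : k' = _) (e₇ : l'' = l₃)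
    (e₈ : _ = (K.tensor f' (g' ≫ h')).obj (m, (K.push σ).obj p)) (e₉ : m = _) :
    eqToHom e₁ ≫ (K.push (α_ f' g' h').hom).map (eqToHom e₂ ≫ bimap (K.tensor (f' ≫ g') h') θ
        (eqToHom e₃ ≫ bimap (K.tensor f' g') ζ ξ)) ≫ eqToHom e₄ =
      eqToHom e₅ ≫ eqToHom e₆ ≫ (K.push (σ ▷ (g ≫ h) ≫ f' ◁ (τ ▷ h ≫ g' ◁ κ))).map (eqToHom e₇) ≫
        eqToHom e₈ ≫
        bimap (K.tensor f' (g' ≫ h')) (eqToHom e₉ ≫ bimap (K.tensor g' h') θ ζ) ξ := by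
  rw [bimap_eqToHom_comp_right, bimap_eqToHom_comp_left, CategoryTheory.Functor.map_comp,
    CategoryTheory.Functor.map_comp, K.tensor_assoc_map, eqToHom_map, eqToHom_map, eqToHom_map]
  simp

lemma TwoCell.assoc_natural {s s' : OneCell x y} {r r' : OneCell y z} {q q' : OneCell z t}
    (θ : s ⟶ s') (ξ : r ⟶ r') (ζ : q ⟶ q') :
    (θ.hcomp ξ).hcomp ζ ≫ TwoCell.assoc s' r' q' =
      TwoCell.assoc s r q ≫ θ.hcomp (ξ.hcomp ζ) := by
  have h : ((θ.base ▷ r.base ≫ s'.base ◁ ξ.base) ▷ q.base ≫ (s'.base ≫ r'.base) ◁ ζ.base) ≫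
      (α_ s'.base r'.base q'.base).hom = (α_ s.base r.base q.base).hom ≫
      θ.base ▷ (r.base ≫ q.base) ≫ s'.base ◁ (ξ.base ▷ q.base ≫ r'.base ◁ ζ.base) := by
    simp
  refine TwoCell.hom_ext h ?_
  exact assoc_natural_fib θ.fib ξ.fib ζ.fib _ _ _ (K.tensor_assoc_obj _ _ _ _ _ _) _ _
    (K.tensor_assoc_obj _ _ _ _ _ _) _ _

lemma leftUnitor_natural_fib {a b : C} {f f' : a ⟶ b} {σ : f ⟶ f'} {p : K.F f} {p' : K.F f'}
    (ξ : (K.push σ).obj p ⟶ p') {k k' : K.F f'} {l : K.F (𝟙 a ≫ f')} {l' : K.F f}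
    {m : K.F (𝟙 a)} (e₁ : k = _) (e₂ : l = (K.tensor (𝟙 a) f').obj (_, m)) (e₃ : m = K.unit a)
    (e₄ : _ = p') (e₅ : k = k') (e₆ : k' = _) (e₇ : l' = p) :
    eqToHom e₁ ≫ (K.push (λ_ f').hom).map (eqToHom e₂ ≫ bimap (K.tensor (𝟙 a) f') ξ
      (eqToHom e₃)) ≫ eqToHom e₄ =
      eqToHom e₅ ≫ eqToHom e₆ ≫ (K.push σ).map (eqToHom e₇) ≫ ξ := by
  subst e₃
  have := K.tensor_unit_map ξ
  rw [eqToHom_refl, CategoryTheory.Functor.map_comp, this, eqToHom_map, eqToHom_map]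
  simp

lemma TwoCell.leftUnitor_natural {s s' : OneCell x y} (θ : s ⟶ s') :
    TwoCell.hcomp (𝟙 (OneCell.id x)) θ ≫ TwoCell.leftUnitor s' = TwoCell.leftUnitor s ≫ θ := by
  have h : (𝟙 (𝟙 x.base) ▷ s.base ≫ 𝟙 x.base ◁ θ.base) ≫ (λ_ s'.base).hom =
      (λ_ s.base).hom ≫ θ.base := by
    simp
  refine TwoCell.hom_ext h ?_
  exact leftUnitor_natural_fib θ.fib _ _ (K.push_id_obj _) (K.tensor_unit_obj _) _ _
    (K.tensor_unit_obj _)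

lemma rightUnitor_natural_fib {a b : C} {f f' : a ⟶ b} {σ : f ⟶ f'} {p : K.F f} {p' : K.F f'}
    (ξ : (K.push σ).obj p ⟶ p') {k k' : K.F f'} {l : K.F (f' ≫ 𝟙 b)} {l' : K.F f}
    {m : K.F (𝟙 b)} (e₁ : k = _) (e₂ : l = (K.tensor f' (𝟙 b)).obj (m, _)) (e₃ : m = K.unit b)
    (e₄ : _ = p') (e₅ : k = k') (e₆ : k' = _) (e₇ : l' = p) :
    eqToHom e₁ ≫ (K.push (ρ_ f').hom).map (eqToHom e₂ ≫ bimap (K.tensor f' (𝟙 b))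
      (eqToHom e₃) ξ) ≫ eqToHom e₄ =
      eqToHom e₅ ≫ eqToHom e₆ ≫ (K.push σ).map (eqToHom e₇) ≫ ξ := by
  subst e₃
  have := K.unit_tensor_map ξ
  rw [eqToHom_refl, CategoryTheory.Functor.map_comp, this, eqToHom_map, eqToHom_map]
  simp

lemma TwoCell.rightUnitor_natural {s s' : OneCell x y} (θ : s ⟶ s') :
    TwoCell.hcomp θ (𝟙 (OneCell.id y)) ≫ TwoCell.rightUnitor s' = TwoCell.rightUnitor s ≫ θ := by
  have h : (θ.base ▷ 𝟙 y.base ≫ s'.base ◁ 𝟙 (𝟙 y.base)) ≫ (ρ_ s'.base).hom =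
      (ρ_ s.base).hom ≫ θ.base := by
    simp
  refine TwoCell.hom_ext h ?_
  exact rightUnitor_natural_fib θ.fib _ _ (K.push_id_obj _) (K.unit_tensor_obj _) _ _
    (K.unit_tensor_obj _)

section Strict

variable [Bicategory.Strict C]

/-- If `C` is strict, so is the 2-category of `K`: the constraint 2-cells are identities. -/
lemma TwoCell.assoc_eq (s : OneCell x y) (r : OneCell y z) (q : OneCell z t) :
    ∃ e, TwoCell.assoc s r q = eqToHom e :=
  TwoCell.eq_eqToHom _ ⟨Bicategory.Strict.assoc _ _ _,
    congrArg Iso.hom (Bicategory.Strict.associator_eqToIso _ _ _)⟩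
    ⟨K.tensor_assoc_obj _ _ _ _ _ _, rfl⟩

lemma TwoCell.leftUnitor_eq (s : OneCell x y) : ∃ e, TwoCell.leftUnitor s = eqToHom e :=
  TwoCell.eq_eqToHom _ ⟨Bicategory.Strict.id_comp _,
    congrArg Iso.hom (Bicategory.Strict.leftUnitor_eqToIso _)⟩ ⟨K.tensor_unit_obj _, rfl⟩

lemma TwoCell.rightUnitor_eq (s : OneCell x y) : ∃ e, TwoCell.rightUnitor s = eqToHom e :=
  TwoCell.eq_eqToHom _ ⟨Bicategory.Strict.comp_id _,
    congrArg Iso.hom (Bicategory.Strict.rightUnitor_eqToIso _)⟩ ⟨K.unit_tensor_obj _, rfl⟩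

end Strict

section Enriched

open MonoidalCategory

/-- The functor `1 ⥤ D` on an object of `D`. -/
def catPoint (D : Cat.{v, u}) (d : D) : 𝟙_ Cat.{v, u} ⟶ D :=
  ((Functor.const (𝟙_ Cat.{v, u})).obj d).toCatHom

variable {C : Type w} [Bicategory.{w, w} C] [Bicategory.Strict C] {K : Coefficients.{w, v, u} C}

/-- The strict 2-category of `K`, as a category enriched in `Cat`. The laws hold because the
natural constraint 2-cells have identities as components. -/
instance : EnrichedCategory Cat.{max w v, max w u v} (Vertex K) where
  Hom x y := Cat.of (OneCell x y)
  id x := catPoint _ (OneCell.id x)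
  comp x y z := (OneCell.compFunctor x y z).toCatHom
  id_comp x y := by
    ext1
    exact functor_eq_of_natural (fun s => TwoCell.leftUnitor s) (fun s => TwoCell.leftUnitor_eq s)
      (fun f => TwoCell.leftUnitor_natural f)
  comp_id x y := by
    ext1
    exact functor_eq_of_natural (fun s => TwoCell.rightUnitor s)
      (fun s => TwoCell.rightUnitor_eq s) (fun f => TwoCell.rightUnitor_natural f)
  assoc x y z t := by
    ext1
    exact functor_eq_of_natural (fun s => TwoCell.assoc s.1 s.2.1 s.2.2)
      (fun s => TwoCell.assoc_eq s.1 s.2.1 s.2.2)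
      (fun f => TwoCell.assoc_natural f.1 f.2.1 f.2.2)

end Enriched

end Coefficients

/-! ### The coefficients of a categorical operad -/

namespace CatOperad

variable {X : SSet.{w}} (P : CatOperad.{w, v, u} X)

lemma assoc_of_eq (s : X _⦋3⦌) {A₀₁ A₁₂ A₂₃ A₀₂ A₁₃ A₀₃ : X _⦋1⦌} {f₀ f₁ f₂ f₃ : X _⦋2⦌}
    (e₀ : X.δ 0 s = f₀) (e₁ : X.δ 1 s = f₁) (e₂ : X.δ 2 s = f₂) (e₃ : X.δ 3 s = f₃)
    (h₀ : IsTri f₀ A₂₃ A₁₂ A₁₃) (h₁ : IsTri f₁ A₂₃ A₀₂ A₀₃)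
    (h₂ : IsTri f₂ A₁₃ A₀₁ A₀₃) (h₃ : IsTri f₃ A₁₂ A₀₁ A₀₂) :
    ((P.mul _ h₀).prod (𝟭 (P.cat A₀₁))) ⋙ P.mul _ h₂ =
      prod.associator (P.cat A₂₃) (P.cat A₁₂) (P.cat A₀₁) ⋙
        ((𝟭 (P.cat A₂₃)).prod (P.mul _ h₃)) ⋙ P.mul _ h₁ := by
  subst e₀ e₁ e₂ e₃
  exact P.assoc s h₀ h₁ h₂ h₃

lemma mul_unit_of_eq {A E : X _⦋1⦌} (f : X _⦋2⦌) (h : IsTri f A E A) (hf : f = X.σ 0 A)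
    (e : P.cat E) (c : X _⦋0⦌) (hc : X.δ 1 A = c)
    (he : (⟨E, e⟩ : Σ A, P.cat A) = ⟨X.σ 0 c, P.unit c⟩) :
    (𝟭 (P.cat A)).prod' ((Functor.const _).obj e) ⋙ P.mul f h = 𝟭 (P.cat A) := by
  subst hf hc
  cases he
  exact P.mul_unit A

lemma unit_mul_of_eq {A E : X _⦋1⦌} (f : X _⦋2⦌) (h : IsTri f E A A) (hf : f = X.σ 1 A)
    (e : P.cat E) (c : X _⦋0⦌) (hc : X.δ 0 A = c)
    (he : (⟨E, e⟩ : Σ A, P.cat A) = ⟨X.σ 0 c, P.unit c⟩) :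
    ((Functor.const _).obj e).prod' (𝟭 (P.cat A)) ⋙ P.mul f h = 𝟭 (P.cat A) := by
  subst hf hc
  cases he
  exact P.unit_mul A

end CatOperad

section DecNerve

variable {X : SSet.{w}} {C : Type w} [Bicategory.{w, w} C] (φ : dec X ≅ duskinNerve C)

/-- The simplex of the nerve corresponding to a simplex of `X`. -/
def toNerve {n : ℕ} (x : X _⦋n + 1⦌) : NerveSimplex C n :=
  φ.hom.app (op ⦋n⦌) x

/-- The simplex of `X` corresponding to a simplex of the nerve. -/
def ofNerve {n : ℕ} (N : NerveSimplex C n) : X _⦋n + 1⦌ :=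
  φ.inv.app (op ⦋n⦌) N

lemma ofNerve_toNerve {n : ℕ} (x : X _⦋n + 1⦌) : ofNerve φ (toNerve φ x) = x :=
  ConcreteCategory.congr_hom (φ.hom_inv_id_app (op ⦋n⦌)) x

lemma toNerve_ofNerve {n : ℕ} (N : NerveSimplex C n) : toNerve φ (ofNerve φ N) = N :=
  ConcreteCategory.congr_hom (φ.inv_hom_id_app (op ⦋n⦌)) N

lemma map_ofNerve {n m : ℕ} (f : ⦋m⦌ ⟶ ⦋n⦌) {g : ⦋m + 1⦌ ⟶ ⦋n + 1⦌} (h : g = addTop.map f)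
    (N : NerveSimplex C n) : X.map g.op (ofNerve φ N) = ofNerve φ (N.precomp f.toOrderHom) := by
  subst h
  exact (ConcreteCategory.congr_hom (φ.inv.naturality f.op) N).symm

/-- The faces of `X` other than the top one are those of the décalage. -/
lemma addTop_δ {n : ℕ} (i : Fin (n + 2)) :
    (SimplexCategory.δ i.castSucc : ⦋n + 1⦌ ⟶ ⦋n + 2⦌) = addTop.map (SimplexCategory.δ i) := by
  ext a : 3
  change Fin.succAbove _ _ = addTopMap (SimplexCategory.δ i).toOrderHom a
  induction a using Fin.lastCases with
  | last =>
    rw [addTopMap_last]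
    simp
  | cast a =>
    rw [addTopMap_castSucc]
    exact Fin.castSucc_succAbove_castSucc

/-- The degeneracies of `X` other than the top one are those of the décalage. -/
lemma addTop_σ {n : ℕ} (i : Fin (n + 1)) :
    (SimplexCategory.σ i.castSucc : ⦋n + 2⦌ ⟶ ⦋n + 1⦌) = addTop.map (SimplexCategory.σ i) := by
  ext a : 3
  change Fin.predAbove _ _ = addTopMap (SimplexCategory.σ i).toOrderHom a
  induction a using Fin.lastCases with
  | last =>
    rw [addTopMap_last]
    simp
  | cast a =>
    rw [addTopMap_castSucc]
    exact Fin.castSucc_predAbove_castSucc _ _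

lemma δ_ofNerve {n : ℕ} (i : Fin (n + 2)) (N : NerveSimplex C (n + 1)) :
    X.δ i.castSucc (ofNerve φ N) = ofNerve φ (N.precomp (SimplexCategory.δ i).toOrderHom) :=
  map_ofNerve φ _ (addTop_δ i) N

lemma σ_ofNerve {n : ℕ} (i : Fin (n + 1)) (N : NerveSimplex C n) :
    X.σ i.castSucc (ofNerve φ N) = ofNerve φ (N.precomp (SimplexCategory.σ i).toOrderHom) :=
  map_ofNerve φ _ (addTop_σ i) N

/-- The edge of `X` corresponding to an object of `C`, that is, to a vertex of the décalage. -/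
def obX (A : C) : X _⦋1⦌ := ofNerve φ (.point A)

/-- The triangle of `X` corresponding to a 1-cell of `C`. -/
def arrX {A B : C} (f : A ⟶ B) : X _⦋2⦌ := ofNerve φ (.arrow f)

/-- The fibre of a 1-cell of `C`: the edge of the corresponding triangle of `X` opposite to its last
vertex. -/
def fibX {A B : C} (f : A ⟶ B) : X _⦋1⦌ := X.δ 2 (arrX φ f)

/-- The tetrahedron of `X` corresponding to a lax triangle in `C`. -/
def laxX {A B D : C} {f : A ⟶ B} {g : B ⟶ D} {h : A ⟶ D} (σ : f ≫ g ⟶ h) : X _⦋3⦌ :=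
  ofNerve φ (.triangle σ)

/-- The fibre of a lax triangle in `C`: the face of the corresponding tetrahedron of `X` opposite to
its last vertex. -/
def triX {A B D : C} {f : A ⟶ B} {g : B ⟶ D} {h : A ⟶ D} (σ : f ≫ g ⟶ h) : X _⦋2⦌ :=
  X.δ 3 (laxX φ σ)

variable {A B D : C} {f : A ⟶ B} {g : B ⟶ D} {h : A ⟶ D} (σ : f ≫ g ⟶ h)

lemma δ₀_arrX : X.δ 0 (arrX φ f) = obX φ B :=
  (δ_ofNerve φ 0 _).trans (congrArg _ (NerveSimplex.precomp_eq_point _ _ rfl))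

lemma δ₁_arrX : X.δ 1 (arrX φ f) = obX φ A :=
  (δ_ofNerve φ 1 _).trans (congrArg _ (NerveSimplex.precomp_eq_point _ _ rfl))

lemma isTri_arrX (f : A ⟶ B) : IsTri (arrX φ f) (obX φ B) (fibX φ f) (obX φ A) :=
  ⟨δ₀_arrX φ, rfl, δ₁_arrX φ⟩

lemma δ₀_laxX : X.δ 0 (laxX φ σ) = arrX φ g :=
  (δ_ofNerve φ 0 _).trans (congrArg _ (NerveSimplex.eq_arrow _))

lemma δ₁_laxX : X.δ 1 (laxX φ σ) = arrX φ h :=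
  (δ_ofNerve φ 1 _).trans (congrArg _ (NerveSimplex.eq_arrow _))

lemma δ₂_laxX : X.δ 2 (laxX φ σ) = arrX φ f :=
  (δ_ofNerve φ 2 _).trans (congrArg _ (NerveSimplex.eq_arrow _))

lemma isTri_triX : IsTri (triX φ σ) (fibX φ g) (fibX φ f) (fibX φ h) where
  d0 := by
    rw [fibX, ← δ₀_laxX φ σ]
    exact ConcreteCategory.congr_hom (X.δ_comp_δ (i := 0) (j := 2) (by decide)) (laxX φ σ)
  d1 := by
    rw [fibX, ← δ₁_laxX φ σ]
    exact ConcreteCategory.congr_hom (X.δ_comp_δ (i := 1) (j := 2) (by decide)) (laxX φ σ)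
  d2 := by
    rw [fibX, ← δ₂_laxX φ σ]
    exact ConcreteCategory.congr_hom (X.δ_comp_δ (i := 2) (j := 2) (by decide)) (laxX φ σ)

/-- The cocycle condition in `C` gives a 4-simplex of `X`; the tetrahedron is its face opposite
to the last vertex. -/
lemma exists_tetX {a b c d : C} {f : a ⟶ b} {g : b ⟶ c} {h : c ⟶ d} {p : a ⟶ c} {q : b ⟶ d}
    {r : a ⟶ d} (σ : f ≫ g ⟶ p) (τ : p ≫ h ⟶ r) (σ' : g ≫ h ⟶ q) (τ' : f ≫ q ⟶ r)
    (e : σ ▷ h ≫ τ = (α_ f g h).hom ≫ f ◁ σ' ≫ τ') : ∃ s : X _⦋3⦌,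
      X.δ 0 s = triX φ σ' ∧ X.δ 1 s = triX φ τ ∧ X.δ 2 s = triX φ τ' ∧ X.δ 3 s = triX φ σ := by
  let s := ofNerve φ (.tetrahedron σ τ σ' τ' e)
  have h₀ : X.δ 0 s = laxX φ σ' :=
    (δ_ofNerve φ 0 _).trans (congrArg _ (NerveSimplex.eq_triangle _))
  have h₁ : X.δ 1 s = laxX φ τ :=
    (δ_ofNerve φ 1 _).trans (congrArg _ (NerveSimplex.eq_triangle _))
  have h₂ : X.δ 2 s = laxX φ τ' :=
    (δ_ofNerve φ 2 _).trans (congrArg _ (NerveSimplex.eq_triangle _))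
  have h₃ : X.δ 3 s = laxX φ σ :=
    (δ_ofNerve φ 3 _).trans (congrArg _ (NerveSimplex.eq_triangle _))
  refine ⟨X.δ 4 s, ?_, ?_, ?_, ?_⟩
  · rw [triX, ← h₀]
    exact ConcreteCategory.congr_hom (X.δ_comp_δ (i := 0) (j := 3) (by decide)) s
  · rw [triX, ← h₁]
    exact ConcreteCategory.congr_hom (X.δ_comp_δ (i := 1) (j := 3) (by decide)) s
  · rw [triX, ← h₂]
    exact ConcreteCategory.congr_hom (X.δ_comp_δ (i := 2) (j := 3) (by decide)) s
  · rw [triX, ← h₃]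
    exact ConcreteCategory.congr_hom (X.δ_comp_δ (i := 3) (j := 3) (by decide)) s

lemma arrX_id (A : C) : arrX φ (𝟙 A) = X.σ 0 (obX φ A) :=
  ((σ_ofNerve φ 0 (.point A)).trans (congrArg _ (NerveSimplex.eq_arrow _))).symm

lemma fibX_id (A : C) : fibX φ (𝟙 A) = X.σ 0 (X.δ 1 (obX φ A)) := by
  rw [fibX, arrX_id]
  exact ConcreteCategory.congr_hom (X.δ_comp_σ_of_gt (i := 1) (j := 0) (by decide)) _

lemma triX_leftUnitor (f : A ⟶ B) : triX φ (λ_ f).hom = X.σ 0 (fibX φ f) := by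
  have h : laxX φ (λ_ f).hom = X.σ 0 (arrX φ f) :=
    ((σ_ofNerve φ 0 (.arrow f)).trans (congrArg _ (NerveSimplex.eq_triangle _))).symm
  rw [triX, h]
  exact ConcreteCategory.congr_hom (X.δ_comp_σ_of_gt (i := 2) (j := 0) (by decide)) _

lemma triX_rightUnitor (f : A ⟶ B) : triX φ (ρ_ f).hom = X.σ 1 (fibX φ f) := by
  have h : laxX φ (ρ_ f).hom = X.σ 1 (arrX φ f) :=
    ((σ_ofNerve φ 1 (.arrow f)).trans (congrArg _ (NerveSimplex.eq_triangle _))).symm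
  rw [triX, h]
  exact ConcreteCategory.congr_hom (X.δ_comp_σ_of_gt (i := 2) (j := 1) (by decide)) _

lemma δ₁_fibX (f : A ⟶ B) : X.δ 1 (fibX φ f) = X.δ 1 (obX φ A) := by
  rw [← δ₁_arrX φ (f := f)]
  exact ConcreteCategory.congr_hom (X.δ_comp_δ (i := 1) (j := 1) (by decide)) _

lemma δ₀_fibX (f : A ⟶ B) : X.δ 0 (fibX φ f) = X.δ 1 (obX φ B) := by
  rw [← δ₀_arrX φ (f := f)]
  exact ConcreteCategory.congr_hom (X.δ_comp_δ (i := 0) (j := 1) (by decide)) _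

variable (P : CatOperad.{w, v, u} X)

/-- The unit over the fibre of an identity 1-cell, which is a degenerate edge of `X`. -/
lemma exists_unit (A : C) : ∃ e : P.cat (fibX φ (𝟙 A)),
    (⟨_, e⟩ : Σ A, P.cat A) = ⟨X.σ 0 (X.δ 1 (obX φ A)), P.unit _⟩ := by
  rw [fibX_id]
  exact ⟨_, rfl⟩

/-- The coefficients of a categorical operad `P`: the categories over the edges of `X` which
correspond to objects of `C` and to fibres of 1-cells of `C`. -/
noncomputable def coefficients : Coefficients.{w, v, u} C where
  E A := P.cat (obX φ A)
  F f := P.cat (fibX φ f)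
  mul σ := P.mul (triX φ σ) (isTri_triX φ σ)
  act f := P.mul (arrX φ f) (isTri_arrX φ f)
  unit A := (exists_unit φ P A).choose
  mul_assoc σ τ σ' τ' e := by
    obtain ⟨s, h₀, h₁, h₂, h₃⟩ := exists_tetX φ σ τ σ' τ' e
    exact P.assoc_of_eq s h₀ h₁ h₂ h₃ _ _ _ _
  mul_unit f := P.mul_unit_of_eq _ _ (triX_leftUnitor φ f) _ _ (δ₁_fibX φ f)
    (exists_unit φ P _).choose_spec
  unit_mul f := P.unit_mul_of_eq _ _ (triX_rightUnitor φ f) _ _ (δ₀_fibX φ f)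
    (exists_unit φ P _).choose_spec
  act_mul σ := P.assoc_of_eq (laxX φ σ) (δ₀_laxX φ σ) (δ₁_laxX φ σ) (δ₂_laxX φ σ) rfl _ _ _ _
  act_unit A := P.mul_unit_of_eq _ _ (arrX_id φ A) _ _ rfl (exists_unit φ P _).choose_spec

end DecNerve

/-! ### Simplices of the nerve of the 2-category of a system of coefficients -/

namespace Coefficients

section LaxTriangles

variable {C : Type w} [Bicategory.{w, w} C] {K : Coefficients.{w, v, u} C} {x y z t : K.Vertex}

lemma tensor_push_eq_mul_map {A B D : C} {f : A ⟶ B} {g : B ⟶ D} {h : A ⟶ D} (σ : f ≫ g ⟶ h)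
    {q q' : K.F g} {p p' : K.F f} (y : q ⟶ q') (x : p ⟶ p') :
    (K.push σ).map (bimap (K.tensor f g) y x) = eqToHom (K.tensor_push_eq_mul σ q p) ≫
      bimap (K.mul σ) y x ≫ eqToHom (K.tensor_push_eq_mul σ q' p').symm :=
  Functor.congr_hom (K.tensor_push σ) (Prod.mkHom y x)

lemma act_mul_obj {a b c : C} {f : a ⟶ b} {g : b ⟶ c} {h : a ⟶ c} (σ : f ≫ g ⟶ h) (d : K.E c)
    (q : K.F g) (p : K.F f) :
    (K.act f).obj ((K.act g).obj (d, q), p) = (K.act h).obj (d, (K.mul σ).obj (q, p)) :=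
  Functor.congr_obj (K.act_mul σ) ((d, q), p)

lemma eqToHom_symm_comp {A : Type*} [Category* A] {a b c : A} (e : a = b) (f : a ⟶ c) :
    eqToHom e ≫ eqToHom e.symm ≫ f = f := by
  simp

lemma eqToHom_comp_map_eqToHom {A A' : Type*} [Category* A] [Category* A'] (T : A ⥤ A') {a b : A}
    {c d : A'} (e : a = b) (e' : d = T.obj a) (f : T.obj b ⟶ c) :
    ∃ e'', eqToHom e' ≫ T.map (eqToHom e) ≫ f = eqToHom e'' ≫ f := by
  subst e e'
  exact ⟨rfl, by simp⟩

lemma eqToHom_comp_eq_iff {A : Type*} [Category* A] {a b c d e k : A} (h₁ : d = a) (h₂ : e = b)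
    (h₃ : k = e) (h₄ : d = k) (u : a ⟶ c) (v : b ⟶ c) :
    eqToHom h₁ ≫ u = eqToHom h₄ ≫ eqToHom h₃ ≫ eqToHom h₂ ≫ v ↔
      ∃ h, v = eqToHom h ≫ u := by
  subst h₁ h₂ h₃ h₄
  simp [eq_comm]

/-- The 2-cell `g ∘ f ⇒ h` of `C` underlying a lax triangle in the 2-category of `K`. -/
def TwoCell.laxBase {s : OneCell x y} {r : OneCell y z} {m : OneCell x z} (θ : s.comp r ⟶ m) :
    s.base ≫ r.base ⟶ m.base :=
  θ.base

/-- The morphism `q · p ⟶ m` underlying a lax triangle in the 2-category of `K`. -/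
def TwoCell.lax {s : OneCell x y} {r : OneCell y z} {m : OneCell x z} (θ : s.comp r ⟶ m) :
    (K.mul θ.laxBase).obj (r.fib, s.fib) ⟶ m.fib :=
  eqToHom (K.tensor_push_eq_mul θ.laxBase r.fib s.fib).symm ≫ θ.fib

/-- The condition on a 2-cell `g ∘ f ⇒ h` of the 2-category of `K` in the form of a cocycle
condition for `mul` and `act`. -/
lemma lax_comm_iff {A B D : C} {f : A ⟶ B} {g : B ⟶ D} {h : A ⟶ D} {σ : f ≫ g ⟶ h} {a : K.E A}
    {b : K.E B} {d : K.E D} {p : K.F f} {q : K.F g} {m : K.F h} {α : (K.act f).obj (b, p) ⟶ a}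
    {β : (K.act g).obj (d, q) ⟶ b} {γ : (K.act h).obj (d, m) ⟶ a}
    {ξ : (K.mul σ).obj (q, p) ⟶ m} :
    (∃ e, bimap (K.act f) β (𝟙 p) ≫ α = eqToHom e ≫ bimap (K.act h) (𝟙 d) ξ ≫ γ) ↔
      bimap (K.act h) (𝟙 d) (eqToHom (K.tensor_push_eq_mul σ q p) ≫ ξ) ≫ γ =
        eqToHom (K.act_push_obj _ _ _) ≫ eqToHom (K.act_tensor_obj _ _ _ _ _) ≫
          bimap (K.act f) β (𝟙 p) ≫ α := by
  rw [bimap_eqToHom_comp_right]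
  constructor
  · rintro ⟨e, h⟩
    rw [h]
    simp
  · intro h
    refine ⟨K.act_mul_obj σ d q p, ?_⟩
    rw [Category.assoc, eqToHom_comp_iff] at h
    rw [h]
    simp

/-- The lax triangle with a given underlying morphism. -/
def TwoCell.ofLax {s : OneCell x y} {r : OneCell y z} {m : OneCell x z}
    (σ : s.base ≫ r.base ⟶ m.base) (ξ : (K.mul σ).obj (r.fib, s.fib) ⟶ m.fib)
    (h : ∃ e, bimap (K.act s.base) r.str (𝟙 s.fib) ≫ s.str =
      eqToHom e ≫ bimap (K.act m.base) (𝟙 z.fib) ξ ≫ m.str) : s.comp r ⟶ m :=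
  TwoCell.mk (s := s.comp r) σ (eqToHom (K.tensor_push_eq_mul σ r.fib s.fib) ≫ ξ)
    (lax_comm_iff.1 h)

lemma TwoCell.ofLax_lax {s : OneCell x y} {r : OneCell y z} {m : OneCell x z}
    (σ : s.base ≫ r.base ⟶ m.base) (ξ : (K.mul σ).obj (r.fib, s.fib) ⟶ m.fib) (h) :
    (TwoCell.ofLax σ ξ h).lax = ξ :=
  eqToHom_symm_comp (K.tensor_push_eq_mul σ r.fib s.fib).symm ξ

lemma TwoCell.fib_eq {s : OneCell x y} {r : OneCell y z} {m : OneCell x z} (θ : s.comp r ⟶ m) :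
    eqToHom (K.tensor_push_eq_mul θ.laxBase r.fib s.fib) ≫ θ.lax = θ.fib :=
  eqToHom_symm_comp _ θ.fib

lemma TwoCell.lax_comm {s : OneCell x y} {r : OneCell y z} {m : OneCell x z}
    (θ : s.comp r ⟶ m) : ∃ e, bimap (K.act s.base) r.str (𝟙 s.fib) ≫ s.str =
      eqToHom e ≫ bimap (K.act m.base) (𝟙 z.fib) θ.lax ≫ m.str :=
  lax_comm_iff.2 ((congrArg (fun ξ => bimap (K.act m.base) (𝟙 z.fib) ξ ≫ m.str) θ.fib_eq).trans
    θ.comm')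

lemma whiskerRight_fib {a b c d : C} {f : a ⟶ b} {g : b ⟶ c} {h : c ⟶ d} {m : a ⟶ c} {n : a ⟶ d}
    (σ : f ≫ g ⟶ m) (τ : m ≫ h ⟶ n) {p : K.F f} {q : K.F g} {r : K.F h} {s : K.F m} {l : K.F n}
    (ξ : (K.push σ).obj ((K.tensor f g).obj (q, p)) ⟶ s)
    (ζ : (K.push τ).obj ((K.tensor m h).obj (r, s)) ⟶ l) {k : K.F n} {k' : K.F (m ≫ h)}
    {r' : K.F h} (e₁ : k = (K.push τ).obj k') (e₂ : k' = (K.tensor m h).obj (r', _))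
    (e₃ : r' = r) : ∃ e,
    eqToHom e₁ ≫ (K.push τ).map (eqToHom e₂ ≫ bimap (K.tensor m h) (eqToHom e₃) ξ) ≫ ζ =
      eqToHom e ≫ bimap (K.mul τ) (𝟙 r)
        (eqToHom (K.tensor_push_eq_mul σ q p).symm ≫ ξ) ≫
          (eqToHom (K.tensor_push_eq_mul τ r s).symm ≫ ζ) := by
  subst e₁ e₂ e₃
  refine ⟨by rw [K.tensor_push_eq_mul, K.tensor_push_eq_mul], ?_⟩
  rw [bimap_eqToHom_comp_right, eqToHom_refl, eqToHom_refl, Category.id_comp, Category.id_comp,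
    eqToHom_refl, tensor_push_eq_mul_map]
  simp

lemma whiskerLeft_fib {a b c d : C} {f : a ⟶ b} {g : b ⟶ c} {h : c ⟶ d} {m : b ⟶ d} {n : a ⟶ d}
    (σ : g ≫ h ⟶ m) (τ : f ≫ m ⟶ n) {p : K.F f} {q : K.F g} {r : K.F h} {s : K.F m} {l : K.F n}
    (ξ : (K.push σ).obj ((K.tensor g h).obj (r, q)) ⟶ s)
    (ζ : (K.push τ).obj ((K.tensor f m).obj (s, p)) ⟶ l) {k : K.F n} {k' : K.F (f ≫ m)}
    {p' : K.F f} (e₁ : k = (K.push τ).obj k') (e₂ : k' = (K.tensor f m).obj (_, p'))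
    (e₃ : p' = p) : ∃ e,
    eqToHom e₁ ≫ (K.push τ).map (eqToHom e₂ ≫ bimap (K.tensor f m) ξ (eqToHom e₃)) ≫ ζ =
      eqToHom e ≫ bimap (K.mul τ) (eqToHom (K.tensor_push_eq_mul σ r q).symm ≫ ξ) (𝟙 p) ≫
        (eqToHom (K.tensor_push_eq_mul τ s p).symm ≫ ζ) := by
  subst e₁ e₂ e₃
  refine ⟨by rw [K.tensor_push_eq_mul, K.tensor_push_eq_mul], ?_⟩
  rw [bimap_eqToHom_comp_left, eqToHom_refl, eqToHom_refl, Category.id_comp, Category.id_comp,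
    eqToHom_refl, tensor_push_eq_mul_map]
  simp

lemma TwoCell.fib_congr {s s' : OneCell x y} {θ θ' : s ⟶ s'} (h : θ = θ') :
    ∃ e, θ.fib = eqToHom e ≫ θ'.fib := by
  subst h
  exact ⟨rfl, (Category.id_comp _).symm⟩

/-- Four lax triangles of the 2-category of `K` satisfy the cocycle condition if and only if the
underlying lax triangles of `C` and the underlying morphisms in the fibres do. -/
lemma TwoCell.cocycle_iff {s : OneCell x y} {r : OneCell y z} {q : OneCell z t} {m : OneCell x z}
    {n : OneCell y t} {l : OneCell x t} (θ : s.comp r ⟶ m) (κ : m.comp q ⟶ l)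
    (θ' : r.comp q ⟶ n) (κ' : s.comp n ⟶ l) :
    θ.hcomp (𝟙 q) ≫ κ = TwoCell.assoc s r q ≫ TwoCell.hcomp (𝟙 s) θ' ≫ κ' ↔
      θ.laxBase ▷ q.base ≫ κ.laxBase =
        (α_ s.base r.base q.base).hom ≫ s.base ◁ θ'.laxBase ≫ κ'.laxBase ∧
        ∃ e, bimap (K.mul κ'.laxBase) θ'.lax (𝟙 s.fib) ≫ κ'.lax =
          eqToHom e ≫ bimap (K.mul κ.laxBase) (𝟙 q.fib) θ.lax ≫ κ.lax := by
  have hb : (θ.hcomp (𝟙 q) ≫ κ).base = θ.laxBase ▷ q.base ≫ κ.laxBase := by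
    change (θ.laxBase ▷ q.base ≫ m.base ◁ 𝟙 q.base) ≫ κ.laxBase = _
    simp
  have hb' : (TwoCell.assoc s r q ≫ TwoCell.hcomp (𝟙 s) θ' ≫ κ').base =
      (α_ s.base r.base q.base).hom ≫ s.base ◁ θ'.laxBase ≫ κ'.laxBase := by
    change (α_ s.base r.base q.base).hom ≫
      (𝟙 s.base ▷ (r.base ≫ q.base) ≫ s.base ◁ θ'.laxBase) ≫ κ'.laxBase = _
    simp
  have hf : ∃ e, (θ.hcomp (𝟙 q) ≫ κ).fib =
      eqToHom e ≫ bimap (K.mul κ.laxBase) (𝟙 q.fib) θ.lax ≫ κ.lax :=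
    whiskerRight_fib θ.laxBase κ.laxBase θ.fib κ.fib (K.push_comp_obj _ _ _)
      (K.tensor_push_obj _ _ _ _).symm (K.push_id_obj _)
  have hf' : ∃ e, (TwoCell.hcomp (𝟙 s) θ' ≫ κ').fib =
      eqToHom e ≫ bimap (K.mul κ'.laxBase) θ'.lax (𝟙 s.fib) ≫ κ'.lax :=
    whiskerLeft_fib θ'.laxBase κ'.laxBase θ'.fib κ'.fib (K.push_comp_obj _ _ _)
      (K.tensor_push_obj _ _ _ _).symm (K.push_id_obj _)
  have hf'' : ∃ e, (TwoCell.assoc s r q ≫ TwoCell.hcomp (𝟙 s) θ' ≫ κ').fib =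
      eqToHom e ≫ (TwoCell.hcomp (𝟙 s) θ' ≫ κ').fib :=
    eqToHom_comp_map_eqToHom (K.push (TwoCell.hcomp (𝟙 s) θ' ≫ κ').base)
      (K.tensor_assoc_obj _ _ _ _ _ _) (K.push_comp_obj _ _ _) _
  obtain ⟨e₁, hf⟩ := hf
  obtain ⟨e₂, hf'⟩ := hf'
  obtain ⟨e₃, hf''⟩ := hf''
  rw [hf'] at hf''
  constructor
  · intro h
    refine ⟨hb.symm.trans ((congrArg TwoCell.base h).trans hb'), ?_⟩
    obtain ⟨e₄, h₄⟩ := TwoCell.fib_congr h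
    rw [hf, hf''] at h₄
    exact (eqToHom_comp_eq_iff _ _ _ _ _ _).1 h₄
  · rintro ⟨h, h₄⟩
    refine TwoCell.hom_ext (hb.trans (h.trans hb'.symm)) ?_
    rw [hf, hf'']
    exact (eqToHom_comp_eq_iff _ _ _ _ _ _).2 h₄

end LaxTriangles

end Coefficients

section StrictUnit

variable {B : Type*} [Bicategory B] [Bicategory.Strict B]

lemma leftUnitor_eq_eqToHom {a b : B} {m : a ⟶ a} (e : m = 𝟙 a) (f : a ⟶ b) :
    ∃ e', eqToHom e ▷ f ≫ (λ_ f).hom = eqToHom e' := by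
  subst e
  exact ⟨Bicategory.Strict.id_comp f, by simp [Bicategory.Strict.leftUnitor_eqToIso]⟩

lemma rightUnitor_eq_eqToHom {a b : B} {m : b ⟶ b} (e : m = 𝟙 b) (f : a ⟶ b) :
    ∃ e', f ◁ eqToHom e ≫ (ρ_ f).hom = eqToHom e' := by
  subst e
  exact ⟨Bicategory.Strict.comp_id f, by simp [Bicategory.Strict.rightUnitor_eqToIso]⟩

end StrictUnit

namespace Coefficients

section Nerve

variable {C : Type w} [Bicategory.{w, w} C] {K : Coefficients.{w, v, u} C} {x y z t : K.Vertex}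

lemma TwoCell.exists_laxBase_eq {s : OneCell x y} {r : OneCell y z} {m : OneCell x z}
    {θ : s.comp r ⟶ m} (h : ∃ e, θ = eqToHom e) : ∃ e, θ.laxBase = eqToHom e := by
  obtain ⟨e, rfl⟩ := h
  subst e
  exact ⟨rfl, rfl⟩

lemma TwoCell.exists_lax_eq {s : OneCell x y} {r : OneCell y z} {m : OneCell x z}
    {θ : s.comp r ⟶ m} (h : ∃ e, θ = eqToHom e) : ∃ e, θ.lax = eqToHom e := by
  obtain ⟨e, rfl⟩ := h
  subst e
  exact ⟨_, eqToHom_trans (K.tensor_push_eq_mul (𝟙 (s.base ≫ r.base)) r.fib s.fib).symm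
    (K.push_id_obj _)⟩

lemma OneCell.eq_id {f : x.base ⟶ x.base} {p : K.F f} {α : (K.act f).obj (x.fib, p) ⟶ x.fib}
    (h : (⟨f, p⟩ : Σ f : x.base ⟶ x.base, K.F f) = ⟨𝟙 _, K.unit _⟩) (hα : ∃ e, α = eqToHom e) :
    (⟨f, p, α⟩ : OneCell x x) = OneCell.id x := by
  cases h
  obtain ⟨e, rfl⟩ := hα
  rfl

variable [Bicategory.Strict C]

/-- The associator of the 2-category of `K` is an identity, and so is the 2-cell `TwoCell.assoc`. -/
lemma associator_comp_eq {x y z t : CatEnriched K.Vertex} (s : x ⟶ y) (r : y ⟶ z) (q : z ⟶ t)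
    {m : x ⟶ t} (f : s ≫ r ≫ q ⟶ m) :
    (Bicategory.associator s r q).hom ≫ f =
      (OneCell.category (K := K) x t).comp
        (TwoCell.assoc (K := K) (x := x) (y := y) (z := z) (t := t) s r q) f :=
  congrArg (· ≫ f)
    (TwoCell.assoc_eq (K := K) (x := x) (y := y) (z := z) (t := t) s r q).choose_spec.symm

variable {n : ℕ}

/-- The vertices of a simplex of the nerve of the 2-category of `K`. -/
def vert (N : NerveSimplex (CatEnriched K.Vertex) n) (i : Fin (n + 1)) : K.Vertex :=
  N.obj i

/-- The 1-cells of a simplex of the nerve of the 2-category of `K`. -/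
def oneCell (N : NerveSimplex (CatEnriched K.Vertex) n) {i j : Fin (n + 1)} (h : i ≤ j) :
    OneCell (vert N i) (vert N j) :=
  N.hom h

/-- The 2-cells of a simplex of the nerve of the 2-category of `K`. -/
def twoCell (N : NerveSimplex (CatEnriched K.Vertex) n) {i j k : Fin (n + 1)} (h : i ≤ j)
    (h' : j ≤ k) : (oneCell N h).comp (oneCell N h') ⟶ oneCell N (h.trans h') :=
  N.comp h h'

variable (N : NerveSimplex (CatEnriched K.Vertex) n)

lemma oneCell_refl (i : Fin (n + 1)) : oneCell N (le_refl i) = OneCell.id (vert N i) :=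
  N.hom_refl i

lemma twoCell_refl_left {i k : Fin (n + 1)} (h : i ≤ k) :
    ∃ e, twoCell N (le_refl i) h = eqToHom e := by
  obtain ⟨e, he⟩ := leftUnitor_eq_eqToHom (N.hom_refl i) (N.hom h)
  exact ⟨e, (N.comp_refl_left h).trans he⟩

lemma twoCell_refl_right {i k : Fin (n + 1)} (h : i ≤ k) :
    ∃ e, twoCell N h (le_refl k) = eqToHom e := by
  obtain ⟨e, he⟩ := rightUnitor_eq_eqToHom (N.hom_refl k) (N.hom h)
  exact ⟨e, (N.comp_refl_right h).trans he⟩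

lemma twoCell_assoc {i j k l : Fin (n + 1)} (hij : i ≤ j) (hjk : j ≤ k) (hkl : k ≤ l) :
    TwoCell.hcomp (twoCell N hij hjk) (𝟙 (oneCell N hkl)) ≫ twoCell N (hij.trans hjk) hkl =
      TwoCell.assoc _ _ _ ≫ TwoCell.hcomp (𝟙 (oneCell N hij)) (twoCell N hjk hkl) ≫
        twoCell N hij (hjk.trans hkl) :=
  (N.comp_assoc hij hjk hkl).trans (associator_comp_eq _ _ _ _)

/-- The projection from the nerve of the 2-category of `K` to the nerve of `C`. -/
def proj : NerveSimplex C n where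
  obj i := (vert N i).base
  hom h := (oneCell N h).base
  comp h h' := (twoCell N h h').laxBase
  hom_refl i := congrArg OneCell.base (oneCell_refl N i)
  comp_refl_left {i k} h := by
    obtain ⟨e, he⟩ := TwoCell.exists_laxBase_eq (twoCell_refl_left N h)
    obtain ⟨e', he'⟩ := leftUnitor_eq_eqToHom (congrArg OneCell.base (oneCell_refl N i))
      (oneCell N h).base
    exact he.trans he'.symm
  comp_refl_right {i k} h := by
    obtain ⟨e, he⟩ := TwoCell.exists_laxBase_eq (twoCell_refl_right N h)
    obtain ⟨e', he'⟩ := rightUnitor_eq_eqToHom (congrArg OneCell.base (oneCell_refl N k))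
      (oneCell N h).base
    exact he.trans he'.symm
  comp_assoc hij hjk hkl := ((TwoCell.cocycle_iff _ _ _ _).1 (twoCell_assoc N hij hjk hkl)).1

lemma fib_refl (i : Fin (n + 1)) :
    (⟨_, (oneCell N (le_refl i)).fib⟩ :
        Σ f : (vert N i).base ⟶ (vert N i).base, K.F f) =
      ⟨𝟙 _, K.unit _⟩ := by
  rw [oneCell_refl]
  rfl

/-- The simplex of the nerve of the 2-category of `K` on a simplex of the nerve of `C` together with
the data in the fibres. -/
def simplexOfFibres (N : NerveSimplex C n) (a : ∀ i, K.E (N.obj i))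
    (p : ∀ {i j : Fin (n + 1)} (h : i ≤ j), K.F (N.hom h))
    (α : ∀ {i j : Fin (n + 1)} (h : i ≤ j), (K.act (N.hom h)).obj (a j, p h) ⟶ a i)
    (ξ : ∀ {i j k : Fin (n + 1)} (h : i ≤ j) (h' : j ≤ k),
      (K.mul (N.comp h h')).obj (p h', p h) ⟶ p (h.trans h'))
    (p_refl : ∀ i, (⟨_, p (le_refl i)⟩ : Σ f : N.obj i ⟶ N.obj i, K.F f) = ⟨𝟙 _, K.unit _⟩)
    (α_refl : ∀ i, ∃ e, α (le_refl i) = eqToHom e)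
    (ξ_refl_left : ∀ {i k : Fin (n + 1)} (h : i ≤ k), ∃ e, ξ (le_refl i) h = eqToHom e)
    (ξ_refl_right : ∀ {i k : Fin (n + 1)} (h : i ≤ k), ∃ e, ξ h (le_refl k) = eqToHom e)
    (comm : ∀ {i j k : Fin (n + 1)} (h : i ≤ j) (h' : j ≤ k), ∃ e,
      bimap (K.act (N.hom h)) (α h') (𝟙 (p h)) ≫ α h =
        eqToHom e ≫ bimap (K.act (N.hom (h.trans h'))) (𝟙 (a k)) (ξ h h') ≫ α (h.trans h'))
    (assoc : ∀ {i j k l : Fin (n + 1)} (h : i ≤ j) (h' : j ≤ k) (h'' : k ≤ l), ∃ e,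
      bimap (K.mul (N.comp h (h'.trans h''))) (ξ h' h'') (𝟙 (p h)) ≫ ξ h (h'.trans h'') =
        eqToHom e ≫ bimap (K.mul (N.comp (h.trans h') h'')) (𝟙 (p h'')) (ξ h h') ≫
          ξ (h.trans h') h'') :
    NerveSimplex (CatEnriched K.Vertex) n where
  obj i := (⟨N.obj i, a i⟩ : K.Vertex)
  hom {i j} h := (⟨N.hom h, p h, α h⟩ : OneCell (K := K) ⟨N.obj i, a i⟩ ⟨N.obj j, a j⟩)
  comp {i j k} h h' := TwoCell.ofLax
    (s := (⟨N.hom h, p h, α h⟩ : OneCell (K := K) ⟨N.obj i, a i⟩ ⟨N.obj j, a j⟩))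
    (r := (⟨N.hom h', p h', α h'⟩ : OneCell (K := K) ⟨N.obj j, a j⟩ ⟨N.obj k, a k⟩))
    (m := (⟨N.hom (h.trans h'), p (h.trans h'), α (h.trans h')⟩ :
      OneCell (K := K) ⟨N.obj i, a i⟩ ⟨N.obj k, a k⟩)) (N.comp h h') (ξ h h') (comm h h')
  hom_refl i := OneCell.eq_id (x := ⟨N.obj i, a i⟩) (p_refl i) (α_refl i)
  comp_refl_left {i k} h := by
    obtain ⟨e₁, h₁⟩ := ξ_refl_left h
    obtain ⟨e₂, h₂⟩ := leftUnitor_eq_eqToHom (N.hom_refl i) (N.hom h)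
    refine Eq.trans (TwoCell.eq_eqToHom _ ⟨e₂, (N.comp_refl_left h).trans h₂⟩
      ⟨(K.tensor_push_eq_mul _ _ _).trans e₁, ?_⟩).choose_spec
      (leftUnitor_eq_eqToHom (B := CatEnriched K.Vertex) _ _).choose_spec.symm
    exact (congrArg (eqToHom (K.tensor_push_eq_mul _ _ _) ≫ ·) h₁).trans (eqToHom_trans _ _)
  comp_refl_right {i k} h := by
    obtain ⟨e₁, h₁⟩ := ξ_refl_right h
    obtain ⟨e₂, h₂⟩ := rightUnitor_eq_eqToHom (N.hom_refl k) (N.hom h)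
    refine Eq.trans (TwoCell.eq_eqToHom _ ⟨e₂, (N.comp_refl_right h).trans h₂⟩
      ⟨(K.tensor_push_eq_mul _ _ _).trans e₁, ?_⟩).choose_spec
      (rightUnitor_eq_eqToHom (B := CatEnriched K.Vertex) _ _).choose_spec.symm
    exact (congrArg (eqToHom (K.tensor_push_eq_mul _ _ _) ≫ ·) h₁).trans (eqToHom_trans _ _)
  comp_assoc {i j k l} h h' h'' := by
    refine Eq.trans ?_ (associator_comp_eq (K := K) _ _ _ _).symm
    refine (TwoCell.cocycle_iff (x := ⟨N.obj i, a i⟩) (y := ⟨N.obj j, a j⟩) (z := ⟨N.obj k, a k⟩)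
      (t := ⟨N.obj l, a l⟩) (s := ⟨N.hom h, p h, α h⟩) (r := ⟨N.hom h', p h', α h'⟩)
      (q := ⟨N.hom h'', p h'', α h''⟩) (m := ⟨N.hom _, p _, α _⟩) (n := ⟨N.hom _, p _, α _⟩)
      (l := ⟨N.hom _, p _, α _⟩) (TwoCell.ofLax (N.comp _ _) (ξ h h') (comm h h'))
      (TwoCell.ofLax (N.comp _ _) (ξ _ h'') (comm _ h''))
      (TwoCell.ofLax (N.comp _ _) (ξ h' h'') (comm h' h''))
      (TwoCell.ofLax (N.comp _ _) (ξ h _) (comm h _))).2 ⟨N.comp_assoc h h' h'', ?_⟩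
    rw [TwoCell.ofLax_lax, TwoCell.ofLax_lax, TwoCell.ofLax_lax, TwoCell.ofLax_lax]
    exact assoc h h' h''

end Nerve
end Coefficients

/-! ### Faces of the simplices of `X` in terms of the nerve -/

section DecFaces

variable {X : SSet.{w}} {C : Type w} [Bicategory.{w, w} C] (φ : dec X ≅ duskinNerve C) {n : ℕ}

lemma castSucc_le {i j : Fin (n + 1)} (h : i ≤ j) : i.castSucc ≤ j.castSucc :=
  Fin.castSucc_le_castSucc_iff.2 h

/-- The edges of a simplex of `X` to its last vertex are the objects of the simplex of the nerve. -/
lemma edge_last_ofNerve (N : NerveSimplex C n) (i : Fin (n + 1)) :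
    edge (ofNerve φ N) (Fin.le_last i.castSucc) = obX φ (N.obj i) := by
  refine (map_ofNerve φ (SimplexCategory.const ⦋0⦌ ⦋n⦌ i) ?_ N).trans
    (congrArg _ (NerveSimplex.precomp_eq_point _ _ rfl))
  ext a : 3
  fin_cases a
  · exact (addTopMap_castSucc (SimplexCategory.const ⦋0⦌ ⦋n⦌ i).toOrderHom 0).symm
  · exact (addTopMap_last (SimplexCategory.const ⦋0⦌ ⦋n⦌ i).toOrderHom).symm

lemma face_last_ofNerve (N : NerveSimplex C n) {i j : Fin (n + 1)} (h : i ≤ j) :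
    face (ofNerve φ N) (castSucc_le h) (Fin.le_last j.castSucc) = arrX φ (N.hom h) := by
  refine (map_ofNerve φ (SimplexCategory.mkOfLe i j h) ?_ N).trans
    (congrArg _ (NerveSimplex.eq_arrow _))
  ext a : 3
  fin_cases a
  · exact (addTopMap_castSucc (SimplexCategory.mkOfLe i j h).toOrderHom 0).symm
  · exact (addTopMap_castSucc (SimplexCategory.mkOfLe i j h).toOrderHom 1).symm
  · exact (addTopMap_last (SimplexCategory.mkOfLe i j h).toOrderHom).symm

/-- The edges of a simplex of `X` away from its last vertex are the fibres of the 1-cells of the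
simplex of the nerve. -/
lemma edge_ofNerve (N : NerveSimplex C n) {i j : Fin (n + 1)} (h : i ≤ j) :
    edge (ofNerve φ N) (castSucc_le h) = fibX φ (N.hom h) := by
  rw [fibX, ← face_last_ofNerve φ N h]
  exact (isTri_face _ _ _).d2.symm

lemma face_ofNerve (N : NerveSimplex C n) {i j k : Fin (n + 1)} (h : i ≤ j) (h' : j ≤ k) :
    face (ofNerve φ N) (castSucc_le h) (castSucc_le h') = triX φ (N.comp h h') := by
  obtain ⟨g, hg⟩ : ∃ g : ⦋3⦌ ⟶ ⦋n + 1⦌, g = addTop.map (SimplexCategory.mkOfLeComp i j k h h') :=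
    ⟨_, rfl⟩
  have hN : laxX φ (N.comp h h') = X.map g.op (ofNerve φ N) :=
    ((map_ofNerve φ _ hg N).trans (congrArg _ (NerveSimplex.eq_triangle _))).symm
  have hδ : SimplexCategory.mkOfLeComp _ _ _ (castSucc_le h) (castSucc_le h') =
      SimplexCategory.δ 3 ≫ g := by
    subst hg
    ext a : 3
    fin_cases a
    · exact (addTopMap_castSucc (SimplexCategory.mkOfLeComp i j k h h').toOrderHom 0).symm
    · exact (addTopMap_castSucc (SimplexCategory.mkOfLeComp i j k h h').toOrderHom 1).symm
    · exact (addTopMap_castSucc (SimplexCategory.mkOfLeComp i j k h h').toOrderHom 2).symm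
  rw [triX, hN]
  simp only [face, hδ, op_comp, X.map_comp]
  rfl

end DecFaces

namespace Coefficients

variable {C : Type w} [Bicategory.{w, w} C] {K : Coefficients.{w, v, u} C} {x y z : K.Vertex}

lemma Vertex.ext_of_heq (h : x.base = y.base) (h' : HEq x.fib y.fib) : x = y := by
  cases x
  cases y
  cases h
  cases h'
  rfl

lemma OneCell.ext_of_heq {s r : OneCell x y} (h : s.base = r.base) (h' : HEq s.fib r.fib)
    (h'' : HEq s.str r.str) : s = r := by
  cases s
  cases r
  cases h
  cases h'
  cases h''
  rfl

lemma TwoCell.ext_of_lax {s : OneCell x y} {r : OneCell y z} {m : OneCell x z}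
    {θ κ : s.comp r ⟶ m} (h : θ.laxBase = κ.laxBase) (h' : HEq θ.lax κ.lax) : θ = κ := by
  rcases θ with ⟨σ, ξ, _⟩
  rcases κ with ⟨σ', ξ', _⟩
  obtain rfl : σ = σ' := h
  obtain rfl : ξ = ξ' :=
    (cancel_epi (eqToHom (K.tensor_push_eq_mul σ r.fib s.fib).symm)).1 (eq_of_heq h')
  rfl

lemma OneCell.str_of_eq_id {s : OneCell x x} (h : s = OneCell.id x) : ∃ e, s.str = eqToHom e := by
  subst h
  exact ⟨K.act_unit_obj _, rfl⟩

section Nerve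

variable [Bicategory.Strict C] {n : ℕ} {N N' : NerveSimplex (CatEnriched K.Vertex) n}

/-- A simplex of the nerve of the 2-category of `K` is determined by its projection to the nerve of
`C` and its components in the fibres. -/
lemma nerve_ext (hproj : proj N = proj N') (hv : ∀ i, HEq (vert N i).fib (vert N' i).fib)
    (hf : ∀ i j (h : i ≤ j), HEq (oneCell N h).fib (oneCell N' h).fib)
    (hs : ∀ i j (h : i ≤ j), HEq (oneCell N h).str (oneCell N' h).str)
    (hl : ∀ i j k (h : i ≤ j) (h' : j ≤ k), HEq (twoCell N h h').lax (twoCell N' h h').lax) :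
    N = N' := by
  have eq_obj : ∀ {S T : NerveSimplex C n}, S = T → ∀ i, S.obj i = T.obj i := by
    rintro S _ rfl _
    rfl
  have eq_hom : ∀ {S T : NerveSimplex C n}, S = T → ∀ i j (h : i ≤ j), HEq (S.hom h) (T.hom h) := by
    rintro S _ rfl _ _ _
    rfl
  have eq_comp : ∀ {S T : NerveSimplex C n}, S = T → ∀ i j k (h : i ≤ j) (h' : j ≤ k),
      HEq (S.comp h h') (T.comp h h') := by
    rintro S _ rfl _ _ _ _ _
    rfl
  have ho := eq_obj hproj
  have hh := eq_hom hproj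
  have hc := eq_comp hproj
  clear hproj eq_obj eq_hom eq_comp
  rcases N with ⟨o, f, c, h₁, h₂, h₃, h₄⟩
  rcases N' with ⟨o', f', c', h₁', h₂', h₃', h₄'⟩
  obtain rfl : o = o' := funext fun i => Vertex.ext_of_heq (K := K) (ho i) (hv i)
  obtain rfl : @f = @f' := by
    funext i j h
    exact OneCell.ext_of_heq (K := K) (eq_of_heq (hh i j h)) (hf i j h) (hs i j h)
  obtain rfl : @c = @c' := by
    funext i j k h h'
    exact TwoCell.ext_of_lax (K := K) (eq_of_heq (hc i j k h h')) (hl i j k h h')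
  rfl

end Nerve
end Coefficients

/-! ### The décalage of the Grothendieck construction -/

section Comparison

variable {X : SSet.{w}} {C : Type w} [Bicategory.{w, w} C] [Bicategory.Strict C]
  (φ : dec X ≅ duskinNerve C) (P : CatOperad.{w, v, u} X) {n : ℕ}

open Coefficients

/-- An `(n + 1)`-simplex of the Grothendieck construction and an `n`-simplex of the nerve of the
2-category of the coefficients of `P` correspond to each other if they have the same base and the
same components over the 2-dimensional faces: the face on `i, j` and the last vertex is the 1-cell
`i ⟶ j`, and the face on `i, j, k` is the lax triangle on `i, j, k`. The indices `a, b, c` are only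
assumed to be equal to those vertices, so that the relation is visibly stable under simplicial
operators. -/
structure Corresponds (S : TotalSimplex P (n + 1))
    (N : NerveSimplex (CatEnriched (coefficients φ P).Vertex) n) : Prop where
  base : S.base = ofNerve φ (proj N)
  face_last : ∀ {i j : Fin (n + 1)} (h : i ≤ j) {a b c : Fin (n + 2)} (hab : a ≤ b) (hbc : b ≤ c),
    a = i.castSucc → b = j.castSucc → c = Fin.last _ →
      S.HasFace hab hbc (isTri_arrX φ (oneCell N h).base) (b := (vert N j).fib)
        (p := (oneCell N h).fib) (c := (vert N i).fib) (oneCell N h).str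
  face : ∀ {i j k : Fin (n + 1)} (h : i ≤ j) (h' : j ≤ k) {a b c : Fin (n + 2)} (hab : a ≤ b)
    (hbc : b ≤ c), a = i.castSucc → b = j.castSucc → c = k.castSucc →
      S.HasFace hab hbc (isTri_triX φ (twoCell N h h').laxBase) (b := (oneCell N h').fib)
        (p := (oneCell N h).fib) (c := (oneCell N (h.trans h')).fib) (twoCell N h h').lax

variable {φ P} {S : TotalSimplex P (n + 1)}
  {N : NerveSimplex (CatEnriched (coefficients φ P).Vertex) n}

namespace Corresponds

/-- Identity 1-cells correspond to degenerate edges. -/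
lemma pt_refl_eq (hS : S.base = ofNerve φ (proj N)) (i : Fin (n + 1)) :
    S.pt (le_refl i.castSucc) =
      ⟨fibX φ (oneCell N (le_refl i)).base, (oneCell N (le_refl i)).fib⟩ := by
  refine (S.pt_refl _).trans ?_
  have h := congrArg (fun x => (⟨fibX φ x.1, x.2⟩ : Σ A, P.cat A)) (fib_refl N i)
  refine Eq.trans ?_ h.symm
  refine Eq.trans ?_ (exists_unit φ P _).choose_spec.symm
  have hv : vertex S.base i.castSucc = X.δ 1 (obX φ (vert N i).base) := by
    rw [vertex_eq_δ₁ S.base (Fin.le_last i.castSucc), hS, edge_last_ofNerve]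
    rfl
  rw [hv]

lemma str_refl (N : NerveSimplex (CatEnriched (coefficients φ P).Vertex) n) (i : Fin (n + 1)) :
    ∃ e, (oneCell N (le_refl i)).str = eqToHom e :=
  OneCell.str_of_eq_id (oneCell_refl N i)

/-- It is enough to compare the faces on strictly increasing vertices. -/
lemma of_lt (hbase : S.base = ofNerve φ (proj N))
    (pt_last : ∀ i : Fin (n + 1), S.pt (Fin.le_last i.castSucc) =
      ⟨obX φ (vert N i).base, (vert N i).fib⟩)
    (face_last : ∀ {i j : Fin (n + 1)} (h : i < j),
      S.HasFace (castSucc_le h.le) (Fin.le_last j.castSucc)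
        (isTri_arrX φ (oneCell N h.le).base) (b := (vert N j).fib)
        (p := (oneCell N h.le).fib) (c := (vert N i).fib) (oneCell N h.le).str)
    (face : ∀ {i j k : Fin (n + 1)} (h : i < j) (h' : j < k),
      S.HasFace (castSucc_le h.le) (castSucc_le h'.le)
        (isTri_triX φ (twoCell N h.le h'.le).laxBase)
        (b := (oneCell N h'.le).fib) (p := (oneCell N h.le).fib)
        (c := (oneCell N (h.le.trans h'.le)).fib) (twoCell N h.le h'.le).lax) :
    Corresponds φ P S N where
  base := hbase
  face_last {i j} h a b c hab hbc := by
    rintro rfl rfl rfl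
    rcases h.eq_or_lt with rfl | h
    · obtain ⟨α, hα⟩ := TotalSimplex.exists_hasFace (S := S) (hij := hab) (hjk := hbc)
        (isTri_arrX φ (oneCell N (le_refl i)).base)
        (by rw [hbase]; exact (face_last_ofNerve φ (proj N) (le_refl i)).symm)
        (pt_last i) (pt_refl_eq hbase i) (pt_last i)
      obtain ⟨e, rfl⟩ := hα.refl_left
      obtain ⟨e', he'⟩ := str_refl N i
      rw [he']
      exact hα
    · exact face_last h
  face {i j k} h h' a b c hab hbc := by
    rintro rfl rfl rfl
    have pt : ∀ {i j : Fin (n + 1)} (h : i ≤ j), S.pt (castSucc_le h) =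
        ⟨fibX φ (oneCell N h).base, (oneCell N h).fib⟩ := by
      intro i j h
      rcases h.eq_or_lt with rfl | h
      · exact pt_refl_eq hbase i
      · exact (face_last h).pt_ij
    by_cases hlt : i < j ∧ j < k
    · exact face hlt.1 hlt.2
    · obtain ⟨α, hα⟩ := TotalSimplex.exists_hasFace (S := S) (hij := hab) (hjk := hbc)
        (isTri_triX φ (twoCell N h h').laxBase)
        (by rw [hbase]; exact (face_ofNerve φ (proj N) h h').symm)
        (pt h') (pt h) (pt (h.trans h'))
      have key : α = (twoCell N h h').lax := by
        rcases h.eq_or_lt with rfl | h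
        · obtain ⟨e, rfl⟩ := hα.refl_left
          obtain ⟨e', he'⟩ := TwoCell.exists_lax_eq (twoCell_refl_left N h')
          exact he'.symm
        · rcases h'.eq_or_lt with rfl | h'
          · obtain ⟨e, rfl⟩ := hα.refl_right
            obtain ⟨e', he'⟩ := TwoCell.exists_lax_eq (twoCell_refl_right N h.le)
            exact he'.symm
          · exact absurd ⟨h, h'⟩ hlt
      rw [← key]
      exact hα

lemma pt_last (H : Corresponds φ P S N) (i : Fin (n + 1)) :
    S.pt (Fin.le_last i.castSucc) = ⟨obX φ (vert N i).base, (vert N i).fib⟩ :=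
  (H.face_last (le_refl i) le_rfl (Fin.le_last _) rfl rfl rfl).pt_jk

lemma pt_eq (H : Corresponds φ P S N) {i j : Fin (n + 1)} (h : i ≤ j) :
    S.pt (castSucc_le h) = ⟨fibX φ (oneCell N h).base, (oneCell N h).fib⟩ :=
  (H.face_last h (castSucc_le h) (Fin.le_last _) rfl rfl rfl).pt_ij

/-- The correspondence is compatible with the simplicial operators of the décalage. -/
lemma precomp (H : Corresponds φ P S N) {m : ℕ} (f : ⦋m⦌ ⟶ ⦋n⦌) :
    Corresponds φ P (S.precomp (addTop.map f)) (N.precomp f.toOrderHom) where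
  base := (congrArg (X.map (addTop.map f).op) H.base).trans (map_ofNerve φ f rfl (proj N))
  face_last {i j} h a b c hab hbc := by
    rintro rfl rfl rfl
    refine (TotalSimplex.hasFace_precomp_iff (addTop.map f)).2 ?_
    exact H.face_last (f.toOrderHom.monotone h) _ _ (addTopMap_castSucc f.toOrderHom i)
      (addTopMap_castSucc f.toOrderHom j) (addTopMap_last f.toOrderHom)
  face {i j k} h h' a b c hab hbc := by
    rintro rfl rfl rfl
    refine (TotalSimplex.hasFace_precomp_iff (addTop.map f)).2 ?_
    exact H.face (f.toOrderHom.monotone h) (f.toOrderHom.monotone h') _ _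
      (addTopMap_castSucc f.toOrderHom i) (addTopMap_castSucc f.toOrderHom j)
      (addTopMap_castSucc f.toOrderHom k)

lemma left_unique {T : TotalSimplex P (n + 1)} (H : Corresponds φ P S N)
    (H' : Corresponds φ P T N) : S = T := by
  refine TotalSimplex.ext_of_hasFace (H.base.trans H'.base.symm) (fun a b hab => ?_)
    (fun a b c hab hbc => ?_)
  · induction a using Fin.lastCases with
    | last => exact absurd hab (Fin.le_last b).not_gt
    | cast i =>
      induction b using Fin.lastCases with
      | last => exact (H.pt_last i).trans (H'.pt_last i).symm
      | cast j =>
        have h : i ≤ j := Fin.castSucc_le_castSucc_iff.1 hab.le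
        exact (H.pt_eq h).trans (H'.pt_eq h).symm
  · induction b using Fin.lastCases with
    | last => exact absurd hbc (Fin.le_last c).not_gt
    | cast j =>
      induction a using Fin.lastCases with
      | last => exact absurd hab (Fin.le_last _).not_gt
      | cast i =>
        have h : i ≤ j := Fin.castSucc_le_castSucc_iff.1 hab.le
        induction c using Fin.lastCases with
        | last => exact ⟨_, _, _, _, _, _, _, _, _, H.face_last h _ _ rfl rfl rfl,
            H'.face_last h _ _ rfl rfl rfl⟩
        | cast k =>
          have h' : j ≤ k := Fin.castSucc_le_castSucc_iff.1 hbc.le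
          exact ⟨_, _, _, _, _, _, _, _, _, H.face h h' _ _ rfl rfl rfl,
            H'.face h h' _ _ rfl rfl rfl⟩

lemma right_unique {N' : NerveSimplex (CatEnriched (coefficients φ P).Vertex) n}
    (H : Corresponds φ P S N) (H' : Corresponds φ P S N') : N = N' := by
  refine nerve_ext ?_ (fun i => ?_) (fun i j h => ?_) (fun i j h => ?_) (fun i j k h h' => ?_)
  · rw [← toNerve_ofNerve φ (proj N), ← H.base, H'.base, toNerve_ofNerve]
  · exact (Sigma.mk.inj_iff.1 ((H.pt_last i).symm.trans (H'.pt_last i))).2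
  · exact (Sigma.mk.inj_iff.1 ((H.pt_eq h).symm.trans (H'.pt_eq h))).2
  · have h₁ := H.face_last h (castSucc_le h) (Fin.le_last _) rfl rfl rfl
    have h₂ := H'.face_last h (castSucc_le h) (Fin.le_last _) rfl rfl rfl
    exact (h₁.comp _ rfl (S.isTri _ _)).symm.trans (h₂.comp _ rfl (S.isTri _ _))
  · have h₁ := H.face h h' (castSucc_le h) (castSucc_le h') rfl rfl rfl
    have h₂ := H'.face h h' (castSucc_le h) (castSucc_le h') rfl rfl rfl
    exact (h₁.comp _ rfl (S.isTri _ _)).symm.trans (h₂.comp _ rfl (S.isTri _ _))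

end Corresponds

end Comparison

section Existence

variable {X : SSet.{w}} {C : Type w} [Bicategory.{w, w} C] [Bicategory.Strict C]
  {φ : dec X ≅ duskinNerve C} {P : CatOperad.{w, v, u} X} {n : ℕ}

open Coefficients

lemma CatOperad.exists_eq_mk {x : Σ A, P.cat A} {A : X _⦋1⦌} (h : x.1 = A) :
    ∃ a : P.cat A, x = ⟨A, a⟩ := by
  subst h
  exact ⟨x.2, rfl⟩

lemma fib_eq_of_sigma_eq {A B : C} {f g : A ⟶ B} (e : f = g) {p : P.cat (fibX φ f)}
    {q : P.cat (fibX φ g)} (h : (⟨_, p⟩ : Σ A, P.cat A) = ⟨_, q⟩) :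
    (⟨f, p⟩ : Σ f : A ⟶ B, P.cat (fibX φ f)) = ⟨g, q⟩ := by
  subst e
  obtain rfl := eq_of_heq (Sigma.mk.inj_iff.1 h).2
  rfl

/-- Every simplex of the décalage of the Grothendieck construction comes from a simplex of the nerve
of the 2-category of the coefficients of `P`. -/
lemma TotalSimplex.exists_corresponds (S : TotalSimplex P (n + 1)) :
    ∃ N, Corresponds φ P S N := by
  obtain ⟨M, hM⟩ : ∃ M : NerveSimplex C n, S.base = ofNerve φ M :=
    ⟨_, (ofNerve_toNerve φ S.base).symm⟩
  have ha (i : Fin (n + 1)) : ∃ a : P.cat (obX φ (M.obj i)),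
      S.pt (Fin.le_last i.castSucc) = ⟨_, a⟩ :=
    CatOperad.exists_eq_mk (by rw [S.pt_fst, hM]; exact edge_last_ofNerve φ M i)
  choose a ha using ha
  have hp {i j : Fin (n + 1)} (h : i ≤ j) : ∃ p : P.cat (fibX φ (M.hom h)),
      S.pt (castSucc_le h) = ⟨_, p⟩ :=
    CatOperad.exists_eq_mk (by rw [S.pt_fst, hM]; exact edge_ofNerve φ M h)
  choose p hp using @hp
  have hα {i j : Fin (n + 1)} (h : i ≤ j) :=
    TotalSimplex.exists_hasFace (S := S) (hij := castSucc_le h) (hjk := Fin.le_last j.castSucc)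
      (isTri_arrX φ (M.hom h)) (by rw [hM]; exact (face_last_ofNerve φ M h).symm)
      (ha j) (hp h) (ha i)
  choose α hα using @hα
  have hξ {i j k : Fin (n + 1)} (h : i ≤ j) (h' : j ≤ k) :=
    TotalSimplex.exists_hasFace (S := S) (hij := castSucc_le h) (hjk := castSucc_le h')
      (isTri_triX φ (M.comp h h')) (by rw [hM]; exact (face_ofNerve φ M h h').symm)
      (hp h') (hp h) (hp (h.trans h'))
  choose ξ hξ using @hξ
  have p_refl (i : Fin (n + 1)) : (⟨_, p (le_refl i)⟩ : Σ f : M.obj i ⟶ M.obj i,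
      (coefficients φ P).F f) = ⟨𝟙 _, (coefficients φ P).unit _⟩ := by
    refine fib_eq_of_sigma_eq (M.hom_refl i) (((hp (le_refl i)).symm.trans (S.pt_refl _)).trans ?_)
    refine Eq.trans ?_ (exists_unit φ P _).choose_spec.symm
    rw [vertex_eq_δ₁ S.base (Fin.le_last i.castSucc), hM, edge_last_ofNerve]
  refine ⟨simplexOfFibres (K := coefficients φ P) M a p α ξ p_refl
    (fun i => (hα (le_refl i)).refl_left) (fun h => (hξ (le_refl _) h).refl_left)
    (fun h => (hξ h (le_refl _)).refl_right)
    (fun h h' => (hα h').cocycle (hα (h.trans h')) (hα h) (hξ h h'))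
    (fun h h' h'' => (hξ h' h'').cocycle (hξ (h.trans h') h'') (hξ h (h'.trans h'')) (hξ h h')), ?_⟩
  refine Corresponds.of_lt hM ha (fun h => hα h.le) (fun {i j k} h h' => ?_)
  have := TwoCell.ofLax_lax (K := coefficients φ P)
    (s := ⟨M.hom h.le, p h.le, α h.le⟩) (r := ⟨M.hom h'.le, p h'.le, α h'.le⟩)
    (m := ⟨M.hom (h.le.trans h'.le), p (h.le.trans h'.le), α (h.le.trans h'.le)⟩)
    (x := ⟨M.obj i, a i⟩) (y := ⟨M.obj j, a j⟩) (z := ⟨M.obj k, a k⟩)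
    (M.comp h.le h'.le) (ξ h.le h'.le)
    ((hα h'.le).cocycle (hα (h.le.trans h'.le)) (hα h.le) (hξ h.le h'.le))
  have H := hξ h.le h'.le
  rw [← this] at H
  exact H

lemma CatOperad.exists_heq_hom {B A D : X _⦋1⦌} {f f' : X _⦋2⦌} (t : IsTri f B A D)
    {b : P.cat B} {a : P.cat A} {d : P.cat D} (α : (P.mul f t).obj (b, a) ⟶ d)
    {x y z : Σ A, P.cat A} (hx : x = ⟨B, b⟩) (hy : y = ⟨A, a⟩) (hz : z = ⟨D, d⟩) (hf : f' = f)
    (t' : IsTri f' x.1 y.1 z.1) :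
    ∃ β : (P.mul f' t').obj (x.2, y.2) ⟶ z.2, HEq β α := by
  subst hx hy hz hf
  exact ⟨α, HEq.rfl⟩

/-- Transport of the cocycle condition along equalities of all the data. -/
lemma CatOperad.Cocycle.congr {f₀ f₁ f₂ f₃ g₀ g₁ g₂ g₃ : X _⦋2⦌}
    {A₀₁ A₁₂ A₂₃ A₀₂ A₁₃ A₀₃ : X _⦋1⦌}
    {h₀ : IsTri f₀ A₂₃ A₁₂ A₁₃} {h₁ : IsTri f₁ A₂₃ A₀₂ A₀₃}
    {h₂ : IsTri f₂ A₁₃ A₀₁ A₀₃} {h₃ : IsTri f₃ A₁₂ A₀₁ A₀₂}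
    {a₀₁ : P.cat A₀₁} {a₁₂ : P.cat A₁₂} {a₂₃ : P.cat A₂₃} {a₀₂ : P.cat A₀₂} {a₁₃ : P.cat A₁₃}
    {a₀₃ : P.cat A₀₃} {α₀ : (P.mul f₀ h₀).obj (a₂₃, a₁₂) ⟶ a₁₃}
    {α₁ : (P.mul f₁ h₁).obj (a₂₃, a₀₂) ⟶ a₀₃} {α₂ : (P.mul f₂ h₂).obj (a₁₃, a₀₁) ⟶ a₀₃}
    {α₃ : (P.mul f₃ h₃).obj (a₁₂, a₀₁) ⟶ a₀₂} (H : P.Cocycle h₀ h₁ h₂ h₃ α₀ α₁ α₂ α₃)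
    {x₀₁ x₁₂ x₂₃ x₀₂ x₁₃ x₀₃ : Σ A, P.cat A} (e₀₁ : x₀₁ = ⟨A₀₁, a₀₁⟩) (e₁₂ : x₁₂ = ⟨A₁₂, a₁₂⟩)
    (e₂₃ : x₂₃ = ⟨A₂₃, a₂₃⟩) (e₀₂ : x₀₂ = ⟨A₀₂, a₀₂⟩) (e₁₃ : x₁₃ = ⟨A₁₃, a₁₃⟩)
    (e₀₃ : x₀₃ = ⟨A₀₃, a₀₃⟩) {r₀ : IsTri g₀ x₂₃.1 x₁₂.1 x₁₃.1} {r₁ : IsTri g₁ x₂₃.1 x₀₂.1 x₀₃.1}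
    {r₂ : IsTri g₂ x₁₃.1 x₀₁.1 x₀₃.1} {r₃ : IsTri g₃ x₁₂.1 x₀₁.1 x₀₂.1}
    {β₀ : (P.mul g₀ r₀).obj (x₂₃.2, x₁₂.2) ⟶ x₁₃.2} {β₁ : (P.mul g₁ r₁).obj (x₂₃.2, x₀₂.2) ⟶ x₀₃.2}
    {β₂ : (P.mul g₂ r₂).obj (x₁₃.2, x₀₁.2) ⟶ x₀₃.2} {β₃ : (P.mul g₃ r₃).obj (x₁₂.2, x₀₁.2) ⟶ x₀₂.2}
    (d₀ : g₀ = f₀) (d₁ : g₁ = f₁) (d₂ : g₂ = f₂) (d₃ : g₃ = f₃) (hβ₀ : HEq β₀ α₀) (hβ₁ : HEq β₁ α₁)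
    (hβ₂ : HEq β₂ α₂) (hβ₃ : HEq β₃ α₃) : P.Cocycle r₀ r₁ r₂ r₃ β₀ β₁ β₂ β₃ := by
  subst e₀₁ e₁₂ e₂₃ e₀₂ e₁₃ e₀₃ d₀ d₁ d₂ d₃
  cases hβ₀
  cases hβ₁
  cases hβ₂
  cases hβ₃
  exact H

end Existence

section DecIso

variable {X : SSet.{w}} {C : Type w} [Bicategory.{w, w} C] [Bicategory.Strict C]
  {φ : dec X ≅ duskinNerve C} {P : CatOperad.{w, v, u} X} {n : ℕ}

open Coefficients

/-- Every simplex of the nerve of the 2-category of the coefficients of `P` comes from a simplex of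
the décalage of the Grothendieck construction. -/
lemma exists_corresponds_of_nerve (N : NerveSimplex (CatEnriched (coefficients φ P).Vertex) n) :
    ∃ S, Corresponds φ P S N := by
  have castSucc_lt {i j : Fin (n + 1)} (h : i.castSucc < j.castSucc) : i < j :=
    Fin.castSucc_lt_castSucc_iff.1 h
  -- the objects over the edges
  have hpt (a b : Fin (n + 2)) (h : a < b) : ∃ x : Σ A, P.cat A,
      (∀ i j (hij : i ≤ j), a = i.castSucc → b = j.castSucc →
        x = ⟨fibX φ (oneCell N hij).base, (oneCell N hij).fib⟩) ∧
      (∀ i : Fin (n + 1), a = i.castSucc → b = Fin.last _ →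
        x = ⟨obX φ (vert N i).base, (vert N i).fib⟩) := by
    induction a using Fin.lastCases with
    | last => exact absurd h (Fin.le_last b).not_gt
    | cast i =>
      induction b using Fin.lastCases with
      | last =>
        refine ⟨⟨_, (vert N i).fib⟩, fun _ j _ _ e => absurd e.symm j.castSucc_ne_last,
          fun i' e _ => ?_⟩
        obtain rfl := Fin.castSucc_injective _ e
        rfl
      | cast j =>
        refine ⟨⟨_, (oneCell N (castSucc_lt h).le).fib⟩, fun i' j' _ e e' => ?_,
          fun _ _ e => absurd e j.castSucc_ne_last⟩
        obtain rfl := Fin.castSucc_injective _ e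
        obtain rfl := Fin.castSucc_injective _ e'
        rfl
  choose pt pt_cast pt_last using hpt
  have hq {i j : Fin (n + 1)} (h : i < j) (h' : i.castSucc < j.castSucc) :
      pt i.castSucc j.castSucc h' = ⟨fibX φ (oneCell N h.le).base, (oneCell N h.le).fib⟩ :=
    pt_cast _ _ _ _ _ h.le rfl rfl
  have hq_last (i : Fin (n + 1)) (h : i.castSucc < Fin.last _) :
      pt i.castSucc (Fin.last _) h = ⟨obX φ (vert N i).base, (vert N i).fib⟩ :=
    pt_last _ _ _ _ rfl rfl
  -- the morphisms over the triangles
  have hcomp (a b c : Fin (n + 2)) (h : a < b) (h' : b < c) (f : X _⦋2⦌)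
      (hf : f = face (ofNerve φ (proj N)) h.le h'.le)
      (t : IsTri f (pt b c h').1 (pt a b h).1 (pt a c (h.trans h')).1) :
      ∃ α : (P.mul f t).obj ((pt b c h').2, (pt a b h).2) ⟶ (pt a c (h.trans h')).2,
        (∀ i j (hij : i ≤ j), a = i.castSucc → b = j.castSucc → c = Fin.last _ →
          HEq α (oneCell N hij).str) ∧
        (∀ i j k (hij : i ≤ j) (hjk : j ≤ k), a = i.castSucc → b = j.castSucc → c = k.castSucc →
          HEq α (twoCell N hij hjk).lax) := by
    induction b using Fin.lastCases with
    | last => exact absurd h' (Fin.le_last c).not_gt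
    | cast j =>
      induction a using Fin.lastCases with
      | last => exact absurd h (Fin.le_last _).not_gt
      | cast i =>
        have l := castSucc_lt h
        induction c using Fin.lastCases with
        | last =>
          obtain ⟨α, hα⟩ := P.exists_heq_hom (isTri_arrX φ (oneCell N l.le).base)
            (b := (vert N j).fib) (a := (oneCell N l.le).fib) (d := (vert N i).fib)
            (oneCell N l.le).str (hq_last j h') (hq l h) (hq_last i (h.trans h'))
            (hf.trans (face_last_ofNerve φ (proj N) l.le)) t
          refine ⟨α, fun i' j' _ e e' _ => ?_,
            fun _ _ k _ _ _ _ e => absurd e.symm k.castSucc_ne_last⟩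
          obtain rfl := Fin.castSucc_injective _ e
          obtain rfl := Fin.castSucc_injective _ e'
          exact hα
        | cast k =>
          have l' := castSucc_lt h'
          obtain ⟨α, hα⟩ := P.exists_heq_hom (isTri_triX φ (twoCell N l.le l'.le).laxBase)
            (b := (oneCell N l'.le).fib) (a := (oneCell N l.le).fib)
            (d := (oneCell N (l.le.trans l'.le)).fib)
            (twoCell N l.le l'.le).lax (hq l' h') (hq l h) (hq (l.trans l') (h.trans h'))
            (hf.trans (face_ofNerve φ (proj N) l.le l'.le)) t
          refine ⟨α, fun _ _ _ _ _ e => absurd e k.castSucc_ne_last,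
            fun i' j' k' _ _ e e' e'' => ?_⟩
          obtain rfl := Fin.castSucc_injective _ e
          obtain rfl := Fin.castSucc_injective _ e'
          obtain rfl := Fin.castSucc_injective _ e''
          exact hα
  choose comp comp_last comp_cast using hcomp
  obtain ⟨S, hS, hSpt, hScomp⟩ := TotalSimplex.exists_of_lt (P := P) (ofNerve φ (proj N)) pt
    (fun a b h => by
      induction a using Fin.lastCases with
      | last => exact absurd h (Fin.le_last b).not_gt
      | cast i =>
        induction b using Fin.lastCases with
        | last =>
          rw [hq_last]
          exact (edge_last_ofNerve φ (proj N) i).symm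
        | cast j =>
          rw [hq (castSucc_lt h)]
          exact (edge_ofNerve φ (proj N) (castSucc_lt h).le).symm)
    comp
    (fun a b c d h h' h'' f₀ f₁ f₂ f₃ hf₀ hf₁ hf₂ hf₃ t₀ t₁ t₂ t₃ => by
      induction c using Fin.lastCases with
      | last => exact absurd h'' (Fin.le_last d).not_gt
      | cast k =>
        induction b using Fin.lastCases with
        | last => exact absurd h' (Fin.le_last _).not_gt
        | cast j =>
          induction a using Fin.lastCases with
          | last => exact absurd h (Fin.le_last _).not_gt
          | cast i =>
            have l := castSucc_lt h
            have l' := castSucc_lt h'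
            induction d using Fin.lastCases with
            | last =>
              -- a tetrahedron with the last vertex: the condition on the 2-cell on `i, j, k`
              have H : P.Cocycle (isTri_arrX φ (oneCell N l'.le).base)
                  (isTri_arrX φ (oneCell N (l.le.trans l'.le)).base)
                  (isTri_arrX φ (oneCell N l.le).base)
                  (isTri_triX φ (twoCell N l.le l'.le).laxBase)
                  (a₀₁ := (oneCell N l.le).fib) (a₁₂ := (oneCell N l'.le).fib)
                  (a₂₃ := (vert N k).fib) (a₀₂ := (oneCell N (l.le.trans l'.le)).fib)
                  (a₁₃ := (vert N j).fib) (a₀₃ := (vert N i).fib)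
                  (oneCell N l'.le).str (oneCell N (l.le.trans l'.le)).str (oneCell N l.le).str
                  (twoCell N l.le l'.le).lax :=
                (twoCell N l.le l'.le).lax_comm
              exact H.congr (hq l h) (hq l' h') (hq_last k h'') (hq (l.trans l') _)
                (hq_last j _) (hq_last i _) (hf₀.trans (face_last_ofNerve φ (proj N) l'.le))
                (hf₁.trans (face_last_ofNerve φ (proj N) (l.le.trans l'.le)))
                (hf₂.trans (face_last_ofNerve φ (proj N) l.le))
                (hf₃.trans (face_ofNerve φ (proj N) l.le l'.le))
                (comp_last _ _ _ _ _ _ _ _ _ _ l'.le rfl rfl rfl)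
                (comp_last _ _ _ _ _ _ _ _ _ _ (l.le.trans l'.le) rfl rfl rfl)
                (comp_last _ _ _ _ _ _ _ _ _ _ l.le rfl rfl rfl)
                (comp_cast _ _ _ _ _ _ _ _ _ _ _ l.le l'.le rfl rfl rfl)
            | cast m =>
              -- a tetrahedron without the last vertex: the cocycle condition in the 2-category
              have l'' := castSucc_lt h''
              have H : P.Cocycle (isTri_triX φ (twoCell N l'.le l''.le).laxBase)
                  (isTri_triX φ (twoCell N (l.le.trans l'.le) l''.le).laxBase)
                  (isTri_triX φ (twoCell N l.le (l'.le.trans l''.le)).laxBase)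
                  (isTri_triX φ (twoCell N l.le l'.le).laxBase)
                  (a₀₁ := (oneCell N l.le).fib) (a₁₂ := (oneCell N l'.le).fib)
                  (a₂₃ := (oneCell N l''.le).fib) (a₀₂ := (oneCell N (l.le.trans l'.le)).fib)
                  (a₁₃ := (oneCell N (l'.le.trans l''.le)).fib)
                  (a₀₃ := (oneCell N (l.le.trans (l'.le.trans l''.le))).fib)
                  (twoCell N l'.le l''.le).lax (twoCell N (l.le.trans l'.le) l''.le).lax
                  (twoCell N l.le (l'.le.trans l''.le)).lax (twoCell N l.le l'.le).lax :=
                ((TwoCell.cocycle_iff _ _ _ _).1 (twoCell_assoc N l.le l'.le l''.le)).2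
              exact H.congr (hq l h) (hq l' h') (hq l'' h'') (hq (l.trans l') _)
                (hq (l'.trans l'') _) (hq (l.trans (l'.trans l'')) _)
                (hf₀.trans (face_ofNerve φ (proj N) l'.le l''.le))
                (hf₁.trans (face_ofNerve φ (proj N) (l.le.trans l'.le) l''.le))
                (hf₂.trans (face_ofNerve φ (proj N) l.le (l'.le.trans l''.le)))
                (hf₃.trans (face_ofNerve φ (proj N) l.le l'.le))
                (comp_cast _ _ _ _ _ _ _ _ _ _ _ l'.le l''.le rfl rfl rfl)
                (comp_cast _ _ _ _ _ _ _ _ _ _ _ (l.le.trans l'.le) l''.le rfl rfl rfl)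
                (comp_cast _ _ _ _ _ _ _ _ _ _ _ l.le (l'.le.trans l''.le) rfl rfl rfl)
                (comp_cast _ _ _ _ _ _ _ _ _ _ _ l.le l'.le rfl rfl rfl))
  have S_pt {i j : Fin (n + 1)} (h : i < j) : S.pt (castSucc_le h.le) =
      ⟨fibX φ (oneCell N h.le).base, (oneCell N h.le).fib⟩ :=
    (hSpt i.castSucc j.castSucc h).trans (hq h _)
  have S_pt_last (i : Fin (n + 1)) : S.pt (Fin.le_last i.castSucc) =
      ⟨obX φ (vert N i).base, (vert N i).fib⟩ :=
    (hSpt i.castSucc _ i.castSucc_lt_last).trans (hq_last i _)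
  have pt_tri {a b c : Fin (n + 2)} (h : a < b) (h' : b < c) {f : X _⦋2⦌}
      (t : IsTri f (S.pt h'.le).1 (S.pt h.le).1 (S.pt (h.le.trans h'.le)).1) :
      IsTri f (pt b c h').1 (pt a b h).1 (pt a c (h.trans h')).1 := by
    rw [← hSpt, ← hSpt, ← hSpt]
    exact t
  refine ⟨S, Corresponds.of_lt hS S_pt_last (fun {i j} h => ?_) (fun {i j k} h h' => ?_)⟩
  · refine ⟨?_, S_pt_last j, S_pt h, S_pt_last i, fun f hf t => ?_⟩
    · rw [hS]
      exact (face_last_ofNerve φ (proj N) h.le).symm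
    · have h₁ : i.castSucc < j.castSucc := h
      have hf' := hf
      rw [hS] at hf'
      exact (hScomp _ _ _ h₁ j.castSucc_lt_last f hf hf' t
        (pt_tri h₁ j.castSucc_lt_last t)).trans (comp_last _ _ _ _ _ _ _ _ _ _ h.le rfl rfl rfl)
  · refine ⟨?_, S_pt h', S_pt h, S_pt (h.trans h'), fun f hf t => ?_⟩
    · rw [hS]
      exact (face_ofNerve φ (proj N) h.le h'.le).symm
    · have h₁ : i.castSucc < j.castSucc := h
      have h₂ : j.castSucc < k.castSucc := h'
      have hf' := hf
      rw [hS] at hf'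
      exact (hScomp _ _ _ h₁ h₂ f hf hf' t (pt_tri h₁ h₂ t)).trans
        (comp_cast _ _ _ _ _ _ _ _ _ _ _ h.le h'.le rfl rfl rfl)

variable (φ P)

/-- The simplices of the décalage of the Grothendieck construction are those of the nerve of the
2-category of the coefficients of `P`. -/
noncomputable def totalEquiv (n : ℕ) : TotalSimplex P (n + 1) ≃
    NerveSimplex (CatEnriched (coefficients φ P).Vertex) n where
  toFun S := (S.exists_corresponds (φ := φ)).choose
  invFun N := (exists_corresponds_of_nerve N).choose
  left_inv S := Corresponds.left_unique (exists_corresponds_of_nerve _).choose_spec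
    (S.exists_corresponds (φ := φ)).choose_spec
  right_inv N := Corresponds.right_unique (TotalSimplex.exists_corresponds _).choose_spec
    (exists_corresponds_of_nerve N).choose_spec

lemma corresponds_totalEquiv (S : TotalSimplex P (n + 1)) :
    Corresponds φ P S (totalEquiv φ P n S) :=
  (S.exists_corresponds (φ := φ)).choose_spec

end DecIso

section Nerve

variable {X : SSet.{max w v u}} {C : Type max w v u} [Bicategory.{max w v u, max w v u} C]
  [Bicategory.Strict C] (φ : dec X ≅ duskinNerve C) (P : CatOperad.{max w v u, v, u} X)

/-- The décalage of the Grothendieck construction is the nerve of the 2-category of the coefficients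
of `P`. -/
noncomputable def decTotalIso :
    dec (total P) ≅ duskinNerve (CatEnriched (coefficients φ P).Vertex) :=
  NatIso.ofComponents (fun n => (totalEquiv φ P n.unop.len).toIso) (fun {n m} f => by
    ext S
    exact Corresponds.right_unique (corresponds_totalEquiv φ P _)
      ((corresponds_totalEquiv φ P S).precomp f.unop))

/-- The unary operadic 2-category `∫ P`: its simplicial set is the Grothendieck construction, and
its 2-category is that of the coefficients of `P`. -/
noncomputable def totalUOpCat (O : UOpCat.{max w v u}) (P : CatOperad.{max w v u, v, u} O.X) :
    UOpCat.{max w v u} :=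
  letI := O.bicategory
  letI := O.strict
  { X := total P
    C := CatEnriched (coefficients O.decIso P).Vertex
    decIso := decTotalIso O.decIso P }

end Nerve

end OperadicGrothendieck

namespace OperadicGrothendieck

/-! ### The functor into operadic functors with codomain `O` -/

/-- The operadic Grothendieck construction as a functor to operadic functors with codomain `O`. -/
noncomputable def grothendieckUOpCat (O : UOpCat.{max w v u}) :
    CatOperad.{max w v u, v, u} O.X ⥤ Over O where
  obj P := Over.mk (Y := totalUOpCat.{w, v, u} O P)
    ⟨((grothendieck.{w, v, u} O.X).obj P).hom⟩
  map F := Over.homMk ⟨((grothendieck.{w, v, u} O.X).map F).left⟩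
    (congrArg UOpCat.Hom.mk (Over.w ((grothendieck.{w, v, u} O.X).map F)))
  map_id P := Over.OverMorphism.ext (congrArg UOpCat.Hom.mk
    (congrArg CommaMorphism.left ((grothendieck.{w, v, u} O.X).map_id P)))
  map_comp F G := Over.OverMorphism.ext (congrArg UOpCat.Hom.mk
    (congrArg CommaMorphism.left ((grothendieck.{w, v, u} O.X).map_comp F G)))

/-- The functor to operadic functors lifts the functor to simplicial sets over the base. -/
noncomputable def grothendieckUOpCatIso (O : UOpCat.{max w v u}) :
    grothendieckUOpCat.{w, v, u} O ⋙ Over.post UOpCat.forget ≅ grothendieck.{w, v, u} O.X :=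
  NatIso.ofComponents (fun P => Over.isoMk (Iso.refl _) (Category.id_comp _)) (fun F => by
    refine Over.OverMorphism.ext ?_
    exact (Category.comp_id _).trans (Category.id_comp _).symm)

/-- Operadic functors are maps of the underlying simplicial sets, hence faithfulness and fullness
are those of the functor to simplicial sets over the base. -/
instance (O : UOpCat.{max w v u}) : (grothendieckUOpCat.{w, v, u} O).Faithful where
  map_injective {P Q F G} h := by
    have := grothendieck_faithful.{w, v, u} O.X
    refine (grothendieck.{w, v, u} O.X).map_injective (Over.OverMorphism.ext ?_)
    exact congrArg (fun k => UOpCat.Hom.toSSet (CommaMorphism.left k)) h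

instance (O : UOpCat.{max w v u}) : (grothendieckUOpCat.{w, v, u} O).Full where
  map_surjective {P Q} g := by
    have := grothendieck_full.{w, v, u} O.X
    obtain ⟨F, hF⟩ := (grothendieck.{w, v, u} O.X).map_surjective
      (Over.homMk (U := (grothendieck.{w, v, u} O.X).obj P)
        (V := (grothendieck.{w, v, u} O.X).obj Q) g.left.toSSet
        (congrArg UOpCat.Hom.toSSet (Over.w g)))
    refine ⟨F, Over.OverMorphism.ext ?_⟩
    exact congrArg
      (UOpCat.Hom.mk (O := totalUOpCat.{w, v, u} O P) (O' := totalUOpCat.{w, v, u} O Q))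
      (congrArg CommaMorphism.left hF)

section StrictMonoidal

open MonoidalCategory Functor.LaxMonoidal

/-! ### Strict monoidal categories -/

/-- There is a unique operadic functor to the terminal unary operadic 2-category. -/
instance (O : UOpCat.{w}) : Subsingleton (O ⟶ UOpCat.terminal.{w}) where
  allEq f g := congrArg UOpCat.Hom.mk (by
    ext n x
    rfl)

/-- Over the terminal unary operadic 2-category, every operadic functor is a functor over the
base. -/
instance : (grothendieckUOpCat.{w, v, u} UOpCat.terminal ⋙ Over.forget _).Full where
  map_surjective {P Q} g := by
    obtain ⟨F, hF⟩ := (grothendieckUOpCat.{w, v, u} UOpCat.terminal).map_surjective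
      (Over.homMk (U := (grothendieckUOpCat.{w, v, u} UOpCat.terminal).obj P)
        (V := (grothendieckUOpCat.{w, v, u} UOpCat.terminal).obj Q) g (Subsingleton.elim _ _))
    exact ⟨F, congrArg CommaMorphism.left hF⟩

instance : (grothendieckUOpCat.{w, v, u} UOpCat.terminal ⋙ Over.forget _).Faithful :=
  inferInstance

section Full

variable {V W : StrMonCat.{v, u}} (G : V.operad.{w} ⟶ W.operad.{w})

lemma isTri_terminal (f B A C) : IsTri (X := UOpCat.terminal.{w}.X) f B A C := ⟨rfl, rfl, rfl⟩

/-- The functor underlying a morphism of operads over the terminal unary operadic 2-category. -/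
def operadFunctor : V.V ⥤ W.V := CatOperad.Hom.app G PUnit.unit

lemma operadFunctor_unit : 𝟙_ W.V = (operadFunctor G).obj (𝟙_ V.V) :=
  (CatOperad.Hom.app_unit G PUnit.unit).symm

/-- The lax structure of a morphism of operads over the terminal unary operadic 2-category. -/
def operadMu (x y : V.V) :
    (operadFunctor G).obj x ⊗ (operadFunctor G).obj y ⟶ (operadFunctor G).obj (x ⊗ y) :=
  (CatOperad.Hom.lax G PUnit.unit (isTri_terminal _ PUnit.unit PUnit.unit PUnit.unit)).app (x, y)

lemma operadMu_natural {x x' y y' : V.V} (f : x ⟶ x') (g : y ⟶ y') :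
    ((operadFunctor G).map f ⊗ₘ (operadFunctor G).map g) ≫ operadMu G x' y' =
      operadMu G x y ≫ (operadFunctor G).map (f ⊗ₘ g) :=
  (CatOperad.Hom.lax G PUnit.unit (isTri_terminal _ PUnit.unit PUnit.unit PUnit.unit)).naturality
    (Prod.mkHom f g)

lemma operadMu_assoc (x y z : V.V) : ∃ e e',
    (operadMu G x y ⊗ₘ 𝟙 ((operadFunctor G).obj z)) ≫ operadMu G (x ⊗ y) z ≫ eqToHom e =
      eqToHom e' ≫ (𝟙 ((operadFunctor G).obj x) ⊗ₘ operadMu G y z) ≫ operadMu G x (y ⊗ z) :=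
  CatOperad.Hom.lax_assoc G PUnit.unit (isTri_terminal _ _ _ _) (isTri_terminal _ _ _ _)
    (isTri_terminal _ _ _ _) (isTri_terminal _ _ _ _) x y z

lemma operadMu_unit (x : V.V) : ∃ e, operadMu G x (𝟙_ V.V) = eqToHom e :=
  CatOperad.Hom.lax_mul_unit G (A := PUnit.unit) x

lemma operadMu_unit' (x : V.V) : ∃ e, operadMu G (𝟙_ V.V) x = eqToHom e :=
  CatOperad.Hom.lax_unit_mul G (A := PUnit.unit) x

/-- A morphism of operads over the terminal unary operadic 2-category is a lax monoidal functor. -/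
@[reducible]
def operadLaxMonoidal : (operadFunctor G).LaxMonoidal where
  ε := eqToHom (operadFunctor_unit G)
  μ := operadMu G
  μ_natural_left f y := by
    have := operadMu_natural G f (𝟙 y)
    simpa using this
  μ_natural_right x f := by
    have := operadMu_natural G (𝟙 x) f
    simpa using this
  associativity x y z := by
    obtain ⟨e, e', h⟩ := operadMu_assoc G x y z
    rw [V.strict.associator_eq, W.strict.associator_eq, eqToIso.hom, eqToIso.hom, eqToHom_map]
    simpa using h
  left_unitality x := by
    obtain ⟨e, h⟩ := operadMu_unit' G x
    rw [V.strict.leftUnitor_eq, W.strict.leftUnitor_eq, eqToIso.hom, eqToIso.hom, eqToHom_map, h,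
      eqToHom_whiskerRight, eqToHom_trans, eqToHom_trans]
  right_unitality x := by
    obtain ⟨e, h⟩ := operadMu_unit G x
    rw [V.strict.rightUnitor_eq, W.strict.rightUnitor_eq, eqToIso.hom, eqToIso.hom, eqToHom_map, h,
      whiskerLeft_eqToHom, eqToHom_trans, eqToHom_trans]

end Full

instance : StrMonCat.toOperad.{w, v, u}.Full where
  map_surjective {V W} G := by
    let := operadLaxMonoidal G
    exact ⟨⟨operadFunctor G, ⟨operadFunctor_unit G, rfl⟩⟩, rfl⟩

instance : StrMonCat.toOperad.{w, v, u}.Faithful where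
  map_injective {V W F G} h := by
    obtain ⟨F, hF⟩ := F
    obtain ⟨G, hG⟩ := G
    have h₁ : F = G := congrArg (fun k => operadFunctor.{w} k) h
    refine StrMonCat.Hom.ext' h₁ _ _ _ _ fun x y => ?_
    have key : ∀ {k l : V.operad.{w} ⟶ W.operad.{w}}, k = l →
        HEq (operadMu k x y) (operadMu l x y) := by
      rintro k _ rfl
      rfl
    exact key h

/-! ### The Grothendieck construction of a strict monoidal category -/

variable (V : StrMonCat.{v, u}) {n : ℕ}

/-- The simplex of `V^△` on a simplex of the Grothendieck construction of `V`. The data are the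
same; the constraints of `V` are identities, which turns the conditions of the one kind of simplex
into those of the other. -/
def triangleOfTotal (S : TotalSimplex V.operad.{w} n) : NerveSimplex (Deloop V.V) n where
  obj _ := .star
  hom h := (S.pt h).2
  comp h h' := S.comp h h' PUnit.unit rfl (isTri_terminal _ _ _ _)
  hom_refl i := congrArg (fun x : Σ A, V.operad.{w}.cat A => (x.2 : V.V)) (S.pt_refl i)
  comp_refl_left {i k} h := by
    obtain ⟨e, he⟩ := S.comp_refl_left h PUnit.unit rfl (isTri_terminal _ _ _ _)
    refine he.trans ?_
    have e₁ : ((S.pt (le_refl i)).2 : V.V) = 𝟙_ V.V :=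
      congrArg (fun x : Σ A, V.operad.{w}.cat A => (x.2 : V.V)) (S.pt_refl i)
    have : ∀ x y : V.V, ∀ (e : x = 𝟙_ V.V) (e' : y ⊗ x = y),
        eqToHom e' = y ◁ eqToHom e ≫ (ρ_ y).hom := by
      intro x y e e'
      rw [V.strict.rightUnitor_eq, eqToIso.hom, whiskerLeft_eqToHom, eqToHom_trans]
    exact this _ _ e₁ e
  comp_refl_right {i k} h := by
    obtain ⟨e, he⟩ := S.comp_refl_right h PUnit.unit rfl (isTri_terminal _ _ _ _)
    refine he.trans ?_
    have e₁ : ((S.pt (le_refl k)).2 : V.V) = 𝟙_ V.V :=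
      congrArg (fun x : Σ A, V.operad.{w}.cat A => (x.2 : V.V)) (S.pt_refl k)
    have : ∀ x y : V.V, ∀ (e : x = 𝟙_ V.V) (e' : x ⊗ y = y),
        eqToHom e' = eqToHom e ▷ y ≫ (λ_ y).hom := by
      intro x y e e'
      rw [V.strict.leftUnitor_eq, eqToIso.hom, eqToHom_whiskerRight, eqToHom_trans]
    exact this _ _ e₁ e
  comp_assoc {i j k l} h h' h'' := by
    obtain ⟨e, he⟩ := S.comp_assoc h h' h'' PUnit.unit PUnit.unit PUnit.unit PUnit.unit rfl rfl rfl
      rfl (isTri_terminal _ _ _ _) (isTri_terminal _ _ _ _) (isTri_terminal _ _ _ _)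
      (isTri_terminal _ _ _ _)
    have : ∀ {a b c x y z : V.V} (α₃ : b ⊗ a ⟶ x) (α₁ : c ⊗ x ⟶ z) (α₀ : c ⊗ b ⟶ y)
        (α₂ : y ⊗ a ⟶ z) (_ : ∃ e, (α₀ ⊗ₘ 𝟙 a) ≫ α₂ = eqToHom e ≫ (𝟙 c ⊗ₘ α₃) ≫ α₁),
        c ◁ α₃ ≫ α₁ = (α_ c b a).inv ≫ α₀ ▷ a ≫ α₂ := by
      rintro a b c x y z α₃ α₁ α₀ α₂ ⟨e, h⟩
      rw [V.strict.associator_eq, eqToIso.inv, ← tensorHom_id, h, id_tensorHom]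
      simp
    exact this _ _ _ _ ⟨e, he⟩

/-- The simplex of the Grothendieck construction of `V` on a simplex of `V^△`. -/
def totalOfTriangle (N : NerveSimplex (Deloop V.V) n) : TotalSimplex V.operad.{w} n where
  base := PUnit.unit
  pt h := ⟨PUnit.unit, N.hom h⟩
  pt_fst _ := rfl
  comp h h' _ _ _ := N.comp h h'
  pt_refl i := congrArg (fun x : V.V => (⟨PUnit.unit, x⟩ : Σ A, V.operad.{w}.cat A)) (N.hom_refl i)
  comp_refl_left {i k} h _ _ _ := by
    have : ∀ {x y : V.V} (e : x = 𝟙_ V.V), ∃ e', y ◁ eqToHom e ≫ (ρ_ y).hom = eqToHom e' := by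
      intro x y e
      exact ⟨by rw [e, V.strict.tensor_unit],
        by rw [V.strict.rightUnitor_eq, eqToIso.hom, whiskerLeft_eqToHom, eqToHom_trans]⟩
    obtain ⟨e, he⟩ := this (x := N.hom (le_refl i)) (y := N.hom h) (N.hom_refl i)
    exact ⟨e, (N.comp_refl_left h).trans he⟩
  comp_refl_right {i k} h _ _ _ := by
    have : ∀ {x y : V.V} (e : x = 𝟙_ V.V), ∃ e', eqToHom e ▷ y ≫ (λ_ y).hom = eqToHom e' := by
      intro x y e
      exact ⟨by rw [e, V.strict.unit_tensor],
        by rw [V.strict.leftUnitor_eq, eqToIso.hom, eqToHom_whiskerRight, eqToHom_trans]⟩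
    obtain ⟨e, he⟩ := this (x := N.hom (le_refl k)) (y := N.hom h) (N.hom_refl k)
    exact ⟨e, (N.comp_refl_right h).trans he⟩
  comp_assoc {i j k l} h h' h'' _ _ _ _ _ _ _ _ _ _ _ _ := by
    have : ∀ {a b c x y z : V.V} (α₃ : b ⊗ a ⟶ x) (α₁ : c ⊗ x ⟶ z) (α₀ : c ⊗ b ⟶ y)
        (α₂ : y ⊗ a ⟶ z) (_ : c ◁ α₃ ≫ α₁ = (α_ c b a).inv ≫ α₀ ▷ a ≫ α₂),
        ∃ e, (α₀ ⊗ₘ 𝟙 a) ≫ α₂ = eqToHom e ≫ (𝟙 c ⊗ₘ α₃) ≫ α₁ := by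
      intro a b c x y z α₃ α₁ α₀ α₂ h
      rw [V.strict.associator_eq, eqToIso.inv] at h
      exact ⟨V.strict.tensor_assoc _ _ _, by rw [tensorHom_id, id_tensorHom, h]; simp⟩
    exact this (N.comp h h') (N.comp _ h'') (N.comp h' h'') (N.comp h _) (N.comp_assoc h h' h'')

/-- The Grothendieck construction of a strict monoidal category `V` is `V^△`. -/
def totalTriangleEquiv (n : ℕ) :
    TotalSimplex V.operad.{max w v u} n ≃ ULift.{w} (NerveSimplex (Deloop V.V) n) where
  toFun S := ⟨triangleOfTotal V S⟩
  invFun N := totalOfTriangle V N.down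
  left_inv _ := TotalSimplex.ext' rfl (fun _ => rfl) (fun _ _ _ _ _ _ _ => HEq.rfl)
  right_inv _ := congrArg ULift.up
    (NerveSimplex.deloop_ext (fun _ => rfl) (fun _ _ => HEq.rfl))

/-- The isomorphism of the Grothendieck construction of `V` with `V^△`, natural in `V`. -/
noncomputable def totalTriangleIso :
    (StrMonCat.toOperad.{max w v u, v, u} ⋙ grothendieckUOpCat.{w, v, u} UOpCat.terminal ⋙
      Over.forget _) ⋙ UOpCat.forget ≅ triangleFunctor.{v, u} ⋙ SSet.uliftFunctor.{w, max v u} :=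
  NatIso.ofComponents
    (fun V => NatIso.ofComponents (fun n => (totalTriangleEquiv V n.unop.len).toIso) (fun _ => rfl))
    (fun _ => rfl)

end StrictMonoidal

section Pullback

open MonoidalCategory Functor.LaxMonoidal

/-! ### Morphisms from tensor products in `1/Cat` -/

section PtHom

variable {B A D : Cat.{v, u}} {b : B} {a : A} {d : D}

/-- The morphism `(B, b) ⊗ (A, a) ⟶ (D, d)` of `1/Cat` on a functor `m : B × A ⥤ D` and a map
`m (b, a) ⟶ d`. -/
def ptHom (m : B ⊗ A ⟶ D) (α : m.toFunctor.obj (b, a) ⟶ d) :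
    (⟨B, b⟩ : PtCat.{v, u}) ⊗ ⟨A, a⟩ ⟶ ⟨D, d⟩ :=
  PtCat.Hom.mk (D := (⟨B, b⟩ : PtCat.{v, u}) ⊗ ⟨A, a⟩) m α

lemma castMul_heq {x y z : Cat.{v, u}} (hB : B = x) (hA : A = y) (hD : D = z) (m : x ⊗ y ⟶ z) :
    HEq (castMul hB hA hD m) m := by
  subst hB hA hD
  simp [castMul]

lemma PtCat.mk_eqToHom {D E : Cat.{v, u}} (e : D = E) (d : D) :
    (⟨E, (eqToHom e).toFunctor.obj d⟩ : PtCat.{v, u}) = ⟨D, d⟩ := by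
  subst e
  rfl

/-- A degenerate lax triangle of `1/Cat` is given by a degenerate functor and an identity. -/
lemma ptHom_right_unit {m : B ⊗ A ⟶ B} {α : m.toFunctor.obj (b, a) ⟶ b}
    (e : (⟨A, a⟩ : PtCat.{v, u}) = 𝟙_ PtCat) (hm : ∃ e', m = B ◁ eqToHom e' ≫ (ρ_ B).hom)
    (hα : ∃ e, α = eqToHom e) : ptHom m α = (⟨B, b⟩ : PtCat.{v, u}) ◁ eqToHom e ≫ (ρ_ _).hom := by
  obtain ⟨rfl, rfl⟩ := hm
  obtain ⟨e', rfl⟩ := hα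
  rcases a with ⟨⟨⟨⟩⟩⟩
  have : (⟨B, b⟩ : PtCat.{v, u}) ◁ eqToHom e = 𝟙 _ := MonoidalCategory.whiskerLeft_id _ _
  rw [this, Category.id_comp]
  refine PtCat.Hom.ext' ?_ ?_
  · exact (congrArg (· ≫ (ρ_ B).hom) (MonoidalCategory.whiskerLeft_id _ _)).trans
      (Category.id_comp _)
  · rfl

lemma ptHom_left_unit {m : B ⊗ A ⟶ A} {α : m.toFunctor.obj (b, a) ⟶ a}
    (e : (⟨B, b⟩ : PtCat.{v, u}) = 𝟙_ PtCat) (hm : ∃ e', m = eqToHom e' ▷ A ≫ (λ_ A).hom)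
    (hα : ∃ e, α = eqToHom e) : ptHom m α = eqToHom e ▷ (⟨A, a⟩ : PtCat.{v, u}) ≫ (λ_ _).hom := by
  obtain ⟨rfl, rfl⟩ := hm
  obtain ⟨e', rfl⟩ := hα
  rcases b with ⟨⟨⟨⟩⟩⟩
  have : eqToHom e ▷ (⟨A, a⟩ : PtCat.{v, u}) = 𝟙 _ := MonoidalCategory.id_whiskerRight _ _
  rw [this, Category.id_comp]
  refine PtCat.Hom.ext' ?_ ?_
  · exact (congrArg (· ≫ (λ_ A).hom) (MonoidalCategory.id_whiskerRight _ _)).trans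
      (Category.id_comp _)
  · rfl

/-- Morphisms of `1/Cat` with the same functor are equal if their maps are equal up to the
identification of the sources. -/
lemma PtCat.Hom.eq_iff {D E : PtCat.{v, u}} {F G : D ⟶ E} (h : F.functor = G.functor) :
    F = G ↔ ∃ e, G.map = eqToHom e ≫ F.map := by
  constructor
  · rintro rfl
    exact ⟨rfl, (Category.id_comp _).symm⟩
  · rcases F with ⟨F, f⟩
    rcases G with ⟨G, g⟩
    obtain rfl : F = G := h
    rintro ⟨e, h'⟩
    exact congrArg (PtCat.Hom.mk F) (h'.trans (Category.id_comp f)).symm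

/-- Over four functors which satisfy the cocycle condition, the cocycle condition in `1/Cat` is
the cocycle condition for the maps between the points. -/
lemma ptHom_assoc_iff {A₀₁ A₁₂ A₂₃ A₀₂ A₁₃ A₀₃ : Cat.{v, u}} {a₀₁ : A₀₁} {a₁₂ : A₁₂} {a₂₃ : A₂₃}
    {a₀₂ : A₀₂} {a₁₃ : A₁₃} {a₀₃ : A₀₃} {m₀ : A₂₃ ⊗ A₁₂ ⟶ A₁₃} {m₁ : A₂₃ ⊗ A₀₂ ⟶ A₀₃}
    {m₂ : A₁₃ ⊗ A₀₁ ⟶ A₀₃} {m₃ : A₁₂ ⊗ A₀₁ ⟶ A₀₂}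
    (hm : m₀ ▷ A₀₁ ≫ m₂ = (α_ A₂₃ A₁₂ A₀₁).hom ≫ A₂₃ ◁ m₃ ≫ m₁)
    (α₀ : m₀.toFunctor.obj (a₂₃, a₁₂) ⟶ a₁₃) (α₁ : m₁.toFunctor.obj (a₂₃, a₀₂) ⟶ a₀₃)
    (α₂ : m₂.toFunctor.obj (a₁₃, a₀₁) ⟶ a₀₃) (α₃ : m₃.toFunctor.obj (a₁₂, a₀₁) ⟶ a₀₂) :
    (⟨A₂₃, a₂₃⟩ : PtCat.{v, u}) ◁ ptHom m₃ α₃ ≫ ptHom m₁ α₁ =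
      (α_ (⟨A₂₃, a₂₃⟩ : PtCat.{v, u}) ⟨A₁₂, a₁₂⟩ ⟨A₀₁, a₀₁⟩).inv ≫
        ptHom m₀ α₀ ▷ (⟨A₀₁, a₀₁⟩ : PtCat.{v, u}) ≫ ptHom m₂ α₂ ↔
    ∃ e, m₂.toFunctor.map (Prod.mkHom α₀ (𝟙 a₀₁)) ≫ α₂ =
      eqToHom e ≫ m₁.toFunctor.map (Prod.mkHom (𝟙 a₂₃) α₃) ≫ α₁ := by
  have h : A₂₃ ◁ m₃ ≫ m₁ = (α_ A₂₃ A₁₂ A₀₁).inv ≫ m₀ ▷ A₀₁ ≫ m₂ := by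
    rw [hm, Iso.inv_hom_id_assoc]
  refine (PtCat.Hom.eq_iff h).trans ?_
  have key : ((α_ (⟨A₂₃, a₂₃⟩ : PtCat.{v, u}) ⟨A₁₂, a₁₂⟩ ⟨A₀₁, a₀₁⟩).inv ≫
      ptHom m₀ α₀ ▷ (⟨A₀₁, a₀₁⟩ : PtCat.{v, u}) ≫ ptHom m₂ α₂).map =
        m₂.toFunctor.map (Prod.mkHom α₀ (𝟙 a₀₁)) ≫ α₂ := by
    refine (congrArg (· ≫ (ptHom m₀ α₀ ▷ (⟨A₀₁, a₀₁⟩ : PtCat.{v, u}) ≫ ptHom m₂ α₂).map)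
      (CategoryTheory.Functor.map_id (m₀ ▷ A₀₁ ≫ m₂).toFunctor ((a₂₃, a₁₂), a₀₁))).trans ?_
    exact Category.id_comp _
  rw [key]
  rfl

/-- A morphism of `1/Cat` is given by a map between points over any functor equal to its own. -/
lemma exists_ptHom_heq {x y z : PtCat.{v, u}} (G : x ⊗ y ⟶ z) (hx : (⟨B, b⟩ : PtCat.{v, u}) = x)
    (hy : (⟨A, a⟩ : PtCat.{v, u}) = y) (hz : (⟨D, d⟩ : PtCat.{v, u}) = z) (m : B ⊗ A ⟶ D)
    (hm : HEq m G.functor) : ∃ α : m.toFunctor.obj (b, a) ⟶ d, HEq (ptHom m α) G := by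
  subst hx hy hz
  obtain rfl := eq_of_heq hm
  exact ⟨G.map, HEq.rfl⟩

end PtHom

/-! ### The Grothendieck construction of a 1-connected operad -/

lemma NerveSimplex.hom_congr {V : Type u} [Category.{v} V] [MonoidalCategory V]
    {n : ℕ} {S T : NerveSimplex (Deloop V) n} (h : S = T) {i j : Fin (n + 1)} (hij : i ≤ j) :
    S.ob i j hij = T.ob i j hij := by
  rw [h]

lemma NerveSimplex.comp_congr {V : Type u} [Category.{v} V] [MonoidalCategory V]
    {n : ℕ} {S T : NerveSimplex (Deloop V) n} (h : S = T) {i j k : Fin (n + 1)} (hij : i ≤ j)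
    (hjk : j ≤ k) : HEq (S.mul i j k hij hjk) (T.mul i j k hij hjk) := by
  rw [h]

section OneConnected

variable {X : SSet.{max (u + 1) (v + 1)}} (p : X ⟶ triangle Cat.{v, u})

lemma catOf_edge {n : ℕ} (x : X _⦋n⦌) {i j : Fin (n + 1)} (h : i ≤ j) :
    catOf p (edge x h) = (simplexOf p x).ob i j h :=
  congrArg (fun S => S.ob 0 1 (by decide)) (simplexOf_map p (SimplexCategory.mkOfLe i j h) x)

/-- The products of the operad of `p` over a face of `x` are the components of the simplex `p x`. -/
lemma mulOf_heq {n : ℕ} (x : X _⦋n⦌) {i j k : Fin (n + 1)} (hij : i ≤ j) (hjk : j ≤ k)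
    {B A D : X _⦋1⦌} {f : X _⦋2⦌} (hf : f = face x hij hjk) (h : IsTri f B A D) :
    HEq (mulOf p f h) ((simplexOf p x).mul i j k hij hjk) := by
  obtain ⟨hB, hA, hD, e⟩ := mulOf_eq p x (SimplexCategory.mkOfLeComp i j k hij hjk) f h hf i j k
    hij hjk rfl rfl rfl
  rw [e]
  exact castMul_heq _ _ _ _

lemma mulOf_assoc {n : ℕ} (x : X _⦋n⦌) {i j k l : Fin (n + 1)} (hij : i ≤ j) (hjk : j ≤ k)
    (hkl : k ≤ l) {A₀₁ A₁₂ A₂₃ A₀₂ A₁₃ A₀₃ : X _⦋1⦌} {f₀ f₁ f₂ f₃ : X _⦋2⦌}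
    (e₀ : f₀ = face x hjk hkl) (e₁ : f₁ = face x (hij.trans hjk) hkl)
    (e₂ : f₂ = face x hij (hjk.trans hkl)) (e₃ : f₃ = face x hij hjk)
    (h₀ : IsTri f₀ A₂₃ A₁₂ A₁₃) (h₁ : IsTri f₁ A₂₃ A₀₂ A₀₃)
    (h₂ : IsTri f₂ A₁₃ A₀₁ A₀₃) (h₃ : IsTri f₃ A₁₂ A₀₁ A₀₂) :
    mulOf p f₀ h₀ ▷ catOf p A₀₁ ≫ mulOf p f₂ h₂ =
      (α_ (catOf p A₂₃) (catOf p A₁₂) (catOf p A₀₁)).hom ≫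
        catOf p A₂₃ ◁ mulOf p f₃ h₃ ≫ mulOf p f₁ h₁ := by
  obtain ⟨s, d₀, d₁, d₂, d₃⟩ := exists_tetra x hij hjk hkl
  exact Cat.Hom.ext ((CatOperad.ofTriangle p).assoc_of_eq s (d₀.symm.trans e₀.symm)
    (d₁.symm.trans e₁.symm) (d₂.symm.trans e₂.symm) (d₃.symm.trans e₃.symm) h₀ h₁ h₂ h₃)

lemma mulOf_face_left {n : ℕ} (x : X _⦋n⦌) {i k : Fin (n + 1)} (h : i ≤ k) {B A : X _⦋1⦌}
    (t : IsTri (face x (le_refl i) h) B A B) :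
    ∃ e, mulOf p _ t = catOf p B ◁ eqToHom e ≫ (ρ_ (catOf p B)).hom := by
  obtain ⟨hB, hA, hD, e⟩ := mulOf_eq p x (SimplexCategory.mkOfLeComp i i k le_rfl h) _ t rfl i i k
    le_rfl h rfl rfl rfl
  have key : ∀ {z y B A : Cat.{v, u}} (hB : B = z) (hA : A = y) (hD : B = z) (e : y = 𝟙_ Cat),
      castMul hB hA hD (z ◁ eqToHom e ≫ (ρ_ z).hom) =
        B ◁ eqToHom (hA.trans e) ≫ (ρ_ B).hom := by
    rintro z y _ _ rfl rfl _ rfl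
    simp [castMul]
  have hS : (simplexOf p x).mul i i k le_rfl h = (simplexOf p x).ob i k h ◁
      eqToHom ((simplexOf p x).hom_refl i) ≫ (ρ_ _).hom := (simplexOf p x).comp_refl_left h
  rw [hS] at e
  exact ⟨_, e.trans (key _ _ _ _)⟩

lemma mulOf_face_right {n : ℕ} (x : X _⦋n⦌) {i k : Fin (n + 1)} (h : i ≤ k) {B A : X _⦋1⦌}
    (t : IsTri (face x h (le_refl k)) B A A) :
    ∃ e, mulOf p _ t = eqToHom e ▷ catOf p A ≫ (λ_ (catOf p A)).hom := by
  obtain ⟨hB, hA, hD, e⟩ := mulOf_eq p x (SimplexCategory.mkOfLeComp i k k h le_rfl) _ t rfl i k k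
    h le_rfl rfl rfl rfl
  have key : ∀ {z y B A : Cat.{v, u}} (hB : B = z) (hA : A = y) (hD : A = y) (e : z = 𝟙_ Cat),
      castMul hB hA hD (eqToHom e ▷ y ≫ (λ_ y).hom) =
        eqToHom (hB.trans e) ▷ A ≫ (λ_ A).hom := by
    rintro z y _ _ rfl rfl _ rfl
    simp [castMul]
  have hS : (simplexOf p x).mul i k k h le_rfl =
      (eqToHom ((simplexOf p x).hom_refl k) : (simplexOf p x).ob k k le_rfl ⟶ 𝟙_ Cat) ▷
        (simplexOf p x).ob i k h ≫ (λ_ _).hom :=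
    (simplexOf p x).comp_refl_right h
  rw [hS] at e
  exact ⟨_, e.trans (key _ _ _ _)⟩

variable {p} {n : ℕ}

/-- The pointed category on an object of the fibre of the Grothendieck construction. -/
def ptOf (x : Σ A, (CatOperad.ofTriangle p).cat A) : PtCat.{v, u} :=
  ⟨catOf p x.1, x.2⟩

lemma ptOf_refl (S : TotalSimplex (CatOperad.ofTriangle p) n) (i : Fin (n + 1)) :
    ptOf (S.pt (le_refl i)) = 𝟙_ PtCat :=
  ((congrArg ptOf (S.pt_refl i)).trans (PtCat.mk_eqToHom (catOf_σ₀ p _) ⟨⟨⟨⟩⟩⟩))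

/-- The simplex of `(1/Cat)^△` on a simplex of the Grothendieck construction. -/
def pointedSimplex (S : TotalSimplex (CatOperad.ofTriangle p) n) :
    NerveSimplex (Deloop PtCat.{v, u}) n where
  obj _ := .star
  hom h := ptOf (S.pt h)
  comp h h' := ptHom (mulOf p _ (S.isTri h h')) (S.comp h h' _ rfl (S.isTri h h'))
  hom_refl i := ptOf_refl S i
  comp_refl_left {i k} h := ptHom_right_unit (ptOf_refl S i)
    (mulOf_face_left p S.base h (S.isTri (le_refl i) h)) (S.comp_refl_left h _ _ _)
  comp_refl_right {i k} h := ptHom_left_unit (ptOf_refl S k)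
    (mulOf_face_right p S.base h (S.isTri h (le_refl k))) (S.comp_refl_right h _ _ _)
  comp_assoc {i j k l} h h' h'' := by
    exact (ptHom_assoc_iff (mulOf_assoc p S.base h h' h'' rfl rfl rfl rfl _ _ _ _) _ _ _ _).2
      (S.comp_assoc h h' h'' _ _ _ _ rfl rfl rfl rfl _ _ _ _)

lemma pointedSimplex_comp (S : TotalSimplex (CatOperad.ofTriangle p) n) {i j k : Fin (n + 1)}
    (h : i ≤ j) (h' : j ≤ k) {f : X _⦋2⦌} (hf : f = face S.base h h')
    (t : IsTri f (S.pt h').1 (S.pt h).1 (S.pt (h.trans h')).1) :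
    HEq ((pointedSimplex S).comp h h') (ptHom (mulOf p f t) (S.comp h h' f hf t)) := by
  subst hf
  rfl

variable (p)

/-- The map from the Grothendieck construction of a 1-connected operad to `(1/Cat)^△`. -/
def totalToPointed : total (CatOperad.ofTriangle p) ⟶ triangle PtCat.{v, u} where
  app _ := ↾fun S => pointedSimplex S
  naturality {n m} f := by
    ext S
    refine NerveSimplex.deloop_ext (fun _ => rfl) fun {i j k} h h' => ?_
    exact (pointedSimplex_comp (S.precomp f.unop) h h' rfl _).trans
      (pointedSimplex_comp S (f.unop.toOrderHom.monotone h) (f.unop.toOrderHom.monotone h')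
        (face_map f.unop S.base h h') ((S.precomp f.unop).isTri h h')).symm

variable {p}

/-- The square of the Grothendieck construction and `(1/Cat)^△` commutes. -/
lemma triangleSimplexMap_pointedSimplex (S : TotalSimplex (CatOperad.ofTriangle p) n) :
    triangleSimplexMap PtCat.forget PtCat.forget_isNormal (pointedSimplex S) =
      simplexOf p S.base := by
  refine NerveSimplex.deloop_ext (fun {i j} h => ?_) fun {i j k} h h' => ?_
  · have := catOf_edge p S.base h
    rw [← S.pt_fst] at this
    exact this
  · refine HEq.trans (heq_of_eq ?_) (mulOf_heq p S.base h h' rfl (S.isTri h h'))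
    exact Category.id_comp (mulOf p _ (S.isTri h h'))

lemma PtCat.Hom.map_heq {D D' E E' : PtCat.{v, u}} (hD : D = D') (hE : E = E')
    {F : D ⟶ E} {F' : D' ⟶ E'} (h : HEq F F') : HEq F.map F'.map := by
  subst hD hE h
  rfl

lemma pointedSimplex_injective {S T : TotalSimplex (CatOperad.ofTriangle p) n}
    (hbase : S.base = T.base) (h : pointedSimplex S = pointedSimplex T) : S = T := by
  have hom {i j : Fin (n + 1)} (hij : i ≤ j) : ptOf (S.pt hij) = ptOf (T.pt hij) :=
    NerveSimplex.hom_congr h hij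
  refine TotalSimplex.ext' hbase (fun {i j} hij => ?_) (fun {i j k} hij hjk f hf hf' t t' => ?_)
  · refine Sigma.ext ?_ ?_
    · rw [S.pt_fst, T.pt_fst, hbase]
    · exact (PtCat.mk.inj (hom hij)).2
  · have h₁ := (pointedSimplex_comp S hij hjk hf t).symm.trans
      ((NerveSimplex.comp_congr h hij hjk).trans (pointedSimplex_comp T hij hjk hf' t'))
    exact PtCat.Hom.map_heq (congrArg₂ _ (hom hjk) (hom hij)) (hom (hij.trans hjk)) h₁

/-- A simplex of the base together with a lift of its image to `(1/Cat)^△` comes from a simplex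
of the Grothendieck construction. -/
lemma exists_pointedSimplex (x : X _⦋n⦌) (T : NerveSimplex (Deloop PtCat.{v, u}) n)
    (hT : triangleSimplexMap PtCat.forget PtCat.forget_isNormal T = simplexOf p x) :
    ∃ S : TotalSimplex (CatOperad.ofTriangle p) n, pointedSimplex S = T ∧ S.base = x := by
  -- the objects over the edges
  have hpt {i j : Fin (n + 1)} (h : i ≤ j) : ∃ a : (CatOperad.ofTriangle p).cat (edge x h),
      ptOf ⟨edge x h, a⟩ = T.ob i j h := by
    have e : catOf p (edge x h) = (T.ob i j h).cat :=
      (catOf_edge p x h).trans (NerveSimplex.hom_congr hT h).symm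
    have key : ∀ {D : Cat.{v, u}} {E : PtCat.{v, u}} (_ : D = E.cat), ∃ a : D,
        (⟨D, a⟩ : PtCat.{v, u}) = E := by
      rintro _ E rfl
      exact ⟨E.pt, rfl⟩
    exact key e
  choose a ha using @hpt
  -- the morphisms over the triangles
  have hcomp {i j k : Fin (n + 1)} (h : i ≤ j) (h' : j ≤ k) (f : X _⦋2⦌) (hf : f = face x h h')
      (t : IsTri f (edge x h') (edge x h) (edge x (h.trans h'))) :
      ∃ α : ((CatOperad.ofTriangle p).mul f t).obj (a h', a h) ⟶ a (h.trans h'),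
        HEq (ptHom (mulOf p f t) α) (T.mul i j k h h') := by
    refine exists_ptHom_heq (T.mul i j k h h') (ha h') (ha h) (ha (h.trans h')) (mulOf p f t) ?_
    refine (mulOf_heq p x h h' hf t).trans ((NerveSimplex.comp_congr hT h h').symm.trans ?_)
    exact heq_of_eq (Category.id_comp (T.mul i j k h h').functor)
  choose α hα using @hcomp
  obtain ⟨S, rfl, hS, hS'⟩ := TotalSimplex.exists_of_lt (P := CatOperad.ofTriangle p) x
    (fun i j h => ⟨edge x h.le, a h.le⟩) (fun _ _ _ => rfl)
    (fun i j k h h' f hf t => α h.le h'.le f hf t)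
    (fun i j k l h h' h'' f₀ f₁ f₂ f₃ hf₀ hf₁ hf₂ hf₃ t₀ t₁ t₂ t₃ => by
      refine (ptHom_assoc_iff (mulOf_assoc p x h.le h'.le h''.le hf₀ hf₁ hf₂ hf₃ t₀ t₁ t₂ t₃)
        _ _ _ _).1 ?_
      -- transport of the cocycle condition along equalities of all the data
      have key : ∀ {D₀₁ D₁₂ D₂₃ D₀₂ D₁₃ D₀₃ E₀₁ E₁₂ E₂₃ E₀₂ E₁₃ E₀₃ : PtCat.{v, u}}
          (_ : D₀₁ = E₀₁) (_ : D₁₂ = E₁₂) (_ : D₂₃ = E₂₃) (_ : D₀₂ = E₀₂) (_ : D₁₃ = E₁₃)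
          (_ : D₀₃ = E₀₃) {F₀ : D₂₃ ⊗ D₁₂ ⟶ D₁₃} {F₁ : D₂₃ ⊗ D₀₂ ⟶ D₀₃} {F₂ : D₁₃ ⊗ D₀₁ ⟶ D₀₃}
          {F₃ : D₁₂ ⊗ D₀₁ ⟶ D₀₂} {G₀ : E₂₃ ⊗ E₁₂ ⟶ E₁₃} {G₁ : E₂₃ ⊗ E₀₂ ⟶ E₀₃}
          {G₂ : E₁₃ ⊗ E₀₁ ⟶ E₀₃} {G₃ : E₁₂ ⊗ E₀₁ ⟶ E₀₂} (_ : HEq F₀ G₀) (_ : HEq F₁ G₁)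
          (_ : HEq F₂ G₂) (_ : HEq F₃ G₃) (_ : E₂₃ ◁ G₃ ≫ G₁ = (α_ _ _ _).inv ≫ G₀ ▷ E₀₁ ≫ G₂),
          D₂₃ ◁ F₃ ≫ F₁ = (α_ _ _ _).inv ≫ F₀ ▷ D₀₁ ≫ F₂ := by
        rintro _ _ _ _ _ _ _ _ _ _ _ _ rfl rfl rfl rfl rfl rfl _ _ _ _ _ _ _ _ ⟨⟩ ⟨⟩ ⟨⟩ ⟨⟩ e
        exact e
      exact key (ha h.le) (ha h'.le) (ha h''.le) (ha (h.le.trans h'.le)) (ha (h'.le.trans h''.le))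
        (ha (h.le.trans (h'.le.trans h''.le))) (hα _ _ _ hf₀ t₀) (hα _ _ _ hf₁ t₁)
        (hα _ _ _ hf₂ t₂) (hα _ _ _ hf₃ t₃) (T.comp_assoc h.le h'.le h''.le))
  have obj {i j : Fin (n + 1)} (h : i < j) : ptOf (S.pt h.le) = T.ob i j h.le :=
    (congrArg ptOf (hS i j h)).trans (ha h.le)
  refine ⟨S, NerveSimplex.ext_of_lt (fun _ => rfl) (fun i j h => heq_of_eq (obj h))
    (fun i j k h h' => ?_), rfl⟩
  have t : IsTri (face S.base h.le h'.le) (edge S.base h'.le) (edge S.base h.le)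
      (edge S.base (h.le.trans h'.le)) := isTri_face _ _ _
  refine HEq.trans ?_ (hα h.le h'.le _ rfl t)
  have key : ∀ {x y z x' y' z' : Σ A, (CatOperad.ofTriangle p).cat A} (_ : x = x') (_ : y = y')
      (_ : z = z') {f : X _⦋2⦌} (t : IsTri f x.1 y.1 z.1) (t' : IsTri f x'.1 y'.1 z'.1)
      {β : ((CatOperad.ofTriangle p).mul f t).obj (x.2, y.2) ⟶ z.2}
      {β' : ((CatOperad.ofTriangle p).mul f t').obj (x'.2, y'.2) ⟶ z'.2} (_ : HEq β β'),
      HEq (ptHom (mulOf p f t) β) (ptHom (mulOf p f t') β') := by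
    rintro _ _ _ _ _ _ rfl rfl rfl f t t' _ _ ⟨⟩
    rfl
  exact key (hS j k h') (hS i j h) (hS i k (h.trans h')) (S.isTri _ _) t
    (hS' i j k h h' _ rfl rfl (S.isTri _ _) t)

variable (p)

/-- The Grothendieck construction of a 1-connected operad is the pullback of `(1/Cat)^△`. -/
lemma isPullback_totalToPointed :
    IsPullback (totalToPointed p)
      ((grothendieck.{max (u + 1) (v + 1), v, u} X).obj (CatOperad.ofTriangle p)).hom
      (triangleMap PtCat.forget.{v, u} PtCat.forget_isNormal) p := by
  refine IsPullback.of_forall_isPullback_app fun m => ?_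
  refine (Limits.Types.isPullback_iff _ _ _ _).2 ⟨?_, ?_, ?_⟩
  · ext S
    exact triangleSimplexMap_pointedSimplex S
  · rintro S T ⟨h, h'⟩
    exact pointedSimplex_injective h' h
  · intro T x h
    exact exists_pointedSimplex x T h

end OneConnected

end Pullback

end OperadicGrothendieck

theorem mainTheorem3 :
    -- the functors `∫_O` into the categories of operadic functors with codomain `O`
    (∃ G : ∀ O : UOpCat.{max w v u}, CatOperad.{max w v u, v, u} O.X ⥤ Over O,
      (∀ O : UOpCat.{max w v u},
        Nonempty (G O ⋙ Over.post UOpCat.forget ≅ grothendieck.{w, v, u} O.X) ∧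
          (G O).Full ∧ (G O).Faithful) ∧
      -- the functor `∫_⊙ : StrMonCat ⥤ UOpCat`, and `∫_⊙ V ≅ V^△`
      (StrMonCat.toOperad.{max w v u, v, u} ⋙ G UOpCat.terminal ⋙ Over.forget _).Full ∧
      (StrMonCat.toOperad.{max w v u, v, u} ⋙ G UOpCat.terminal ⋙ Over.forget _).Faithful ∧
      Nonempty ((StrMonCat.toOperad.{max w v u, v, u} ⋙ G UOpCat.terminal ⋙ Over.forget _) ⋙
        UOpCat.forget ≅ triangleFunctor.{v, u} ⋙ SSet.uliftFunctor.{w, max v u})) ∧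
    -- for a 1-connected operad `P : O ⟶ Cat^△`, `∫_O P` is the pullback of `P` along
    -- `(1/Cat)^△ ⟶ Cat^△`
    (∀ (O : UOpCat.{max (u + 1) (v + 1)}) (P : O.X ⟶ triangle Cat.{v, u}),
      ∃ t : total (CatOperad.ofTriangle P) ⟶ triangle PtCat.{v, u},
        IsPullback t
          ((grothendieck.{max (u + 1) (v + 1), v, u} O.X).obj (CatOperad.ofTriangle P)).hom
          (triangleMap PtCat.forget.{v, u} PtCat.forget_isNormal) P) := by
  refine ⟨⟨grothendieckUOpCat.{w, v, u}, fun O => ⟨⟨grothendieckUOpCatIso.{w, v, u} O⟩,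
    inferInstance, inferInstance⟩, ?_, ?_, ⟨totalTriangleIso.{w, v, u}⟩⟩,
    fun O P => ⟨totalToPointed P, isPullback_totalToPointed P⟩⟩
  · exact inferInstance
  · exact inferInstance
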